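/- Let $p\ge 5$ be a prime, let $k=\overline{\mathbb F}_p$ be an algebraic closure of $\mathbb F_p$, let $N\ge 4$ be an integer prime to $p$, and let $\kappa\ge 0$ be an integer. Write $\overline{p^\kappa}\in k$ for the residue of $p^\kappa$ (so it is $1$ if $\kappa=0$ and $0$ if $\kappa>0$). *Operators on $k[[q]]$.* For $\varphi=\sum_m a_mq^m\in k[[q]]$ put $U\varphi=\sum a_{mp}q^m$, $V\varphi=\sum a_mq^{mp}$, $\varphi^{(-1)}=\sum_{(n,p)=1}\frac{a_n}{n}q^n$ and, for $n\ge1$, $T_{\kappa+2}(n)\varphi=\sum_m\Big(\sum_{A\mid (n,m),\,(A,N)=1}A^{\kappa+1}a_{mn/A^2}\Big)q^m$. Given $\lambda_n\in k$ for all $n\geq 1$ prime to $p$ and $\lambda_p\in k$, an *eigenvector $\varphi\in qk[[q]]$ of all $T_{\kappa+2}(n)$, $T_{\kappa+2}(p)$, $(n,p)=1$, with eigenvalues $\lambda_n,\lambda_p$* is a $\varphi\in qk[[q]]$ with $\varphi\ne0$, $T_{\kappa+2}(n)\varphi=\lambda_n\varphi$ for $(n,p)=1$, and $T_{\kappa+2}(p)\varphi=\lambda_p\varphi$.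 *Operators on $k[[q]][q']$.* Let $\delta$ be the $p$-derivation for which $q'=\delta q$, that is $\delta x=(\phi(x)-x^p)/p$, where $\phi$ is the lift of Frobenius with $\phi(q)=q^p+pq'$ that acts on constants in $W(k)$ as the Witt vector Frobenius; values of $\delta$ are reduced mod $p$. For $f=f(q,q')\in k[[q]][q']$: (a) for $n\geq 1$ prime to $p$, fix a primitive $n$-th root of unity $\zeta_n$, put $\zeta_D=\zeta_n^{n/D}$ for $D\mid n$, and put $$T_\kappa(n)f=n^{\kappa-1}\sum_{AD=n,\ (A,N)=1,\ 0\le B<D}D^{-\kappa}f\big(\zeta_D^Bq^{A/D},\delta(\zeta_D^Bq^{A/D})\big),$$ an identity in $k((q_n))[q_n']\supset k((q))[q']$, where $q_n=q^{1/n}$, $q_n'=\delta q_n$ (so $q=q_n^n$, $q'=\delta(q_n^n)$); (b) $f$ is *Taylor $\delta$-$p$-symmetric* if $\Sigma_pf:=\sum_{j=1}^pf(q_j,q_j')\in k[[q_1,\dots,q_p]][q_1',\dots,q_p']$ is the image of some $G\in k[[s_1,\dots,s_p]][s_1',\dots,s_p']$ under the (injective) map $s_j\mapsto S_j$, $s_j'\mapsto\delta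 S_j$, with $S_j$ the elementary symmetric polynomials in $q_1,\dots,q_p$; then "$pU$"$f:=G(0,\dots,0,q,0,\dots,0,q')$ (all $s_j,s_j'$ with $j<p$ are set to $0$, $s_p=q$, $s_p'=q'$), and "$pT_\kappa(p)$"$f:=$ "$pU$"$f+\overline{p^\kappa}\,Vf$, where $Vf=f(q^p,\delta(q^p))$. Call $f$ an *eigenvector of all $nT_\kappa(n)$, "$pT_\kappa(p)$", $(n,p)=1$, with eigenvalues $\lambda_n,\lambda_p$* if $f$ is Taylor $\delta$-$p$-symmetric, $nT_\kappa(n)f=\lambda_nf$ for $(n,p)=1$, and "$pT_\kappa(p)$"$f=\lambda_pf$. Call $f$ *primitive* if $U(f(q,0))=0$. Let $F_{/k}$ be the $k$-algebra endomorphism of $k[[q]][q']$ with $q\mapsto q^p$, $q'\mapsto(q')^p$; it makes $k[[q]][q']$ a module over the polynomial ring $k[F_{/k}]$, and $qk[[q]]$ is a module over the power series ring $k[[F_{/k}]]$ by $(\sum c_iF_{/k}^i)\varphi=\sum c_iV^i\varphi$. For $\varphi\in qk[[q]]$ put $$\varphi^{\sharp,2}=\varphi^{(-1)}-\lambda_pV(\varphi)\frac{q'}{q^p}+\overline{p^\kappa}\,V^2(\varphi)\Big(\frac{q'}{q^p}\Big)^p\in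 k[[q]][q'].$$ **Corollary.** Fix $\lambda_n\in k$ for $(n,p)=1$ and $\lambda_p\in k$. Let $\mathcal F$ be the $k$-linear space of all $f\in k[[q]][q']$ with $f(0,0)=0$ which are either $0$ or eigenvectors of all $nT_\kappa(n)$, "$pT_\kappa(p)$", $(n,p)=1$, with eigenvalues $\lambda_n,\lambda_p$. Then $\mathcal F\neq0$ if and only if there is an eigenvector $\varphi\in qk[[q]]$ of all $T_{\kappa+2}(n)$, $T_{\kappa+2}(p)$, $(n,p)=1$, with eigenvalues $\lambda_n,\lambda_p$. Let $\varphi$ be any such eigenvector. Then $\varphi^{\sharp,2}$ belongs to $\mathcal F$ and is primitive, and every primitive element of $\mathcal F$ is a $k$-multiple of $\varphi^{\sharp,2}$. Furthermore: 1) If $\kappa>0$ and $\lambda_p=0$, then $\mathcal F$ is contained in $qk[[q]]$ and is a free $k[[F_{/k}]]$-submodule of it of rank $1$ with basis $\varphi^{\sharp,2}=\varphi^{(-1)}$. 2) If either $\kappa>0$, $\lambda_p\ne0$, or $\kappa=0$, $\lambda_p=0$, then $\mathcal F$ is a free $k[F_{/k}]$-submodule of $k[[q]][q']$ of rank $1$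 with basis $\varphi^{\sharp,2}$. 3) If $\kappa=0$ and $\lambda_p\neq0$, then the sum $\varphi^{\sharp,1}:=\Big(\sum_{i\ge0}\lambda_p^{-i}F_{/k}^i\Big)\varphi^{\sharp,2}$ converges coefficientwise to an element of $k[[q]][q']$, and $\mathcal F$ is a free $k[F_{/k}]$-submodule of $k[[q]][q']$ of rank $1$ with basis $\varphi^{\sharp,1}$. -/

import Mathlib

open scoped PowerSeries

noncomputable section

namespace DeltaHecke

/-! ## The universal `p`-derivation on integral polynomials -/

section Delta

variable {σ : Type*} (p : ℕ) [Fact p.Prime]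

/-- The universal value `δ P` of a `p`-derivation on an integral polynomial `P` in the variables
`x_i`.  It is an integral polynomial in `x_i = X (i, 0)` and `x_i' = δ x_i = X (i, 1)`, given by
`p * δ P = P(x_i ^ p + p * x_i') - P(x_i) ^ p`, see `p_mul_deltaPoly`. -/
def deltaPoly (P : MvPolynomial σ ℤ) : MvPolynomial (σ × ℕ) ℤ :=
  wittStructureInt p P 1

/-- The defining property of `deltaPoly`, for the lift of Frobenius `x ↦ x ^ p + p * x'`. -/
theorem p_mul_deltaPoly (P : MvPolynomial σ ℤ) :
    (p : MvPolynomial (σ × ℕ) ℤ) * deltaPoly p P =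
      MvPolynomial.aeval (fun i : σ =>
          (MvPolynomial.X (i, 0) : MvPolynomial (σ × ℕ) ℤ) ^ p +
            (p : MvPolynomial (σ × ℕ) ℤ) * MvPolynomial.X (i, 1)) P
        - (MvPolynomial.aeval (fun i : σ => MvPolynomial.X (i, 0)) P) ^ p := by
  have h1 := wittStructureInt_prop p P 1
  have h0 := wittStructureInt_prop p P 0
  have hW1 : wittPolynomial p ℤ 1 =
      (MvPolynomial.X 0 : MvPolynomial ℕ ℤ) ^ p + (p : MvPolynomial ℕ ℤ) * MvPolynomial.X 1 := by
    rw [wittPolynomial_one, add_comm]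
    simp
  simp only [wittPolynomial_zero, MvPolynomial.bind₁_X_right, MvPolynomial.rename_X] at h0
  rw [hW1] at h1
  simp only [map_add, map_mul, map_pow, map_natCast, MvPolynomial.bind₁_X_right,
    MvPolynomial.rename_X] at h1
  rw [h0] at h1
  simp only [MvPolynomial.bind₁] at h1
  rw [← h1, deltaPoly]
  ring

/-- The value of `δ P` when the variables `x_i` and their derivatives `δ x_i` take the values
`x i` and `x' i` in a commutative ring. -/
def deltaEval {B : Type*} [CommRing B] (P : MvPolynomial σ ℤ) (x x' : σ → B) : B :=
  MvPolynomial.aeval (fun v : σ × ℕ => if v.2 = 0 then x v.1 else x' v.1) (deltaPoly p P)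

end Delta

/-! ## `δ`-series of order one over a field and substitutions into them -/

/-- `k[[x_i]][x_i']`, the `δ`-series mod `p` of order one in the variables `x_i`, `i ∈ σ`:
the variables of the coefficient ring are the `x_i`, the polynomial variables are the `x_i'`.
For `σ = Unit` this is `k[[q]][q']`. -/
abbrev DSer (σ : Type*) (k : Type*) [Field k] : Type _ := MvPolynomial σ (MvPowerSeries σ k)

section Subst

variable {σ τ : Type*} {k : Type*} [Field k]

/-- A power series in the `x_i`, seen as a `δ`-series (of order zero). -/
abbrev DSer.ofSeries (φ : MvPowerSeries σ k) : DSer σ k := MvPolynomial.C φ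

/-- The variable `x_i`. -/
def DSer.var (i : σ) : DSer σ k := MvPolynomial.C (MvPowerSeries.X i)

/-- The variable `x_i' = δ x_i`. -/
def DSer.var' (i : σ) : DSer σ k := MvPolynomial.X i

/-- The `k`-algebra homomorphism `k[[x_i]][x_i'] → k[[y_j]][y_j']` that substitutes `a i` for
`x_i` and `b i` for `x_i'`. -/
def DSer.subst (a : σ → MvPowerSeries τ k) (ha : MvPowerSeries.HasSubst a) (b : σ → DSer τ k) :
    DSer σ k →ₐ[k] DSer τ k :=
  MvPolynomial.aevalTower
    ((IsScalarTower.toAlgHom k (MvPowerSeries τ k) (DSer τ k)).comp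
      (MvPowerSeries.substAlgHom (R := k) ha)) b

end Subst

section OneVariable

variable {k : Type*} [Field k]

/-- The constant term `f(0, 0)` of `f ∈ k[[q]][q']`. -/
def constTerm (f : DSer Unit k) : k := PowerSeries.constantCoeff (MvPolynomial.constantCoeff f)

/-- The specialization `f(q, 0) ∈ k[[q]]` of `f ∈ k[[q]][q']`. -/
def atZero (f : DSer Unit k) : k⟦X⟧ := MvPolynomial.constantCoeff f

/-- The coefficient of `q ^ m * (q') ^ m'` in `f ∈ k[[q]][q']`. -/
def dcoeff (m m' : ℕ) (f : DSer Unit k) : k :=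
  PowerSeries.coeff m (MvPolynomial.coeff (Finsupp.single () m') f)

theorem hasSubst_const_monomial (c : k) {m : ℕ} (hm : m ≠ 0) :
    MvPowerSeries.HasSubst
      (fun _ : Unit => ((PowerSeries.C c * PowerSeries.X ^ m : k⟦X⟧) : MvPowerSeries Unit k)) := by
  apply MvPowerSeries.hasSubst_of_constantCoeff_zero
  intro _
  change PowerSeries.constantCoeff (PowerSeries.C c * PowerSeries.X ^ m : k⟦X⟧) = 0
  simp [hm]

/-- For `c ∈ k` and `m ≥ 1`, the substitution `f ↦ f(c y ^ m, δ(c y ^ m))` from `k[[q]][q']` to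
`k[[y]][y']`, where `c` stands for a constant with `δ c = 0`
(a root of unity, or a Teichmüller representative, in the ring of Witt vectors of `k`). -/
def scale (p : ℕ) [Fact p.Prime] (c : k) (m : ℕ) (hm : m ≠ 0) : DSer Unit k →ₐ[k] DSer Unit k :=
  DSer.subst (fun _ => PowerSeries.C c * PowerSeries.X ^ m) (hasSubst_const_monomial c hm)
    (fun _ => deltaEval p (MvPolynomial.X 0 * MvPolynomial.X 1 ^ m : MvPolynomial (Fin 2) ℤ)
      ![DSer.ofSeries (PowerSeries.C c), DSer.var ()] ![0, DSer.var' ()])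

/-! ## The operators `V`, `U`, `φ ↦ φ^{(-1)}` and the classical Hecke operators on `k[[q]]` -/

/-- `V (∑ a_n q ^ n) = ∑ a_n q ^ (p n)`. -/
def vOp (p : ℕ) (φ : k⟦X⟧) : k⟦X⟧ :=
  PowerSeries.mk fun m => if p ∣ m then PowerSeries.coeff (m / p) φ else 0

/-- `U (∑ a_n q ^ n) = ∑ a_{n p} q ^ n`. -/
def uOp (p : ℕ) (φ : k⟦X⟧) : k⟦X⟧ := PowerSeries.mk fun m => PowerSeries.coeff (m * p) φ

/-- `φ^{(-1)} = ∑_{(n, p) = 1} (a_n / n) q ^ n` for `φ = ∑ a_n q ^ n`. -/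
def antiTheta (p : ℕ) (φ : k⟦X⟧) : k⟦X⟧ :=
  PowerSeries.mk fun n => if n.Coprime p then PowerSeries.coeff n φ / (n : k) else 0

/-- The classical Hecke operator `T_w(n)` of weight `w` and level `N` on `q`-expansions:
the `m`-th coefficient of `T_w(n) (∑ a_m q ^ m)` is the sum of `A ^ (w - 1) * a_{m n / A ^ 2}`
over the common divisors `A` of `n` and `m` that are prime to `N`. -/
def classicalHecke (N w n : ℕ) (φ : k⟦X⟧) : k⟦X⟧ :=
  PowerSeries.mk fun m => ∑ A ∈ (Nat.gcd n m).divisors with A.Coprime N,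
    (A : k) ^ (w - 1) * PowerSeries.coeff (m * n / A ^ 2) φ

/-- `φ ∈ q k[[q]]` is an eigenvector of all Hecke operators `T_{κ+2}(n)`, `(n, p) = 1`, and
`T_{κ+2}(p)`, with eigenvalues `lam n` and `lamp`. -/
structure IsClassicalEigen (p N κ : ℕ) (lam : ℕ → k) (lamp : k) (φ : k⟦X⟧) : Prop where
  constantCoeff_eq : PowerSeries.constantCoeff φ = 0
  ne_zero : φ ≠ 0
  away : ∀ n : ℕ, 1 ≤ n → n.Coprime p → classicalHecke N (κ + 2) n φ = lam n • φ
  at_p : classicalHecke N (κ + 2) p φ = lamp • φ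

/-! ## Hecke operators on `k[[q]][q']` -/

/-- The Hecke operator `T_κ(n)` on `f ∈ k[[q]][q']`, for `n` prime to `p`:
`n ^ (κ - 1) * ∑ D ^ (-κ) * f(ζ_D ^ B q ^ (A / D), δ(ζ_D ^ B q ^ (A / D)))`, the sum being over
`A, B, D ≥ 0` with `A D = n`, `(A, N) = 1` and `B < D`.  Here `ζ_D = ζ_n ^ (n / D)`.
The value is in `k[[q_n]][q_n'] ⊆ k((q_n))[q_n']` where `q_n = q ^ (1 / n)`; so
`ζ_D ^ B q ^ (A / D) = ζ_n ^ (A B) q_n ^ (A ^ 2)`, because `n / D = A`. -/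
def deltaHecke (p : ℕ) [Fact p.Prime] (N κ n : ℕ) (ζ : k) (f : DSer Unit k) : DSer Unit k :=
  (n : k) ^ ((κ : ℤ) - 1) • ∑ A ∈ n.divisors.attach with A.1.Coprime N,
    ∑ B ∈ Finset.range (n / A.1), ((n / A.1 : ℕ) : k) ^ (-(κ : ℤ)) •
      scale p (ζ ^ (A.1 * B)) (A.1 ^ 2) (pow_ne_zero 2 (Nat.pos_of_mem_divisors A.2).ne') f

/-- The inclusion of `k[[q]][q']` in `k((q_n))[q_n']`, `q_n = q ^ (1 / n)`: it sends `q` to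
`q_n ^ n` and `q'` to `δ (q_n ^ n)`. -/
def toRoot (p : ℕ) [Fact p.Prime] (n : ℕ) (hn : n ≠ 0) : DSer Unit k →ₐ[k] DSer Unit k :=
  scale p 1 n hn

/-- The endomorphism `V` of `k[[q]][q']`, `f ↦ f(q ^ p, δ (q ^ p))`. -/
def deltaV (p : ℕ) [hp : Fact p.Prime] : DSer Unit k →ₐ[k] DSer Unit k :=
  scale p 1 p hp.out.ne_zero

/-- The relative Frobenius `F_{/k}` of `k[[q]][q']`: the `k`-algebra endomorphism that sends
`q` to `q ^ p` and `q'` to `(q') ^ p`. -/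
def relFrob (k : Type*) [Field k] (p : ℕ) [hp : Fact p.Prime] : DSer Unit k →ₐ[k] DSer Unit k :=
  DSer.subst (fun i => (MvPowerSeries.X i : MvPowerSeries Unit k) ^ p)
    (MvPowerSeries.HasSubst.X_pow hp.out.ne_zero) (fun i => DSer.var' i ^ p)

end OneVariable

/-! ## `δ`-symmetry and the Hecke operator at `p` -/

section AtP

variable {k : Type*} [Field k]

/-- `Σ_p f = ∑_j f(q_j, q_j') ∈ k[[q_1, …, q_p]][q_1', …, q_p']` for `f ∈ k[[q]][q']`. -/
def sigmaP (p : ℕ) (f : DSer Unit k) : DSer (Fin p) k :=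
  ∑ j : Fin p, DSer.subst (fun _ : Unit => (MvPowerSeries.X j : MvPowerSeries (Fin p) k))
    (MvPowerSeries.hasSubst_of_constantCoeff_zero fun _ => MvPowerSeries.constantCoeff_X j)
    (fun _ => DSer.var' j) f

theorem hasSubst_esymm (k : Type*) [Field k] (p : ℕ) :
    MvPowerSeries.HasSubst (fun j : Fin p =>
      ((MvPolynomial.esymm (Fin p) k (j.1 + 1) : MvPolynomial (Fin p) k) :
        MvPowerSeries (Fin p) k)) := by
  apply MvPowerSeries.hasSubst_of_constantCoeff_zero
  intro j
  rw [← MvPowerSeries.coeff_zero_eq_constantCoeff_apply, MvPolynomial.coeff_coe,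
    ← MvPolynomial.constantCoeff_eq, MvPolynomial.esymm, map_sum]
  refine Finset.sum_eq_zero fun t ht => ?_
  rw [map_prod]
  have hc : t.card = j.1 + 1 := (Finset.mem_powersetCard.mp ht).2
  obtain ⟨x, hx⟩ : t.Nonempty := Finset.card_pos.mp (by omega)
  exact Finset.prod_eq_zero hx (MvPolynomial.constantCoeff_X (R := k) x)

/-- The homomorphism `k[[s_1, …, s_p]][s_1', …, s_p'] → k[[q_1, …, q_p]][q_1', …, q_p']` with
`s_j ↦ S_j` and `s_j' ↦ δ S_j`, where `S_1, …, S_p` are the elementary symmetric polynomials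
in `q_1, …, q_p`. The index `j : Fin p` stands for `j + 1`. -/
def symmHom (k : Type*) [Field k] (p : ℕ) [Fact p.Prime] : DSer (Fin p) k →ₐ[k] DSer (Fin p) k :=
  DSer.subst
    (fun j => ((MvPolynomial.esymm (Fin p) k (j.1 + 1) : MvPolynomial (Fin p) k) :
      MvPowerSeries (Fin p) k))
    (hasSubst_esymm k p)
    (fun j => deltaEval p (MvPolynomial.esymm (Fin p) ℤ (j.1 + 1)) DSer.var DSer.var')

/-- `G ↦ G(0, …, 0, q, 0, …, 0, q')`: the substitution `s_p ↦ q`, `s_p' ↦ q'` and `s_j ↦ 0`,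
`s_j' ↦ 0` for `j < p`. -/
def specialize (k : Type*) [Field k] (p : ℕ) : DSer (Fin p) k →ₐ[k] DSer Unit k :=
  DSer.subst
    (fun j : Fin p => if j.1 + 1 = p then (MvPowerSeries.X () : MvPowerSeries Unit k) else 0)
    (MvPowerSeries.hasSubst_of_constantCoeff_zero fun j => by
      split_ifs <;> simp)
    (fun j => if j.1 + 1 = p then DSer.var' () else 0)

/-- `f ∈ k[[q]][q']` is Taylor `δ`-`p`-symmetric. -/
def IsTaylorSymmetric (p : ℕ) [Fact p.Prime] (f : DSer Unit k) : Prop :=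
  ∃ G : DSer (Fin p) k, symmHom k p G = sigmaP p f

/-- The graph of the partially defined operator "`pT_κ(p)`" on `k[[q]][q']`:
`f` is Taylor `δ`-`p`-symmetric and "`pT_κ(p)`" `f = "pU" f + p ^ κ V f` is equal to `g`, where
"`pU`" `f = G(0, …, 0, q, 0, …, 0, q')` for the `G` whose image under `symmHom` is `Σ_p f`. -/
def IsHeckeAtP (p : ℕ) [Fact p.Prime] (κ : ℕ) (f g : DSer Unit k) : Prop :=
  ∃ G : DSer (Fin p) k, symmHom k p G = sigmaP p f ∧
    specialize k p G + (p : k) ^ κ • deltaV p f = g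

/-- `f ∈ k[[q]][q']` is Taylor `δ`-`p`-symmetric and satisfies `n T_κ(n) f = lam n * f` for all
`n` prime to `p` (an equality in `k((q_n))[q_n']`, `q_n = q ^ (1 / n)`) and
"`pT_κ(p)`" `f = lamp * f`.  The family `ζ` consists of the chosen `n`-th roots of unity. -/
structure IsDeltaEigen (p : ℕ) [Fact p.Prime] (N κ : ℕ) (ζ lam : ℕ → k) (lamp : k)
    (f : DSer Unit k) : Prop where
  symmetric : IsTaylorSymmetric p f
  away : ∀ (n : ℕ) (hn : n ≠ 0), n.Coprime p →
    (n : k) • deltaHecke p N κ n (ζ n) f = lam n • toRoot p n hn f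
  at_p : IsHeckeAtP p κ f (lamp • f)

theorem sigmaP_add (p : ℕ) (f g : DSer Unit k) : sigmaP p (f + g) = sigmaP p f + sigmaP p g := by
  simp [sigmaP, Finset.sum_add_distrib]

theorem sigmaP_smul (p : ℕ) (c : k) (f : DSer Unit k) : sigmaP p (c • f) = c • sigmaP p f := by
  simp [sigmaP, Finset.smul_sum]

theorem deltaHecke_add (p : ℕ) [Fact p.Prime] (N κ n : ℕ) (ζ : k)
    (f g : DSer Unit k) :
    deltaHecke p N κ n ζ (f + g) = deltaHecke p N κ n ζ f + deltaHecke p N κ n ζ g := by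
  simp only [deltaHecke, map_add, smul_add, Finset.sum_add_distrib]

theorem deltaHecke_smul (p : ℕ) [Fact p.Prime] (N κ n : ℕ) (ζ c : k)
    (f : DSer Unit k) :
    deltaHecke p N κ n ζ (c • f) = c • deltaHecke p N κ n ζ f := by
  simp only [deltaHecke, map_smul, Finset.smul_sum, smul_comm c]

theorem IsDeltaEigen.smul {p : ℕ} [Fact p.Prime] {N κ : ℕ} {ζ lam : ℕ → k} {lamp : k}
    {f : DSer Unit k} (c : k) (hf : IsDeltaEigen p N κ ζ lam lamp f) :
    IsDeltaEigen p N κ ζ lam lamp (c • f) where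
  symmetric := by
    obtain ⟨G, hG⟩ := hf.symmetric
    exact ⟨c • G, by rw [map_smul, hG, sigmaP_smul]⟩
  away n hn hc := by
    rw [deltaHecke_smul, map_smul, smul_comm, hf.away n hn hc, smul_comm]
  at_p := by
    obtain ⟨G, hG, h⟩ := hf.at_p
    refine ⟨c • G, by rw [map_smul, hG, sigmaP_smul], ?_⟩
    rw [map_smul, map_smul, smul_comm lamp, ← h, smul_add, smul_comm c]

theorem IsDeltaEigen.add {p : ℕ} [Fact p.Prime] {N κ : ℕ} {ζ lam : ℕ → k} {lamp : k}
    {f g : DSer Unit k} (hf : IsDeltaEigen p N κ ζ lam lamp f)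
    (hg : IsDeltaEigen p N κ ζ lam lamp g) :
    IsDeltaEigen p N κ ζ lam lamp (f + g) where
  symmetric := by
    obtain ⟨G, hG⟩ := hf.symmetric
    obtain ⟨H, hH⟩ := hg.symmetric
    exact ⟨G + H, by rw [map_add, hG, hH, sigmaP_add]⟩
  away n hn hc := by
    rw [deltaHecke_add, map_add, smul_add, smul_add, hf.away n hn hc, hg.away n hn hc]
  at_p := by
    obtain ⟨G, hG, h⟩ := hf.at_p
    obtain ⟨H, hH, h'⟩ := hg.at_p
    refine ⟨G + H, by rw [map_add, hG, hH, sigmaP_add], ?_⟩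
    rw [map_add, map_add, smul_add, smul_add, ← h, ← h']
    abel

/-- The `k`-linear space `𝓕` of all `f ∈ k[[q]][q']` with `f(0, 0) = 0` that are either `0` or
eigenvectors of all Hecke operators `n T_κ(n)`, "`pT_κ(p)`", `(n, p) = 1`, with the given
eigenvalues. -/
def eigenSpace (p : ℕ) [Fact p.Prime] (N κ : ℕ) (ζ lam : ℕ → k) (lamp : k) :
    Submodule k (DSer Unit k) where
  carrier := {f | constTerm f = 0 ∧ (f = 0 ∨ IsDeltaEigen p N κ ζ lam lamp f)}
  zero_mem' := ⟨by simp [constTerm], Or.inl rfl⟩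
  add_mem' := by
    rintro f g ⟨hf0, hf⟩ ⟨hg0, hg⟩
    refine ⟨by simp only [constTerm, map_add] at *; rw [hf0, hg0, add_zero], ?_⟩
    rcases hf with rfl | hf
    · rwa [zero_add]
    rcases hg with rfl | hg
    · rw [add_zero]; exact Or.inr hf
    · exact Or.inr (hf.add hg)
  smul_mem' := by
    rintro c f ⟨hf0, hf⟩
    refine ⟨?_, ?_⟩
    · simp only [constTerm] at *
      rw [MvPolynomial.constantCoeff_smul, PowerSeries.constantCoeff_smul, hf0, smul_zero]
    · rcases hf with rfl | hf
      · exact Or.inl (smul_zero c)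
      · exact Or.inr (hf.smul c)

/-- `f ∈ k[[q]][q']` is primitive: `U (f(q, 0)) = 0`. -/
def IsPrimitiveSeries (p : ℕ) (f : DSer Unit k) : Prop := uOp p (atZero f) = 0

end AtP

/-! ## The series `φ^{♯,2}` and infinite sums of powers of Frobenius -/

section Sharp

variable {k : Type*} [Field k]

/-- The quotient `φ / q ^ n`, for `φ` divisible by `q ^ n`. -/
def divQPow (n : ℕ) (φ : k⟦X⟧) : k⟦X⟧ := PowerSeries.mk fun m => PowerSeries.coeff (m + n) φ

/-- For `φ ∈ q k[[q]]`, the `δ`-series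
`φ^{♯,2} = φ^{(-1)} - lamp * V(φ) * (q' / q ^ p) + p ^ κ * V ^ 2 (φ) * (q' / q ^ p) ^ p`. -/
def sharpTwo (p κ : ℕ) (lamp : k) (φ : k⟦X⟧) : DSer Unit k :=
  DSer.ofSeries (antiTheta p φ)
    - lamp • (DSer.ofSeries (divQPow p (vOp p φ)) * DSer.var' ())
    + (p : k) ^ κ • (DSer.ofSeries (divQPow (p ^ 2) (vOp p (vOp p φ))) * DSer.var' () ^ p)

/-- `g = (∑_{i ≥ 0} c_i F_{/k} ^ i) h` in `k[[q]][q']`: each coefficient of the partial sums is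
eventually equal to that of `g`. -/
def HasFrobSum (p : ℕ) [Fact p.Prime] (c : ℕ → k) (h g : DSer Unit k) : Prop :=
  ∀ m m' : ℕ, ∀ᶠ n in Filter.atTop,
    dcoeff m m' (∑ i ∈ Finset.range n, c i • (relFrob k p)^[i] h) = dcoeff m m' g

/-! ## `q k[[q]]` as a module over the power series ring `k[[F_{/k}]]` -/

theorem coeff_vOp (p : ℕ) (φ : k⟦X⟧) (m : ℕ) :
    PowerSeries.coeff m (vOp p φ) = if p ∣ m then PowerSeries.coeff (m / p) φ else 0 :=
  PowerSeries.coeff_mk _ _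

theorem coeff_vOp_iterate (p : ℕ) (φ : k⟦X⟧) (i m : ℕ) :
    PowerSeries.coeff m ((vOp p)^[i] φ) =
      if p ^ i ∣ m then PowerSeries.coeff (m / p ^ i) φ else 0 := by
  induction i generalizing φ with
  | zero => simp
  | succ i ih =>
    rw [Function.iterate_succ_apply, ih]
    by_cases h : p ^ i ∣ m
    · rw [if_pos h, coeff_vOp, Nat.div_div_eq_div_mul, ← pow_succ]
      have : p ∣ m / p ^ i ↔ p ^ (i + 1) ∣ m := by
        obtain ⟨c, rfl⟩ := h
        rcases Nat.eq_zero_or_pos (p ^ i) with h0 | h0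
        · have hp : p = 0 := by
            by_contra hp
            exact (pow_ne_zero i hp) h0
          subst hp
          simp [h0]
        · rw [Nat.mul_div_cancel_left _ h0, pow_succ, Nat.mul_dvd_mul_iff_left h0]
      simp only [this]
    · rw [if_neg h, if_neg fun h' => h ((pow_dvd_pow p (Nat.le_succ i)).trans h')]

theorem coeff_vOp_iterate_eq_zero {p : ℕ} (hp : 1 < p) {φ : k⟦X⟧}
    (hφ : PowerSeries.coeff 0 φ = 0) {i m : ℕ} (h : m < i) :
    PowerSeries.coeff m ((vOp p)^[i] φ) = 0 := by
  rw [coeff_vOp_iterate]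
  split_ifs with hd
  · have : m < p ^ i := h.trans (Nat.lt_pow_self hp)
    rwa [Nat.div_eq_of_lt this]
  · rfl

/-- `(∑ c_i F_{/k} ^ i) φ = ∑ c_i V ^ i φ` for `φ ∈ q k[[q]]`. On the `m`-th coefficient only the
indices `i ≤ m` contribute, see `coeff_vOp_iterate_eq_zero`. -/
def frobSum (p : ℕ) (c φ : k⟦X⟧) : k⟦X⟧ :=
  PowerSeries.mk fun m => ∑ i ∈ Finset.range (m + 1),
    PowerSeries.coeff i c * PowerSeries.coeff m ((vOp p)^[i] φ)

theorem coeff_frobSum {p : ℕ} (hp : 1 < p) (c : k⟦X⟧) {φ : k⟦X⟧}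
    (hφ : PowerSeries.coeff 0 φ = 0) {m M : ℕ} (h : m < M) :
    PowerSeries.coeff m (frobSum p c φ) = ∑ i ∈ Finset.range M,
      PowerSeries.coeff i c * PowerSeries.coeff m ((vOp p)^[i] φ) := by
  rw [frobSum, PowerSeries.coeff_mk]
  refine Finset.sum_subset (Finset.range_mono h) fun i _ hi => ?_
  rw [coeff_vOp_iterate_eq_zero hp hφ (by simpa using hi), mul_zero]

theorem coeff_zero_frobSum (p : ℕ) (c : k⟦X⟧) {φ : k⟦X⟧} (hφ : PowerSeries.coeff 0 φ = 0) :
    PowerSeries.coeff 0 (frobSum p c φ) = 0 := by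
  rw [frobSum, PowerSeries.coeff_mk]
  simp only [zero_add, Finset.sum_range_one, Function.iterate_zero, id_eq, hφ, mul_zero]

theorem vOp_iterate_add (p i : ℕ) (φ ψ : k⟦X⟧) :
    (vOp p)^[i] (φ + ψ) = (vOp p)^[i] φ + (vOp p)^[i] ψ := by
  ext m
  simp only [map_add, coeff_vOp_iterate]
  split_ifs <;> simp

theorem vOp_iterate_frobSum {p : ℕ} (hp : 1 < p) (c : k⟦X⟧) {φ : k⟦X⟧}
    (hφ : PowerSeries.coeff 0 φ = 0) {i m M : ℕ} (h : m < M) :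
    PowerSeries.coeff m ((vOp p)^[i] (frobSum p c φ)) = ∑ j ∈ Finset.range M,
      PowerSeries.coeff j c * PowerSeries.coeff m ((vOp p)^[i + j] φ) := by
  rw [coeff_vOp_iterate]
  split_ifs with hd
  · rw [coeff_frobSum hp c hφ (lt_of_le_of_lt (Nat.div_le_self _ _) h)]
    refine Finset.sum_congr rfl fun j _ => ?_
    rw [Function.iterate_add_apply, coeff_vOp_iterate p ((vOp p)^[j] φ) i m, if_pos hd]
  · refine (Finset.sum_eq_zero fun j _ => ?_).symm
    rw [Function.iterate_add_apply, coeff_vOp_iterate p ((vOp p)^[j] φ) i m, if_neg hd, mul_zero]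

theorem frobSum_mul {p : ℕ} (hp : 1 < p) (c d : k⟦X⟧) {φ : k⟦X⟧}
    (hφ : PowerSeries.coeff 0 φ = 0) :
    frobSum p (c * d) φ = frobSum p c (frobSum p d φ) := by
  ext m
  rw [coeff_frobSum hp _ hφ (Nat.lt_succ_self m),
    coeff_frobSum hp _ (coeff_zero_frobSum p d hφ) (Nat.lt_succ_self m)]
  have hR : ∀ i ∈ Finset.range (m + 1),
      PowerSeries.coeff i c * PowerSeries.coeff m ((vOp p)^[i] (frobSum p d φ)) =
        ∑ j ∈ Finset.range (m + 1 - i), PowerSeries.coeff i c *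
          (PowerSeries.coeff j d * PowerSeries.coeff m ((vOp p)^[i + j] φ)) := by
    intro i hi
    rw [vOp_iterate_frobSum hp d hφ (Nat.lt_succ_self m), Finset.mul_sum]
    refine (Finset.sum_subset (Finset.range_mono (Nat.sub_le _ _)) fun j _ hj => ?_).symm
    have : m < i + j := by
      simp only [Finset.mem_range] at hj hi
      omega
    rw [coeff_vOp_iterate_eq_zero hp hφ this, mul_zero, mul_zero]
  rw [Finset.sum_congr rfl hR, Finset.range_eq_Ico]
  simp only [Finset.range_eq_Ico]
  have key := Finset.sum_sigma' (Finset.Ico 0 (m + 1))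
    (fun i => Finset.Ico 0 (m + 1 - i)) (fun i j => PowerSeries.coeff i c *
          (PowerSeries.coeff j d * PowerSeries.coeff m ((vOp p)^[i + j] φ)))
  rw [key]
  simp only [PowerSeries.coeff_mul, Finset.sum_mul]
  rw [Finset.sum_sigma']
  refine Finset.sum_bij' (fun x _ => ⟨x.2.1, x.2.2⟩) (fun x _ => ⟨x.1 + x.2, (x.1, x.2)⟩)
    ?_ ?_ ?_ ?_ ?_
  · rintro ⟨l, i, j⟩ h
    simp at h ⊢
    omega
  · rintro ⟨i, j⟩ h
    simp at h ⊢
    omega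
  · rintro ⟨l, i, j⟩ h
    simp at h
    obtain ⟨_, rfl⟩ := h
    rfl
  · rintro ⟨i, j⟩ h
    rfl
  · rintro ⟨l, i, j⟩ h
    simp at h
    obtain ⟨_, rfl⟩ := h
    simp [mul_assoc]

/-- The ideal `q k[[q]]`, with its additive group structure only. -/
def QSeries (_p : ℕ) (k : Type*) [Field k] : Type _ :=
  (LinearMap.ker (PowerSeries.coeff (R := k) 0) : Submodule k k⟦X⟧)

instance (p : ℕ) : AddCommGroup (QSeries p k) :=
  inferInstanceAs (AddCommGroup (LinearMap.ker (PowerSeries.coeff (R := k) 0)))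

/-- The underlying power series. -/
def QSeries.toSeries {p : ℕ} (φ : QSeries p k) : k⟦X⟧ := φ.1

theorem QSeries.coeff_zero {p : ℕ} (φ : QSeries p k) : PowerSeries.coeff 0 φ.toSeries = 0 := φ.2

/-- `k[[F_{/k}]] = k[[X]]` acts on `q k[[q]]` by `(∑ c_i X ^ i) • φ = ∑ c_i V ^ i φ`. -/
instance (p : ℕ) [hp : Fact p.Prime] : Module k⟦X⟧ (QSeries p k) where
  smul c φ := ⟨frobSum p c φ.toSeries, coeff_zero_frobSum p c φ.coeff_zero⟩
  one_smul φ := by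
    refine Subtype.ext (PowerSeries.ext fun m => ?_)
    change PowerSeries.coeff m (frobSum p 1 φ.toSeries) = PowerSeries.coeff m φ.toSeries
    rw [frobSum, PowerSeries.coeff_mk, Finset.sum_range_succ']
    simp [PowerSeries.coeff_one]
  mul_smul c d φ := Subtype.ext (frobSum_mul hp.out.one_lt c d φ.coeff_zero)
  smul_zero c := by
    refine Subtype.ext (PowerSeries.ext fun m => ?_)
    change PowerSeries.coeff m (frobSum p c 0) = PowerSeries.coeff m 0
    simp [frobSum, coeff_vOp_iterate]
  smul_add c φ ψ := by
    refine Subtype.ext (PowerSeries.ext fun m => ?_)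
    change PowerSeries.coeff m (frobSum p c (φ.toSeries + ψ.toSeries)) =
      PowerSeries.coeff m (frobSum p c φ.toSeries + frobSum p c ψ.toSeries)
    simp [frobSum, vOp_iterate_add, mul_add, Finset.sum_add_distrib]
  add_smul c d φ := by
    refine Subtype.ext (PowerSeries.ext fun m => ?_)
    change PowerSeries.coeff m (frobSum p (c + d) φ.toSeries) =
      PowerSeries.coeff m (frobSum p c φ.toSeries + frobSum p d φ.toSeries)
    simp [frobSum, add_mul, Finset.sum_add_distrib]
  zero_smul φ := by
    refine Subtype.ext (PowerSeries.ext fun m => ?_)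
    change PowerSeries.coeff m (frobSum p 0 φ.toSeries) = PowerSeries.coeff m 0
    simp [frobSum]

end Sharp

end DeltaHecke

end

open DeltaHecke

noncomputable section

namespace DeltaHecke

/-! ## Values of `δ` modulo `p` -/

section DeltaValues

open MvPolynomial

variable {σ : Type*}

/-! The proof works in the coordinate `q'/q^p`. Modulo `p`, `δ(c q^a) = a c^p q^(p(a-1)) q'`, so the
substitution `q ↦ c q^a` multiplies `q'/q^p` by `a`. Hence the operators prime to `p` act separately
on the coefficient series of each power of `q'/q^p` (`tcoeff_scale`, `deltaHecke_eq_iff`), and `V`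
only sees `f(q, 0)`.

Symmetry forces a shape. Modulo `p`, `δ S_(a+1)` is affine in the `q_i'`, and the coefficient of
`q_i'` is the `p`-th power of the `a`-th elementary symmetric polynomial in the other variables.
Restricting `Σ_p f` to two variables, along directions in which these linear parts are divisible by
`(q_1 - q_2)^p`, bounds the exponents by orders of vanishing of `t^M - 1` at `t = 1`. The result is
`f = ψ + ∑ V^(s+1)(φ_s) (q'/q^p)^(p^s)`, a finite sum (`dcoeff_ne_zero_of_isTaylorSymmetric`,
`IsTaylorSymmetric.eq_sharpForm`).

On such terms "`pU`" is explicit: it kills `ψ` and sends `V^(s+1)(φ) (q'/q^p)^(p^s)` to the same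
term for `U φ`, minus `V^s(φ^(-1))` (`isPU_C`, `isPU_sharpTerm`). This rests on the expansion of
`ψ(q_i)` in elementary symmetric polynomials of the other variables with symmetric coefficients
(`subst_X_eq_sum`), and on the injectivity of `symmHom`.

The eigenvalue equations then decouple. Since `A^(2 p^s) = A^2` in `k`, each `φ_s` satisfies the
classical relations of weight `κ + 2`, so multiplicity one gives `φ_s = P_s φ`. Likewise `ψ = ∑ d_i
V^i φ^(-1)`, and the equation at `p` becomes `P = (p^κ X - lamp) d`, where `P = ∑ P_s X^s` is a
polynomial and `d = ∑ d_i X^i` a power series. Thus `𝓕` is identified with the `d ∈ k[[X]]` for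
which `(p^κ X - lamp) d` is a polynomial. Here `F_{/k}` is multiplication by `X`, `φ^{♯,2}` is `d =
1`, and primitive means constant (`exists_eq_eigenForm`, `eigenForm_mem_eigenSpace`,
`relFrob_eigenForm`, `isPrimitiveSeries_eigenForm_iff`).

The three cases follow. If `p^κ X - lamp = 0`, every `d` occurs. If it is a nonzero constant or `X`,
`d` must be a polynomial. If it is `X - lamp` with `lamp ≠ 0`, the solutions are the polynomial
multiples of its inverse, which up to a scalar is `∑ lamp^(-i) X^i`. -/

theorem exists_aeval_add_mul [Fintype σ] {B : Type*} [CommRing B] (t : B) (x y : σ → B)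
    (P : MvPolynomial σ ℤ) :
    ∃ r : B, aeval (fun i => x i + t * y i) P =
      aeval x P + t * ∑ i, aeval x (pderiv i P) * y i + t ^ 2 * r := by
  classical
  induction P using MvPolynomial.induction_on with
  | C a => exact ⟨0, by simp⟩
  | add P Q hP hQ =>
    obtain ⟨r, hr⟩ := hP
    obtain ⟨s, hs⟩ := hQ
    refine ⟨r + s, ?_⟩
    simp only [map_add, hr, hs, add_mul, Finset.sum_add_distrib]
    ring
  | mul_X P j hP =>
    obtain ⟨r, hr⟩ := hP
    refine ⟨(∑ i, aeval x (pderiv i P) * y i) * y j + r * (x j + t * y j), ?_⟩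
    have h : ∑ i, aeval x (pderiv i (P * X j)) * y i =
        (∑ i, aeval x (pderiv i P) * y i) * x j + aeval x P * y j := by
      simp only [Derivation.leibniz, pderiv_X, smul_eq_mul, map_add, map_mul, aeval_X, add_mul,
        Finset.sum_add_distrib, Finset.sum_mul]
      rw [add_comm]
      congr 1
      · exact Finset.sum_congr rfl fun i _ => by ring
      · rw [Finset.sum_eq_single j]
        · simp
        · intro i _ hij
          simp [hij.symm]
        · simp
    simp only [map_mul, aeval_X, hr, h]
    ring

theorem map_aeval_int {B C : Type*} [CommRing B] [CommRing C] (f : B →+* C) (x : σ → B)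
    (P : MvPolynomial σ ℤ) : f (aeval x P) = aeval (fun i => f (x i)) P := by
  induction P using MvPolynomial.induction_on <;> simp_all

variable (p : ℕ) [hp : Fact p.Prime]

theorem map_deltaEval {B C : Type*} [CommRing B] [CommRing C] (f : B →+* C)
    (P : MvPolynomial σ ℤ) (x x' : σ → B) :
    f (deltaEval p P x x') = deltaEval p P (fun i => f (x i)) (fun i => f (x' i)) := by
  unfold deltaEval
  rw [← RingHom.toIntAlgHom_apply f, ← AlgHom.comp_apply, MvPolynomial.comp_aeval]
  congr 2
  ext v
  simp only [RingHom.toIntAlgHom_apply]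
  split_ifs <;> rfl

theorem p_mul_deltaEval {B : Type*} [CommRing B] (P : MvPolynomial σ ℤ) (x x' : σ → B) :
    (p : B) * deltaEval p P x x' =
      aeval (fun i => x i ^ p + p * x' i) P - (aeval x P) ^ p := by
  have h := congrArg (aeval (fun v : σ × ℕ => if v.2 = 0 then x v.1 else x' v.1))
    (p_mul_deltaPoly p P)
  simp only [map_mul, map_natCast, map_sub, map_pow] at h
  rw [deltaEval, h, ← AlgHom.comp_apply, ← AlgHom.comp_apply, comp_aeval, comp_aeval]
  simp

/-- Expand `P(u^p + p u')` to first order around `u^p`. The quadratic remainder has a factor `p^2`,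
and dividing by `p` still leaves one `p`; the division needs `p` to be cancellable in `A`. -/
theorem exists_deltaEval_eq_add_sum [Fintype σ] {A : Type*} [CommRing A] [IsDomain A]
    (hp0 : (p : A) ≠ 0) (P : MvPolynomial σ ℤ) (u u' : σ → A) :
    ∃ r : A, deltaEval p P u u' = deltaEval p P u 0 +
      ∑ i, aeval (fun i => u i ^ p) (pderiv i P) * u' i + p * r := by
  obtain ⟨r, hr⟩ := exists_aeval_add_mul (p : A) (fun i => u i ^ p) u' P
  have h1 := p_mul_deltaEval p P u u'
  have h0 := p_mul_deltaEval p P u 0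
  simp only [Pi.zero_apply, mul_zero, add_zero] at h0
  rw [hr, add_sub_right_comm, add_sub_right_comm, ← h0] at h1
  refine ⟨r, mul_left_cancel₀ hp0 ?_⟩
  rw [h1]
  ring

/-- One cannot divide by `p` in `B`, so the identity is proved for the universal variables over `ℤ`
and then mapped to `B`, where the remainder dies. -/
theorem deltaEval_eq_add_sum [Fintype σ] {B : Type*} [CommRing B] [CharP B p]
    (P : MvPolynomial σ ℤ) (x x' : σ → B) :
    deltaEval p P x x' = deltaEval p P x 0 +
      ∑ i, aeval (fun i => x i ^ p) (pderiv i P) * x' i := by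
  let u : σ → MvPolynomial (σ × ℕ) ℤ := fun i => X (i, 0)
  let u' : σ → MvPolynomial (σ × ℕ) ℤ := fun i => X (i, 1)
  obtain ⟨r, h2⟩ := exists_deltaEval_eq_add_sum p (Nat.cast_ne_zero.mpr hp.out.ne_zero) P u u'
  let g : MvPolynomial (σ × ℕ) ℤ →ₐ[ℤ] B :=
    aeval (fun v : σ × ℕ => if v.2 = 0 then x v.1 else x' v.1)
  have hu : ∀ i, g (u i) = x i := fun i => by simp [g, u]
  have hu' : ∀ i, g (u' i) = x' i := fun i => by simp [g, u']
  have h3 := congrArg (g : MvPolynomial (σ × ℕ) ℤ →+* B) h2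
  rw [map_deltaEval, map_add, map_add, map_deltaEval, map_mul, map_natCast, CharP.cast_eq_zero,
    zero_mul, add_zero, map_sum] at h3
  simp only [RingHom.coe_coe, hu, hu', map_mul, Pi.zero_apply, map_zero] at h3
  rw [h3]
  congr 1
  refine Finset.sum_congr rfl fun i _ => ?_
  congr 1
  have h4 := map_aeval_int (g : MvPolynomial (σ × ℕ) ℤ →+* B) (fun i => u i ^ p) (pderiv i P)
  simp only [map_pow, RingHom.coe_coe, hu] at h4
  exact h4

/-- The elementary symmetric polynomial of degree `a` in the `x l`, `l ≠ i`. -/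
def esymmErase {σ : Type*} [Fintype σ] [DecidableEq σ] {B : Type*} [CommRing B] (x : σ → B)
    (i : σ) (a : ℕ) : B :=
  ∑ T ∈ (Finset.univ.erase i).powersetCard a, ∏ l ∈ T, x l

theorem map_esymmErase [Fintype σ] [DecidableEq σ] {B C : Type*} [CommRing B] [CommRing C]
    (f : B →+* C) (x : σ → B) (i : σ) (a : ℕ) :
    f (esymmErase x i a) = esymmErase (fun l => f (x l)) i a := by
  simp [esymmErase]

theorem pderiv_esymm [Fintype σ] [DecidableEq σ] (i : σ) (a : ℕ) :
    pderiv i (esymm σ ℤ (a + 1)) = esymmErase X i a := by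
  have hprod : ∀ T : Finset σ, pderiv i (∏ l ∈ T, (X l : MvPolynomial σ ℤ)) =
      if i ∈ T then ∏ l ∈ T.erase i, X l else 0 := by
    intro T
    induction T using Finset.induction_on with
    | empty => simp
    | insert j T hj ih =>
      rw [Finset.prod_insert hj, Derivation.leibniz, ih, pderiv_X]
      by_cases hij : i = j
      · subst hij
        simp [hj]
      · by_cases hi : i ∈ T
        · rw [if_pos hi, if_pos (Finset.mem_insert_of_mem hi),
            Finset.erase_insert_of_ne (Ne.symm hij),
            Finset.prod_insert (by simp [hj])]
          simp [Ne.symm hij]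
        · simp [hi, hij, Ne.symm hij]
  rw [esymm, map_sum]
  simp only [hprod]
  rw [← Finset.sum_filter, esymmErase]
  refine Finset.sum_bij' (fun T _ => T.erase i) (fun T _ => insert i T) ?_ ?_ ?_ ?_ ?_
  · intro T hT
    simp only [Finset.mem_filter, Finset.mem_powersetCard] at hT ⊢
    refine ⟨Finset.erase_subset_erase _ hT.1.1, ?_⟩
    rw [Finset.card_erase_of_mem hT.2, hT.1.2, Nat.add_sub_cancel]
  · intro T hT
    simp only [Finset.mem_filter, Finset.mem_powersetCard] at hT ⊢
    have hi : i ∉ T := fun h => by simpa using hT.1 h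
    exact ⟨⟨Finset.subset_univ _, by rw [Finset.card_insert_of_notMem hi, hT.2]⟩,
      Finset.mem_insert_self _ _⟩
  · intro T hT
    simp only [Finset.mem_filter] at hT
    exact Finset.insert_erase hT.2
  · intro T hT
    simp only [Finset.mem_powersetCard] at hT
    exact Finset.erase_insert fun h => by simpa using hT.1 h
  · intro T hT
    rfl

/-- Modulo `p`, the value of `δ` at an elementary symmetric polynomial is affine in the
derivatives of the variables. -/
theorem deltaEval_esymm [Fintype σ] [DecidableEq σ] {B : Type*} [CommRing B] [CharP B p] (a : ℕ)
    (x x' : σ → B) :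
    deltaEval p (esymm σ ℤ (a + 1)) x x' = deltaEval p (esymm σ ℤ (a + 1)) x 0 +
      ∑ i, esymmErase x i a ^ p * x' i := by
  rw [deltaEval_eq_add_sum]
  congr 1
  refine Finset.sum_congr rfl fun i _ => ?_
  congr 1
  -- Frobenius is additive, so the symmetric polynomial in the `x_l^p` is the `p`-th power of the
  -- one in the `x_l`.
  rw [pderiv_esymm, ← AlgHom.coe_toRingHom, map_esymmErase, esymmErase, esymmErase,
    sum_pow_char]
  refine Finset.sum_congr rfl fun T _ => ?_
  simp [Finset.prod_pow]

/-- Modulo `p`, `δ(c y ^ m) = c ^ p m y ^ (p (m - 1)) y'` if `δ c = 0`. -/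
theorem deltaEval_scale {B : Type*} [CommRing B] [CharP B p] (m : ℕ) (c y y' : B) :
    deltaEval p (X 0 * X 1 ^ m : MvPolynomial (Fin 2) ℤ) ![c, y] ![0, y'] =
      c ^ p * m * y ^ (p * (m - 1)) * y' := by
  -- A monomial with coefficient `1` commutes with `x ↦ x^p`, so its `δ` vanishes when the
  -- derivatives of the variables do. This is checked over `ℤ`, where `p` can be cancelled.
  have h0 : deltaEval p (X 0 * X 1 ^ m : MvPolynomial (Fin 2) ℤ) ![c, y] 0 = 0 := by
    let A := MvPolynomial (Fin 2) ℤ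
    have h : deltaEval p (X 0 * X 1 ^ m : MvPolynomial (Fin 2) ℤ) (X : Fin 2 → A) 0 = 0 := by
      have hp0 : (p : A) ≠ 0 := Nat.cast_ne_zero.mpr hp.out.ne_zero
      apply mul_left_cancel₀ hp0
      rw [p_mul_deltaEval]
      simp [mul_pow, ← pow_mul, mul_comm]
    have h2 := congrArg (aeval ![c, y] : A →ₐ[ℤ] B).toRingHom h
    rw [map_deltaEval] at h2
    simpa [Pi.zero_def] using h2
  rw [deltaEval_eq_add_sum, h0]
  simp [Fin.sum_univ_two, Derivation.leibniz, pderiv_X, Derivation.leibniz_pow, pow_mul]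
  ring

end DeltaValues

/-! ## Symmetric power series -/

section SymmetricSeries

open MvPolynomial

theorem isHomogeneous_esymm (σ R : Type*) [Fintype σ] [CommRing R] (n : ℕ) :
    (esymm σ R n).IsHomogeneous n := by
  refine IsHomogeneous.sum _ _ _ fun T hT => ?_
  have h := IsHomogeneous.prod T (fun i => (X i : MvPolynomial σ R)) (fun _ => 1)
    fun i _ => isHomogeneous_X R i
  simpa [(Finset.mem_powersetCard.mp hT).2] using h

variable (k : Type*) [Field k] (p : ℕ)

/-- The weight `j + 1` of the variable `s_{j + 1}`. -/
def esymmWeight (p : ℕ) (j : Fin p) : ℕ := j.1 + 1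

/-- The substitution `s_j ↦ S_j` of the elementary symmetric polynomials. -/
def esymmSubst : MvPowerSeries (Fin p) k →ₐ[k] MvPowerSeries (Fin p) k :=
  MvPowerSeries.substAlgHom (hasSubst_esymm k p)

variable {k p}

theorem esymmSubst_coe (Q : MvPolynomial (Fin p) k) :
    esymmSubst k p Q = (esymmAlgHom (Fin p) k p Q).1 := by
  rw [esymmSubst, MvPowerSeries.substAlgHom_coe, esymmAlgHom_apply]
  induction Q using MvPolynomial.induction_on <;> simp_all [MvPowerSeries.algebraMap_apply]

/-- The monomial `S^α` is homogeneous of degree the weight of `α`. This grading reduces statements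
on power series to polynomials. -/
theorem coeff_prod_esymm_pow {α β : Fin p →₀ ℕ}
    (h : Finsupp.weight (esymmWeight p) α ≠ β.degree) :
    MvPowerSeries.coeff β (α.prod fun j e =>
      ((esymm (Fin p) k (j.1 + 1) : MvPolynomial (Fin p) k) : MvPowerSeries (Fin p) k) ^ e) = 0 := by
  have h1 : (α.prod fun j e => ((esymm (Fin p) k (j.1 + 1) : MvPolynomial (Fin p) k) :
      MvPowerSeries (Fin p) k) ^ e) =
      ((α.prod fun j e => esymm (Fin p) k (j.1 + 1) ^ e : MvPolynomial (Fin p) k) :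
        MvPowerSeries (Fin p) k) := by
    simp only [Finsupp.prod]
    rw [← MvPolynomial.coeToMvPowerSeries.ringHom_apply, map_prod]
    simp
  rw [h1, MvPolynomial.coeff_coe]
  have h2 : (α.prod fun j e => esymm (Fin p) k (j.1 + 1) ^ e).IsHomogeneous
      (Finsupp.weight (esymmWeight p) α) := by
    rw [Finsupp.weight_apply]
    refine IsHomogeneous.prod _ _ _ fun j _ => ?_
    have := (isHomogeneous_esymm (Fin p) k (j.1 + 1)).pow (α j)
    rwa [mul_comm] at this
  exact h2.coeff_eq_zero h.symm

theorem coeff_esymmSubst_eq_zero {g : MvPowerSeries (Fin p) k} {β : Fin p →₀ ℕ}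
    (h : ∀ α, Finsupp.weight (esymmWeight p) α = β.degree → MvPowerSeries.coeff α g = 0) :
    MvPowerSeries.coeff β (esymmSubst k p g) = 0 := by
  rw [esymmSubst, MvPowerSeries.substAlgHom_apply, MvPowerSeries.coeff_subst (hasSubst_esymm k p)]
  refine finsum_eq_zero_of_forall_eq_zero fun α => ?_
  by_cases hα : Finsupp.weight (esymmWeight p) α = β.degree
  · rw [h α hα, zero_smul]
  · rw [coeff_prod_esymm_pow hα, smul_zero]

/-- A coefficient of degree `n` in `g(S_1, …, S_p)` depends only on the weight-`n` part of `g`, so a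
polynomial agreeing with `g` in that weight computes it. -/
theorem coeff_esymmSubst {g : MvPowerSeries (Fin p) k} {Q : MvPolynomial (Fin p) k}
    {β : Fin p →₀ ℕ}
    (h : ∀ α, Finsupp.weight (esymmWeight p) α = β.degree → MvPowerSeries.coeff α g = coeff α Q) :
    MvPowerSeries.coeff β (esymmSubst k p g) = coeff β (esymmAlgHom (Fin p) k p Q).1 := by
  rw [← MvPolynomial.coeff_coe, ← esymmSubst_coe, ← sub_eq_zero, ← map_sub, ← map_sub]
  refine coeff_esymmSubst_eq_zero fun α hα => ?_
  rw [map_sub, h α hα, MvPolynomial.coeff_coe, sub_self]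

theorem le_weight_esymmWeight (α : Fin p →₀ ℕ) (j : Fin p) :
    α j ≤ Finsupp.weight (esymmWeight p) α := by
  rw [Finsupp.weight_apply, Finsupp.sum_fintype _ _ (by simp)]
  refine le_trans ?_ (Finset.single_le_sum (f := fun i => α i • esymmWeight p i)
    (fun i _ => Nat.zero_le _) (Finset.mem_univ j))
  simp only [esymmWeight, smul_eq_mul]
  nlinarith

theorem esymmSubst_injective : Function.Injective (esymmSubst k p) := by
  rw [injective_iff_map_eq_zero]
  intro g hg
  ext α
  set n := Finsupp.weight (esymmWeight p) α with hn
  -- Each exponent of a monomial is at most its weight, so truncating every exponent at `n` keeps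
  -- the whole weight-`n` part of `g`.
  let T : MvPolynomial (Fin p) k :=
    MvPowerSeries.trunc' k (Finsupp.equivFunOnFinite.symm fun _ => n) g
  let Q := weightedHomogeneousComponent (esymmWeight p) n T
  have hQ : ∀ α', Finsupp.weight (esymmWeight p) α' = n →
      MvPowerSeries.coeff α' g = coeff α' Q := by
    intro α' hα'
    rw [coeff_weightedHomogeneousComponent, if_pos hα', MvPowerSeries.coeff_trunc', if_pos]
    intro j
    simpa [← hα'] using le_weight_esymmWeight α' j
  have hQ0 : Q = 0 := by
    apply (esymmAlgHom_fin_bijective k p).1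
    rw [map_zero]
    ext β
    by_cases hβ : β.degree = n
    · rw [← coeff_esymmSubst (g := g) (hβ ▸ hQ), hg]
      simp
    · rw [← MvPolynomial.coeff_coe, ← esymmSubst_coe, coeff_esymmSubst_eq_zero]
      · simp
      · intro α' hα'
        rw [MvPolynomial.coeff_coe, coeff_weightedHomogeneousComponent,
          if_neg (hα'.trans_ne hβ)]
  rw [hQ α hn.symm, hQ0]
  simp

/-- The fundamental theorem on symmetric functions, for power series. -/
theorem exists_esymmSubst_eq {γ : MvPowerSeries (Fin p) k}
    (P : ℕ → MvPolynomial (Fin p) k) (hP : ∀ n, (P n).IsSymmetric)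
    (hγ : ∀ β, MvPowerSeries.coeff β γ = coeff β (P β.degree)) :
    ∃ g, esymmSubst k p g = γ := by
  choose Q hQ using fun n => (esymmAlgHom_fin_bijective k p).2 ⟨P n, hP n⟩
  -- The weight-`n` part of `g` is taken from the preimage `Q n` of `P n`; the other weights of `Q
  -- n` are irrelevant in degree `n`.
  let g : MvPowerSeries (Fin p) k := fun α => coeff α (Q (Finsupp.weight (esymmWeight p) α))
  refine ⟨g, ?_⟩
  ext β
  rw [coeff_esymmSubst (Q := Q β.degree), hQ, hγ]
  intro α hα
  rw [← hα]
  rfl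

/-- The series `∑_β c_{|β| + a} q ^ β` in `p` variables, where `ψ = ∑ c_m q ^ m`. -/
def degreeSeries (p : ℕ) (ψ : k⟦X⟧) (a : ℕ) : MvPowerSeries (Fin p) k :=
  fun β => PowerSeries.coeff (β.degree + a) ψ

/-- The coefficient at `β` depends only on `|β|`: in degree `n` the series is a multiple of the
complete homogeneous symmetric polynomial. -/
theorem exists_esymmSubst_eq_degreeSeries (ψ : k⟦X⟧) (a : ℕ) :
    ∃ g, esymmSubst k p g = degreeSeries p ψ a := by
  classical
  have hmem : ∀ (n : ℕ) (β : Fin p →₀ ℕ),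
      β ∈ Finset.finsuppAntidiag Finset.univ n ↔ β.degree = n := by
    intro n β
    simp [Finset.mem_finsuppAntidiag, Finsupp.degree_eq_sum]
  refine exists_esymmSubst_eq (fun n => ∑ β ∈ Finset.finsuppAntidiag Finset.univ n,
    monomial β (PowerSeries.coeff (n + a) ψ)) ?_ ?_
  · intro n e
    rw [map_sum]
    simp only [rename_monomial]
    refine Finset.sum_bij' (fun β _ => β.mapDomain e) (fun β _ => β.mapDomain e.symm)
      ?_ ?_ ?_ ?_ ?_
    · intro β hβ
      rw [hmem] at hβ ⊢
      rw [← hβ, Finsupp.degree_mapDomain]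
    · intro β hβ
      rw [hmem] at hβ ⊢
      rw [← hβ, Finsupp.degree_mapDomain]
    · intro β _
      rw [← Finsupp.mapDomain_comp]
      simp
    · intro β _
      rw [← Finsupp.mapDomain_comp]
      simp
    · intro β _
      rfl
  · intro β
    rw [coeff_sum]
    simp only [coeff_monomial]
    rw [Finset.sum_ite_eq' , if_pos ((hmem _ _).2 rfl)]
    rfl

/-- `ψ(q_i)` as an alternating sum of products of symmetric power series and elementary symmetric
polynomials in the other variables. -/
theorem subst_X_eq_sum (ψ : k⟦X⟧) (i : Fin p) :
    MvPowerSeries.subst (fun _ : Unit => (MvPowerSeries.X i : MvPowerSeries (Fin p) k)) ψ =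
      ∑ a ∈ Finset.range p, (-1) ^ a * degreeSeries p ψ a * esymmErase MvPowerSeries.X i a := by
  classical
  have hsum : ∑ a ∈ Finset.range p,
      (-1) ^ a * degreeSeries p ψ a * esymmErase MvPowerSeries.X i a =
      ∑ T ∈ (Finset.univ.erase i).powerset,
        (-1) ^ T.card * degreeSeries p ψ T.card * ∏ l ∈ T, MvPowerSeries.X l := by
    have hc : (Finset.univ.erase i).card + 1 = p := by
      rw [Finset.card_erase_add_one (Finset.mem_univ i), Finset.card_univ, Fintype.card_fin]
    rw [Finset.sum_powerset, hc]
    refine Finset.sum_congr rfl fun a _ => ?_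
    rw [esymmErase, Finset.mul_sum]
    refine Finset.sum_congr rfl fun T hT => ?_
    rw [(Finset.mem_powersetCard.mp hT).2]
  rw [hsum]
  ext β
  have hterm : ∀ T : Finset (Fin p), MvPowerSeries.coeff β
      ((-1) ^ T.card * degreeSeries p ψ T.card * ∏ l ∈ T, MvPowerSeries.X l) =
      if T ⊆ β.support then (-1) ^ T.card * PowerSeries.coeff β.degree ψ else 0 := by
    intro T
    let t : Fin p →₀ ℕ := ∑ l ∈ T, Finsupp.single l 1
    have ht : ∀ l, t l = if l ∈ T then 1 else 0 := by
      intro l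
      simp [t, Finsupp.finsetSum_apply, Finsupp.single_apply]
    have hprod : ∏ l ∈ T, (MvPowerSeries.X l : MvPowerSeries (Fin p) k) =
        MvPowerSeries.monomial t 1 := by
      simp only [MvPowerSeries.X, t]
      rw [MvPowerSeries.prod_monomial]
      simp
    have hle : t ≤ β ↔ T ⊆ β.support := by
      constructor
      · intro h l hl
        have := h l
        rw [ht, if_pos hl] at this
        simp only [Finsupp.mem_support_iff]
        omega
      · intro h l
        rw [ht]
        split_ifs with hl
        · have := h hl
          simp only [Finsupp.mem_support_iff] at this
          omega
        · exact Nat.zero_le _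
    have hdeg : t.degree = T.card := by
      simp [t, map_sum]
    rw [hprod, MvPowerSeries.coeff_mul_monomial]
    simp only [hle, mul_one]
    split_ifs with hT
    swap
    · rfl
    have h1 : ((-1) ^ T.card : MvPowerSeries (Fin p) k) = MvPowerSeries.C ((-1) ^ T.card) := by
      simp
    rw [h1, MvPowerSeries.coeff_C_mul]
    congr 1
    change PowerSeries.coeff ((β - t).degree + T.card) ψ = _
    rw [← hdeg, ← map_add, tsub_add_cancel_of_le (hle.2 hT)]
  rw [map_sum]
  simp only [hterm]
  -- Inclusion-exclusion: the coefficient at `β` is that of `q^|β|` in `ψ` times the alternating sum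
  -- over subsets of `supp β \ {i}`, which vanishes unless that set is empty.
  have hfilter : (Finset.univ.erase i).powerset.filter (· ⊆ β.support) =
      (β.support.erase i).powerset := by
    ext T
    simp only [Finset.mem_filter, Finset.mem_powerset, Finset.subset_erase]
    simp [and_comm]
  have hcard := congrArg (Int.cast : ℤ → k)
    (Finset.sum_powerset_neg_one_pow_card (x := β.support.erase i))
  push_cast at hcard
  rw [← Finset.sum_filter, ← Finset.sum_mul, hfilter, hcard]
  refine (PowerSeries.coeff_subst_single i ψ β).trans ?_
  have hiff : β = Finsupp.single i (β i) ↔ β.support.erase i = ∅ := by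
    rw [← Finsupp.support_subset_singleton, Finset.erase_eq_empty_iff, Finset.subset_singleton_iff]
  by_cases h : β = Finsupp.single i (β i)
  · rw [if_pos h, if_pos (hiff.1 h), one_mul]
    conv_rhs => rw [h]
    simp
  · rw [if_neg h, if_neg fun h' => h (hiff.2 h'), zero_mul]

/-- The value at `x` of the elementary symmetric polynomial of degree `n`. -/
def esymmEval (p : ℕ) {B : Type*} [CommRing B] (x : Fin p → B) (n : ℕ) : B :=
  aeval x (esymm (Fin p) ℤ n)

theorem esymmEval_eq_sum {B : Type*} [CommRing B] (x : Fin p → B) (n : ℕ) :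
    esymmEval p x n = ∑ T ∈ Finset.univ.powersetCard n, ∏ l ∈ T, x l := by
  simp [esymmEval, esymm]

theorem coe_esymm (n : ℕ) : ((esymm (Fin p) k n : MvPolynomial (Fin p) k) :
    MvPowerSeries (Fin p) k) = esymmEval p MvPowerSeries.X n := by
  rw [esymmEval_eq_sum, esymm, ← MvPolynomial.coeToMvPowerSeries.ringHom_apply, map_sum]
  refine Finset.sum_congr rfl fun T _ => ?_
  rw [map_prod]
  refine Finset.prod_congr rfl fun l _ => ?_
  rw [MvPolynomial.coeToMvPowerSeries.ringHom_apply, coe_X]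

theorem esymmSubst_X (j : Fin p) : esymmSubst k p (MvPowerSeries.X j) =
    esymmEval p MvPowerSeries.X (j.1 + 1) := by
  rw [esymmSubst, MvPowerSeries.substAlgHom_X, coe_esymm]

/-- At `t = x_j` the left side vanishes for `i ≠ j`. As in Lagrange interpolation, this inverts the
matrix of the `esymmErase x i a`. -/
theorem prod_erase_sub {B : Type*} [CommRing B] (x : Fin p → B) (i : Fin p) (t : B) :
    ∏ l ∈ Finset.univ.erase i, (t - x l) =
      ∑ a ∈ Finset.range p, (-1) ^ a * esymmErase x i a * t ^ (p - 1 - a) := by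
  have hc : (Finset.univ.erase i).card + 1 = p := by
    rw [Finset.card_erase_add_one (Finset.mem_univ i), Finset.card_univ, Fintype.card_fin]
  rw [Finset.prod_sub, Finset.sum_powerset, hc]
  refine Finset.sum_congr rfl fun a _ => ?_
  rw [esymmErase, Finset.mul_sum, Finset.sum_mul]
  refine Finset.sum_congr rfl fun T hT => ?_
  obtain ⟨hT1, hT2⟩ := Finset.mem_powersetCard.mp hT
  rw [Finset.prod_const, Finset.card_sdiff_of_subset hT1, hT2, eq_tsub_of_add_eq hc]
  ring

end SymmetricSeries

/-! ### Characteristic and substitution rules for `δ`-series. -/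

section SubstLemmas

variable {σ τ k : Type*} [Field k]

instance (p : ℕ) [CharP k p] : CharP (DSer σ k) p :=
  charP_of_injective_algebraMap (algebraMap k (DSer σ k)).injective p

theorem DSer.subst_C (a : σ → MvPowerSeries τ k) (ha : MvPowerSeries.HasSubst a) (b : σ → DSer τ k)
    (φ : MvPowerSeries σ k) :
    DSer.subst a ha b (MvPolynomial.C φ) = MvPolynomial.C (MvPowerSeries.subst a φ) := by
  rw [DSer.subst, MvPolynomial.aevalTower_C]
  simp [MvPolynomial.algebraMap_eq]

theorem DSer.subst_X (a : σ → MvPowerSeries τ k) (ha : MvPowerSeries.HasSubst a) (b : σ → DSer τ k)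
    (i : σ) : DSer.subst a ha b (MvPolynomial.X i) = b i := by
  rw [DSer.subst, MvPolynomial.aevalTower_X]

end SubstLemmas

/-! ## Injectivity of `symmHom` -/

section SymmHom

open MvPolynomial

variable (p : ℕ) [hp : Fact p.Prime]

/-- After multiplication by `p` the value is `S_n(q^p) - S_n(q)^p`, visibly symmetric, and `p` is
cancellable over `ℤ`. -/
theorem isSymmetric_deltaEval_esymm (n : ℕ) :
    (deltaEval p (esymm (Fin p) ℤ n) (X : Fin p → MvPolynomial (Fin p) ℤ) 0).IsSymmetric := by
  intro e
  have hp0 : (p : MvPolynomial (Fin p) ℤ) ≠ 0 := Nat.cast_ne_zero.mpr hp.out.ne_zero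
  have h := map_deltaEval p (rename e : MvPolynomial (Fin p) ℤ →ₐ[ℤ] _).toRingHom
    (esymm (Fin p) ℤ n) X 0
  change rename e _ = _ at h
  rw [h]
  apply mul_left_cancel₀ hp0
  have key : ∀ f : MvPolynomial (Fin p) ℤ → MvPolynomial (Fin p) ℤ,
      aeval (fun i => f (X (e i))) (esymm (Fin p) ℤ n) =
        aeval (fun i => f (X i)) (esymm (Fin p) ℤ n) := by
    intro f
    conv_rhs => rw [← rename_esymm (σ := Fin p) (R := ℤ) n e, aeval_rename]
    rfl
  have h1 := p_mul_deltaEval p (esymm (Fin p) ℤ n)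
    (fun i => X (e i) : Fin p → MvPolynomial (Fin p) ℤ) 0
  have h2 := p_mul_deltaEval p (esymm (Fin p) ℤ n) (X : Fin p → MvPolynomial (Fin p) ℤ) 0
  simp only [Pi.zero_apply, mul_zero, add_zero] at h1 h2
  have h3 := (h1.trans (congrArg₂ (· - ·) (key (· ^ p)) (congrArg (· ^ p) (key id)))).trans h2.symm
  simpa [Pi.zero_def] using h3

/-- A polynomial with `deltaConst p a (S_1, …, S_p) = δ S_{a + 1}` at `q' = 0`. -/
def deltaConst (a : ℕ) : MvPolynomial (Fin p) ℤ :=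
  ((esymmAlgHom_fin_bijective ℤ p).2 ⟨_, isSymmetric_deltaEval_esymm p (a + 1)⟩).choose

/-- The value of `deltaConst p a` at `x`. -/
def deltaConstEval {B : Type*} [CommRing B] (x : Fin p → B) (a : ℕ) : B :=
  aeval x (deltaConst p a)

theorem map_deltaConstEval {B C : Type*} [CommRing B] [CommRing C] (f : B →+* C) (x : Fin p → B)
    (a : ℕ) : f (deltaConstEval p x a) = deltaConstEval p (fun i => f (x i)) a :=
  map_aeval_int f x _

theorem deltaConstEval_esymmEval (a : ℕ) {B : Type*} [CommRing B] (x : Fin p → B) :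
    deltaConstEval p (fun j : Fin p => esymmEval p x (j.1 + 1)) a =
      deltaEval p (esymm (Fin p) ℤ (a + 1)) x 0 := by
  have h1 := congrArg Subtype.val
    ((esymmAlgHom_fin_bijective ℤ p).2 ⟨_, isSymmetric_deltaEval_esymm p (a + 1)⟩).choose_spec
  rw [esymmAlgHom_apply] at h1
  have h2 := congrArg (aeval x : MvPolynomial (Fin p) ℤ →ₐ[ℤ] B).toRingHom h1
  rw [map_deltaEval] at h2
  have h3 := map_aeval_int (aeval x : MvPolynomial (Fin p) ℤ →ₐ[ℤ] B).toRingHom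
    (fun j : Fin p => esymm (Fin p) ℤ (j.1 + 1)) (deltaConst p a)
  refine (h3.symm.trans h2).trans ?_
  simp [Pi.zero_def]

variable {p} {k : Type*} [Field k]

theorem symmHom_C (φ : MvPowerSeries (Fin p) k) : symmHom k p (C φ) = C (esymmSubst k p φ) := by
  rw [symmHom, DSer.subst_C, esymmSubst, MvPowerSeries.substAlgHom_apply]

theorem esymmSubst_deltaConst (a : ℕ) :
    esymmSubst k p (deltaConstEval p MvPowerSeries.X a) =
      deltaEval p (esymm (Fin p) ℤ (a + 1)) MvPowerSeries.X 0 := by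
  have h := map_deltaConstEval p
    (esymmSubst k p : MvPowerSeries (Fin p) k →+* MvPowerSeries (Fin p) k) MvPowerSeries.X a
  rw [RingHom.coe_coe] at h
  rw [h, ← deltaConstEval_esymmEval]
  congr 1
  ext1 j
  exact esymmSubst_X (k := k) j

/-- The constant part is written as the image of a series in the `s_j`, so the linear part alone can
be produced as the image of `s_a'` minus that series. -/
theorem symmHom_X [CharP k p] (a : Fin p) : symmHom k p (X a) =
    C (esymmSubst k p (deltaConstEval p MvPowerSeries.X a)) +
      ∑ i, C (esymmErase MvPowerSeries.X i a ^ p) * X i := by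
  have h1 : deltaEval p (esymm (Fin p) ℤ (a.1 + 1)) (DSer.var : Fin p → DSer (Fin p) k) 0 =
      C (esymmSubst k p (deltaConstEval p MvPowerSeries.X a)) := by
    rw [esymmSubst_deltaConst, map_deltaEval]
    congr 1
    ext1 i
    simp
  have h2 : ∀ i : Fin p, esymmErase (DSer.var : Fin p → DSer (Fin p) k) i a ^ p =
      C (esymmErase MvPowerSeries.X i a ^ p) := fun i => by
    rw [map_pow, map_esymmErase]
    rfl
  rw [symmHom, DSer.subst_X, deltaEval_esymm, h1]
  simp only [h2]
  rfl

/-- Combine the equations with the `p`-th powers of the coefficients of the polynomials `∏ (t -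
x_l)` at `t = x_j`. Only `∏ (x_j - x_l)^p u_j` survives, with nonzero factor since the `x_l` are
distinct. -/
theorem eq_zero_of_sum_esymmErase {K : Type*} [Field K] [CharP K p] {x : Fin p → K}
    (hx : Function.Injective x) {u : Fin p → K}
    (hu : ∀ a : Fin p, ∑ i, esymmErase x i a ^ p * u i = 0) : u = 0 := by
  ext j
  have h1 : ∀ i, (∏ l ∈ Finset.univ.erase i, (x j - x l)) ^ p =
      ∑ a ∈ Finset.range p, (-1) ^ (a * p) * esymmErase x i a ^ p * x j ^ ((p - 1 - a) * p) := by
    intro i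
    rw [prod_erase_sub, sum_pow_char]
    simp only [mul_pow, ← pow_mul]
  have h2 : ∑ i, (∏ l ∈ Finset.univ.erase i, (x j - x l)) ^ p * u i = 0 := by
    simp only [h1, Finset.sum_mul]
    rw [Finset.sum_comm]
    refine Finset.sum_eq_zero fun a ha => ?_
    have h3 := hu ⟨a, Finset.mem_range.mp ha⟩
    calc _ = ((-1) ^ (a * p) * x j ^ ((p - 1 - a) * p)) * ∑ i, esymmErase x i a ^ p * u i := by
          rw [Finset.mul_sum]
          exact Finset.sum_congr rfl fun i _ => by ring
      _ = 0 := by rw [h3, mul_zero]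
  rw [Finset.sum_eq_single j] at h2
  · rcases mul_eq_zero.mp h2 with h | h
    · exfalso
      have := eq_zero_of_pow_eq_zero h
      obtain ⟨l, hl, hl0⟩ := Finset.prod_eq_zero_iff.mp this
      exact (Finset.ne_of_mem_erase hl) (hx (sub_eq_zero.mp hl0)).symm
    · exact h
  · intro i _ hij
    rw [Finset.prod_eq_zero (i := j) (Finset.mem_erase.mpr ⟨hij.symm, Finset.mem_univ j⟩)
      (sub_self _), zero_pow hp.out.ne_zero, zero_mul]
  · simp

theorem exists_sum_esymmErase_eq {K : Type*} [Field K] [CharP K p] {x : Fin p → K}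
    (hx : Function.Injective x) (v : Fin p → K) :
    ∃ u : Fin p → K, ∀ a : Fin p, ∑ i, esymmErase x i a ^ p * u i = v a := by
  let M : Matrix (Fin p) (Fin p) K := Matrix.of fun a i => esymmErase x i a ^ p
  have hinj : Function.Injective M.mulVecLin := by
    rw [injective_iff_map_eq_zero]
    intro u hu
    exact eq_zero_of_sum_esymmErase hx fun a => congrFun hu a
  obtain ⟨u, hu⟩ := (LinearMap.injective_iff_surjective.mp hinj) v
  exact ⟨u, fun a => congrFun hu a⟩

theorem symmHom_eq_aeval (G : DSer (Fin p) k) : symmHom k p G =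
    aeval (fun j => symmHom k p (X j))
      (map (esymmSubst k p : MvPowerSeries (Fin p) k →+* MvPowerSeries (Fin p) k) G) := by
  induction G using MvPolynomial.induction_on with
  | C φ => simp [symmHom_C, algebraMap_eq]
  | add P Q hP hQ => simp [hP, hQ]
  | mul_X P j hP => simp [hP]

/-- `symmHom` is `s ↦ S` on coefficients, which is injective, followed by an affine change of the
primed variables. The latter is invertible over the fraction field because the `q_i` are distinct.
Hence `G`, with coefficients mapped there, vanishes at all points over an infinite field. -/
theorem symmHom_injective [CharP k p] : Function.Injective (symmHom k p) := by
  rw [injective_iff_map_eq_zero]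
  intro G hG
  let A := MvPowerSeries (Fin p) k
  have : IsDomain A := NoZeroDivisors.to_isDomain A
  let K := FractionRing A
  have : CharP A p := charP_of_injective_algebraMap (algebraMap k A).injective p
  have : CharP K p := charP_of_injective_algebraMap (IsFractionRing.injective A K) p
  have hXinj : Function.Injective (MvPowerSeries.X : Fin p → A) := fun i j h =>
    MvPowerSeries.X_inj.mp h
  have : Infinite A := by
    refine Infinite.of_injective
      (fun n : ℕ => (MvPowerSeries.X (⟨0, hp.out.pos⟩ : Fin p) : A) ^ n) fun m n h => ?_
    simp only [MvPowerSeries.X_pow_eq] at h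
    have h1 := congrArg (MvPowerSeries.coeff (Finsupp.single (⟨0, hp.out.pos⟩ : Fin p) m)) h
    rw [MvPowerSeries.coeff_monomial_same, MvPowerSeries.coeff_monomial] at h1
    split_ifs at h1 with h2
    · exact Finsupp.single_injective _ h2
    · exact absurd h1 one_ne_zero
  have : Infinite K := Infinite.of_injective _ (IsFractionRing.injective A K)
  let ι : A →+* A := esymmSubst k p
  have hι : Function.Injective ι := esymmSubst_injective
  let x : Fin p → K := fun i => algebraMap A K (MvPowerSeries.X i)
  have hx : Function.Injective x := (IsFractionRing.injective A K).comp hXinj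
  have key : map (algebraMap A K) (map ι G) = 0 := by
    apply MvPolynomial.funext
    intro v
    -- Choose values `u` of the `q_i'` at which the `δ S_(a+1)` take the prescribed values `v a`.
    obtain ⟨u, hu⟩ := exists_sum_esymmErase_eq hx
      (fun a => v a - algebraMap A K (esymmSubst k p (deltaConstEval p MvPowerSeries.X a)))
    have h1 := congrArg (eval₂Hom (algebraMap A K) u) hG
    rw [symmHom_eq_aeval, map_zero, aeval_def, MvPolynomial.hom_eval₂] at h1
    rw [map_zero, eval_map, ← h1]
    congr 1
    · ext1 a
      simp [algebraMap_eq]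
    · ext1 a
      simp only [symmHom_X]
      have h2 := hu a
      simp only [x, ← map_esymmErase] at h2
      simp [h2]
  have h2 : map ι G = 0 := map_injective _ (IsFractionRing.injective A K) (by rw [key, map_zero])
  exact map_injective _ hι (by rw [h2, map_zero])

end SymmHom

/-! ## The operator "`pU`" -/

section PU

open MvPolynomial

variable {k : Type*} [Field k] {p : ℕ}

/-! ### Specialization of symmetric power series -/

variable (k p) in
/-- The substitution `s_p ↦ q` and `s_j ↦ 0` for `j < p`. -/
def specSeries : MvPowerSeries (Fin p) k →ₐ[k] k⟦X⟧ :=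
  MvPowerSeries.substAlgHom (R := k)
    (a := fun j : Fin p => if j.1 + 1 = p then (MvPowerSeries.X () : MvPowerSeries Unit k) else 0)
    (MvPowerSeries.hasSubst_of_constantCoeff_zero fun j => by split_ifs <;> simp)

variable (k p) in
theorem hasSubst_diag :
    MvPowerSeries.HasSubst fun _ : Fin p => (MvPowerSeries.X () : MvPowerSeries Unit k) :=
  MvPowerSeries.hasSubst_of_constantCoeff_zero fun _ => MvPowerSeries.constantCoeff_X _

variable (k p) in
/-- The substitution `q_i ↦ q` for all `i`. -/
def diagSeries : MvPowerSeries (Fin p) k →ₐ[k] k⟦X⟧ :=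
  MvPowerSeries.substAlgHom (R := k) (hasSubst_diag k p)

theorem diagSeries_X (i : Fin p) : diagSeries k p (MvPowerSeries.X i) = PowerSeries.X :=
  MvPowerSeries.substAlgHom_X _ _

theorem specSeries_X (j : Fin p) :
    specSeries k p (MvPowerSeries.X j) = if j.1 + 1 = p then PowerSeries.X else 0 :=
  MvPowerSeries.substAlgHom_X _ _

theorem specialize_C (g : MvPowerSeries (Fin p) k) :
    specialize k p (C g) = C (specSeries k p g) := by
  rw [specialize, DSer.subst_C, specSeries, MvPowerSeries.substAlgHom_apply]

theorem specialize_X (j : Fin p) :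
    specialize k p (X j) = if j.1 + 1 = p then X () else 0 := by
  rw [specialize, DSer.subst_X]
  rfl

theorem diagSeries_subst (ψ : k⟦X⟧) (i : Fin p) :
    diagSeries k p (MvPowerSeries.subst
      (fun _ : Unit => (MvPowerSeries.X i : MvPowerSeries (Fin p) k)) ψ) = ψ := by
  rw [diagSeries, MvPowerSeries.substAlgHom_apply, MvPowerSeries.subst_comp_subst_apply]
  · simp only [MvPowerSeries.subst_X (hasSubst_diag k p)]
    exact congrFun MvPowerSeries.subst_self ψ
  · exact MvPowerSeries.hasSubst_of_constantCoeff_zero fun _ => MvPowerSeries.constantCoeff_X _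
  · exact hasSubst_diag k p

theorem esymmEval_const {B : Type*} [CommRing B] (x : B) (n : ℕ) :
    esymmEval p (fun _ => x) n = p.choose n * x ^ n := by
  rw [esymmEval_eq_sum]
  rw [Finset.sum_congr rfl (g := fun _ => x ^ n)]
  · simp
  · intro T hT
    simp [(Finset.mem_powersetCard.mp hT).2]

/-- Double counting: a set `T` of size `a` occurs once for each of the `p - a` indices outside it.
-/
theorem sum_esymmErase {B : Type*} [CommRing B] (x : Fin p → B) (a : ℕ) :
    ∑ i, esymmErase x i a = ((p : B) - a) * esymmEval p x a := by
  have h : ∀ i T, i ∈ Finset.univ ∧ T ∈ (Finset.univ.erase i).powersetCard a ↔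
      i ∈ Finset.univ \ T ∧ T ∈ (Finset.univ : Finset (Fin p)).powersetCard a := by
    intro i T
    simp [Finset.mem_powersetCard, Finset.subset_erase, and_comm]
  rw [esymmEval_eq_sum, Finset.mul_sum]
  simp only [esymmErase]
  rw [Finset.sum_comm' h]
  refine Finset.sum_congr rfl fun T hT => ?_
  have hT2 := (Finset.mem_powersetCard.mp hT).2
  rw [Finset.sum_const, Finset.card_sdiff_of_subset (Finset.subset_univ T), hT2, Finset.card_univ,
    Fintype.card_fin, nsmul_eq_mul, Nat.cast_sub]
  rw [← hT2]
  simpa using Finset.card_le_univ T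

theorem esymmErase_const {B : Type*} [CommRing B] (x : B) (i : Fin p) (n : ℕ) :
    esymmErase (fun _ => x) i n = (p - 1).choose n * x ^ n := by
  rw [esymmErase, Finset.sum_congr rfl (g := fun _ => x ^ n)]
  · simp [Finset.card_erase_of_mem]
  · intro T hT
    simp [(Finset.mem_powersetCard.mp hT).2]

instance {σ : Type*} [CharP k p] : CharP (MvPowerSeries σ k) p :=
  charP_of_injective_algebraMap (algebraMap k (MvPowerSeries σ k)).injective p

variable [hp : Fact p.Prime]

/-- Pascal's rule together with `p ∣ p.choose (a + 1)` flips the sign at each step. -/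
theorem cast_choose_pred {B : Type*} [CommRing B] [CharP B p] {a : ℕ} (ha : a < p) :
    ((p - 1).choose a : B) = (-1) ^ a := by
  induction a with
  | zero => simp
  | succ a ih =>
    have h1 : p ∣ p.choose (a + 1) := hp.out.dvd_choose_self (Nat.succ_ne_zero _) ha
    have h2 : p.choose (a + 1) = (p - 1).choose a + (p - 1).choose (a + 1) := by
      obtain ⟨m, rfl⟩ : ∃ m, p = m + 1 := ⟨p - 1, (Nat.sub_add_cancel hp.out.one_le).symm⟩
      rfl
    have h3 := (CharP.cast_eq_zero_iff B p _).2 h1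
    rw [h2, Nat.cast_add, ih (by omega)] at h3
    rw [pow_succ]
    linear_combination h3

theorem esymmEval_const_of_char {B : Type*} [CommRing B] [CharP B p] (x : B) (j : Fin p) :
    esymmEval p (fun _ => x) (j.1 + 1) = if j.1 + 1 = p then x ^ p else 0 := by
  rw [esymmEval_const]
  split_ifs with h
  · rw [h]
    simp
  · have h1 : p ∣ p.choose (j.1 + 1) :=
      hp.out.dvd_choose_self (Nat.succ_ne_zero _) (by omega)
    rw [(CharP.cast_eq_zero_iff B p _).2 h1, zero_mul]

/-- On the diagonal `q_i = q` the value of `S_j` is `p.choose j * q^j`, which modulo `p` is `0` for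
`j < p` and `q^p` for `j = p`. So the diagonal computes the specialization `s_p ↦ q`, up to `q ↦
q^p`. -/
theorem diagSeries_esymmSubst [CharP k p] (g : MvPowerSeries (Fin p) k) :
    diagSeries k p (esymmSubst k p g) =
      PowerSeries.expand p hp.out.ne_zero (specSeries k p g) := by
  rw [diagSeries, esymmSubst, MvPowerSeries.substAlgHom_comp_substAlgHom_apply, specSeries,
    PowerSeries.expand, MvPowerSeries.expand_substAlgHom]
  congr 2
  ext1 j
  rw [coe_esymm]
  have h := map_aeval_int (MvPowerSeries.substAlgHom (R := k) (hasSubst_diag k p) :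
    MvPowerSeries (Fin p) k →+* MvPowerSeries Unit k) MvPowerSeries.X
    (esymm (Fin p) ℤ (j.1 + 1))
  simp only [RingHom.coe_coe, MvPowerSeries.substAlgHom_X] at h
  refine h.trans ((esymmEval_const_of_char _ j).trans ?_)
  split_ifs
  · simp
  · simp

/-- Restricting `subst_X_eq_sum` to the diagonal splits `ψ` by residues of exponents modulo `p`. The
signs cancel because `(p - 1).choose b = (-1)^b`, and the residue class of `a` is read off. -/
theorem coeff_specSeries [CharP k p] {g : MvPowerSeries (Fin p) k} {ψ : k⟦X⟧} {a : ℕ} (ha : a < p)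
    (hg : esymmSubst k p g = degreeSeries p ψ a) (e : ℕ) :
    PowerSeries.coeff e (specSeries k p g) = PowerSeries.coeff (p * e + a) ψ := by
  choose g' hg' using fun b => exists_esymmSubst_eq_degreeSeries (p := p) ψ b
  obtain rfl : g = g' a := esymmSubst_injective (hg.trans (hg' a).symm)
  let i : Fin p := ⟨0, hp.out.pos⟩
  have h1 : ψ = ∑ b ∈ Finset.range p,
      PowerSeries.expand p hp.out.ne_zero (specSeries k p (g' b)) * PowerSeries.X ^ b := by
    conv_lhs => rw [← diagSeries_subst (p := p) ψ i, subst_X_eq_sum, map_sum]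
    refine Finset.sum_congr rfl fun b hb => ?_
    have h2 := map_esymmErase (diagSeries k p : MvPowerSeries (Fin p) k →+* k⟦X⟧)
      MvPowerSeries.X i b
    simp only [RingHom.coe_coe, diagSeries_X] at h2
    rw [map_mul, map_mul, ← hg', diagSeries_esymmSubst, h2, esymmErase_const,
      cast_choose_pred (Finset.mem_range.mp hb), map_pow, map_neg, map_one]
    have h3 : ((-1) ^ b * (-1) ^ b : k⟦X⟧) = 1 := by
      rw [← mul_pow]
      simp
    linear_combination (PowerSeries.expand p hp.out.ne_zero (specSeries k p (g' b)) *
      PowerSeries.X ^ b) * h3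
  conv_rhs => rw [h1, map_sum]
  rw [Finset.sum_eq_single_of_mem a (Finset.mem_range.mpr ha)]
  · rw [PowerSeries.coeff_mul_X_pow, PowerSeries.coeff_expand, if_pos (dvd_mul_right p e),
      Nat.mul_div_cancel_left _ hp.out.pos]
  · intro b hb hba
    rw [PowerSeries.coeff_mul_X_pow', PowerSeries.coeff_expand]
    split_ifs with h2 h3
    · exfalso
      have hb' := Finset.mem_range.mp hb
      have h4 : p * e + a ≡ b [MOD p] := ((Nat.modEq_iff_dvd' h2).2 h3).symm
      rw [Nat.ModEq, Nat.mul_add_mod, Nat.mod_eq_of_lt ha, Nat.mod_eq_of_lt hb'] at h4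
      exact hba h4.symm
    · rfl
    · rfl

/-! ### The relation "`pU`" -/

variable (p) in
/-- The graph of the partially defined operator "`pU`". -/
def IsPU (f g : DSer Unit k) : Prop :=
  ∃ G : DSer (Fin p) k, symmHom k p G = sigmaP p f ∧ specialize k p G = g

theorem IsPU.add {f f' g g' : DSer Unit k} (h : IsPU p f g) (h' : IsPU p f' g') :
    IsPU p (f + f') (g + g') := by
  obtain ⟨G, hG, rfl⟩ := h
  obtain ⟨G', hG', rfl⟩ := h'
  exact ⟨G + G', by rw [map_add, hG, hG', sigmaP_add], map_add _ _ _⟩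

theorem IsPU.zero : IsPU p (0 : DSer Unit k) 0 :=
  ⟨0, by simp [sigmaP], map_zero _⟩

theorem IsPU.sum {ι : Type*} (s : Finset ι) {f g : ι → DSer Unit k}
    (h : ∀ i ∈ s, IsPU p (f i) (g i)) : IsPU p (∑ i ∈ s, f i) (∑ i ∈ s, g i) := by
  classical
  induction s using Finset.induction_on with
  | empty => simpa using IsPU.zero
  | insert i s hi ih =>
    rw [Finset.sum_insert hi, Finset.sum_insert hi]
    exact (h i (Finset.mem_insert_self i s)).add
      (ih fun j hj => h j (Finset.mem_insert_of_mem hj))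

/-- Frobenius is a ring endomorphism, so it passes through the sum `Σ_p` and all substitutions. -/
theorem IsPU.pow_char [CharP k p] {f g : DSer Unit k} (h : IsPU p f g) :
    IsPU p (f ^ p) (g ^ p) := by
  obtain ⟨G, hG, rfl⟩ := h
  exact ⟨G ^ p, by rw [map_pow, hG, sigmaP, sigmaP, sum_pow_char]; simp only [map_pow],
    map_pow _ _ _⟩

theorem IsPU.unique [CharP k p] {f g g' : DSer Unit k} (h : IsPU p f g) (h' : IsPU p f g') :
    g = g' := by
  obtain ⟨G, hG, rfl⟩ := h
  obtain ⟨G', hG', rfl⟩ := h'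
  rw [symmHom_injective (hG.trans hG'.symm)]

/-- Summing `subst_X_eq_sum` over `i` gives a combination of the `(p - a) S_a` with symmetric
coefficients. The terms that remain modulo `p` contain some `S_a` with `1 ≤ a < p`, which
specializes to `0`. -/
theorem isPU_C [CharP k p] (ψ : k⟦X⟧) : IsPU p (C ψ) 0 := by
  choose g hg using fun a => exists_esymmSubst_eq_degreeSeries (p := p) ψ a
  let F : ℕ → MvPowerSeries (Fin p) k := fun a =>
    (-1) ^ a * degreeSeries p ψ a * (((p : ℕ) - (a : ℕ) : MvPowerSeries (Fin p) k) *
      esymmEval p MvPowerSeries.X a)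
  have hF : sigmaP p (C ψ) = C (∑ a : Fin p, F (a.1 + 1)) := by
    have h1 : sigmaP p (C ψ) = C (∑ i, MvPowerSeries.subst
        (fun _ : Unit => (MvPowerSeries.X i : MvPowerSeries (Fin p) k)) ψ) := by
      rw [sigmaP, map_sum]
      exact Finset.sum_congr rfl fun i _ => DSer.subst_C _ _ _ _
    -- The factor `p - a` kills both `a = 0` (as `p = 0` in `k`) and `a = p`, so the sum may be
    -- shifted from `0 ≤ a < p` to `1 ≤ a ≤ p`, the indexing of the `s_j`.
    have h2 : F 0 = 0 := by simp [F]
    have h3 : F p = 0 := by simp [F]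
    rw [h1, ← Finset.sum_range (fun a => F (a + 1))]
    congr 1
    have h4 := Finset.sum_range_succ F p
    rw [Finset.sum_range_succ' F p, h2, h3, add_zero, add_zero] at h4
    rw [h4]
    simp only [subst_X_eq_sum]
    rw [Finset.sum_comm]
    refine Finset.sum_congr rfl fun a _ => ?_
    rw [← Finset.mul_sum, sum_esymmErase]
  refine ⟨C (∑ a : Fin p, (-1) ^ (a.1 + 1) * g (a.1 + 1) *
    (((p : ℕ) - ((a.1 + 1 : ℕ) : MvPowerSeries (Fin p) k) : MvPowerSeries (Fin p) k) *
      MvPowerSeries.X a)), ?_, ?_⟩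
  · rw [hF, symmHom_C, map_sum]
    congr 1
    refine Finset.sum_congr rfl fun a _ => ?_
    simp only [map_mul, map_pow, map_neg, map_one, map_sub, map_natCast, hg, esymmSubst_X, F]
  · rw [specialize_C, map_sum, Finset.sum_eq_zero, map_zero]
    intro a _
    simp only [map_mul, map_sub, map_natCast, specSeries_X]
    split_ifs with h
    · simp [h]
    · simp

end PU

/-! ### "`pU`" on the terms `V^(s+1)(φ) (q'/q^p)^(p^s)`. -/

section PUSharp

open MvPolynomial

variable {k : Type*} [Field k] {p : ℕ}

theorem coeff_vOp_iterate_antiTheta (s : ℕ) (φ : k⟦X⟧) (m : ℕ) :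
    PowerSeries.coeff m ((vOp p)^[s] (antiTheta p φ)) =
      if p ^ s ∣ m ∧ (m / p ^ s).Coprime p then
        PowerSeries.coeff (m / p ^ s) φ / ((m / p ^ s : ℕ) : k) else 0 := by
  rw [coeff_vOp_iterate, antiTheta, PowerSeries.coeff_mk]
  by_cases h : p ^ s ∣ m <;> simp [h]

/-- The `δ`-series `V ^ (s + 1) (φ) (q' / q ^ p) ^ (p ^ s)`. -/
def sharpTerm (p s : ℕ) (φ : k⟦X⟧) : DSer Unit k :=
  C (divQPow (p ^ (s + 1)) ((vOp p)^[s + 1] φ)) * X () ^ p ^ s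

theorem sharpTerm_zero (φ : k⟦X⟧) :
    sharpTerm p 0 φ = C (divQPow (p ^ 1) ((vOp p)^[1] φ)) * X () := by
  simp [sharpTerm]

variable [hp : Fact p.Prime]

/-- The values `s_p = q`, `s_j = 0` for `j < p`. -/
def specVal (k : Type*) [Field k] (p : ℕ) (j : Fin p) : k⟦X⟧ :=
  if j.1 + 1 = p then PowerSeries.X else 0

theorem coeff_pow_char [CharP k p] (ψ : k⟦X⟧) (m : ℕ) :
    PowerSeries.coeff m (ψ ^ p) = if p ∣ m then PowerSeries.coeff (m / p) ψ ^ p else 0 := by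
  have : ExpChar k p := ExpChar.prime hp.out
  have h := MvPowerSeries.map_frobenius_expand (σ := Unit) p hp.out.ne_zero (f := ψ)
  have h2 : PowerSeries.map (frobenius k p) (PowerSeries.expand p hp.out.ne_zero ψ) = ψ ^ p := h
  rw [← h2, PowerSeries.coeff_map, PowerSeries.coeff_expand]
  split_ifs
  · rfl
  · exact map_zero _

/-- On the diagonal, `δ S_(a+1)` at `q' = 0` is `z q^(p(a+1))`, where `p z = c - c^p` for the
binomial coefficient `c = p.choose (a + 1)`. Modulo `p` this `z` is `c / p` when `a + 1 < p`, and
`(a + 1) c / p = (p - 1).choose a`; for `a + 1 = p` one has `c = 1` and `z = 0`. -/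
theorem exists_deltaConstEval_specVal [CharP k p] {a : ℕ} (ha : a < p) :
    ∃ η : k, deltaConstEval p (specVal k p) a = PowerSeries.C η * PowerSeries.X ^ (a + 1) ∧
      (a + 1 < p → ((a + 1 : ℕ) : k) * η = (-1) ^ a) ∧ (a + 1 = p → η = 0) := by
  obtain ⟨z, hz, hz1, hz2⟩ : ∃ z : ℤ, (p : ℤ) * z = p.choose (a + 1) - (p.choose (a + 1) : ℤ) ^ p ∧
      (a + 1 < p → ((a + 1 : ℕ) : k) * z = (-1) ^ a) ∧ (a + 1 = p → (z : k) = 0) := by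
    by_cases h : a + 1 = p
    · refine ⟨0, ?_, fun h' => absurd h h'.ne, fun _ => Int.cast_zero⟩
      rw [h]
      simp
    · have h1 : a + 1 < p := by omega
      obtain ⟨c, hc⟩ := hp.out.dvd_choose_self (Nat.succ_ne_zero a) h1
      -- Now `p * c` is the binomial coefficient, and the witness is `(p c - (p c)^p) / p`.
      refine ⟨c - (p : ℤ) ^ (p - 1) * c ^ p, ?_, fun _ => ?_, fun h' => absurd h' h⟩
      · rw [Nat.succ_eq_add_one] at hc
        have hpp : (p : ℤ) ^ p = p * (p : ℤ) ^ (p - 1) := by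
          rw [← pow_succ', Nat.sub_add_cancel hp.out.one_le]
        rw [hc]
        push_cast
        rw [mul_pow, hpp]
        ring
      · have h2 : (a + 1) * c = (p - 1).choose a := by
          apply Nat.eq_of_mul_eq_mul_left hp.out.pos
          have := Nat.add_one_mul_choose_eq (p - 1) a
          rw [Nat.sub_add_cancel hp.out.one_le] at this
          rw [this, ← Nat.succ_eq_add_one a, hc]
          ring
        have h3 := congrArg (Nat.cast : ℕ → k) h2
        rw [cast_choose_pred ha] at h3
        rw [← h3]
        have h4 : p - 1 ≠ 0 := by have := hp.out.two_le; omega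
        simp [h4]
  refine ⟨z, ?_, hz1, hz2⟩
  have hp0 : (p : Polynomial ℤ) ≠ 0 := Nat.cast_ne_zero.mpr hp.out.ne_zero
  have hD : deltaEval p (esymm (Fin p) ℤ (a + 1)) (fun _ => (Polynomial.X : Polynomial ℤ)) 0 =
      (z : Polynomial ℤ) * Polynomial.X ^ (p * (a + 1)) := by
    apply mul_left_cancel₀ hp0
    have hz' := congrArg (Int.cast : ℤ → Polynomial ℤ) hz
    push_cast at hz'
    rw [p_mul_deltaEval, ← mul_assoc, hz']
    simp only [Pi.zero_apply, mul_zero, add_zero]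
    refine (congrArg₂ (fun u v => u - v ^ p)
      (esymmEval_const (p := p) ((Polynomial.X : Polynomial ℤ) ^ p) (a + 1))
      (esymmEval_const (p := p) (Polynomial.X : Polynomial ℤ) (a + 1))).trans ?_
    ring
  have h1 := congrArg (Polynomial.eval₂RingHom (Int.castRingHom k⟦X⟧) PowerSeries.X) hD
  rw [map_deltaEval] at h1
  simp only [map_mul, map_pow, map_intCast, Pi.zero_apply, map_zero] at h1
  simp only [Polynomial.coe_eval₂RingHom, Polynomial.eval₂_X] at h1
  have h2 := deltaConstEval_esymmEval p a (fun _ => (PowerSeries.X : k⟦X⟧))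
  have h3 := map_deltaConstEval p
    (PowerSeries.expand (R := k) p hp.out.ne_zero).toRingHom (specVal k p) a
  -- The diagonal values are `specVal` after `q ↦ q^p`, which can be undone on coefficients.
  have h4 : (fun j : Fin p => esymmEval p (fun _ => (PowerSeries.X : k⟦X⟧)) (j.1 + 1)) =
      fun j => (PowerSeries.expand (R := k) p hp.out.ne_zero).toRingHom (specVal k p j) := by
    have : CharP k⟦X⟧ p := charP_of_injective_algebraMap (algebraMap k k⟦X⟧).injective p
    ext1 j
    rw [esymmEval_const_of_char, specVal]
    split_ifs
    · simp
    · simp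
  rw [← h4, h2] at h3
  have h5 : PowerSeries.expand p hp.out.ne_zero (deltaConstEval p (specVal k p) a) =
      PowerSeries.expand p hp.out.ne_zero (PowerSeries.C (z : k) * PowerSeries.X ^ (a + 1)) := by
    refine (h3.trans h1).trans ?_
    simp [pow_mul]
  ext m
  rw [← PowerSeries.coeff_expand_mul p hp.out.ne_zero, h5, PowerSeries.coeff_expand_mul]

/-- The `p`-th power of `subst_X_eq_sum` involves exactly the linear coefficients of the `δ
S_(a+1)`. Hence `∑ ψ(q_i)^p q_i'` is a combination of the `δ S_(a+1)` minus their constant parts,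
with symmetric coefficients that specialize by `coeff_specSeries`. -/
theorem isPU_C_pow_mul_X [CharP k p] (ψ : k⟦X⟧) :
    IsPU p (C (ψ ^ p) * X ()) (∑ a : Fin p,
      C (((-1) ^ a.1 * PowerSeries.mk fun e => PowerSeries.coeff (p * e + a) ψ) ^ p) *
        ((if a.1 + 1 = p then X () else 0) - C (deltaConstEval p (specVal k p) a))) := by
  choose g hg using fun a => exists_esymmSubst_eq_degreeSeries (p := p) ψ a
  refine ⟨∑ a : Fin p, C (((-1) ^ a.1 * g a) ^ p) *
    (X a - C (deltaConstEval p MvPowerSeries.X a)), ?_, ?_⟩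
  · have h1 : sigmaP p (C (ψ ^ p) * X () : DSer Unit k) = ∑ i, C (MvPowerSeries.subst
        (fun _ : Unit => (MvPowerSeries.X i : MvPowerSeries (Fin p) k)) ψ ^ p) * X i := by
      refine Finset.sum_congr rfl fun i _ => ?_
      rw [map_mul, DSer.subst_X, map_pow, map_pow, DSer.subst_C, map_pow]
      rfl
    rw [h1, map_sum]
    simp only [map_mul, map_sub, symmHom_X, symmHom_C, map_pow, map_neg, map_one, hg,
      add_sub_cancel_left]
    simp only [subst_X_eq_sum]
    simp only [map_sum, sum_pow_char, Finset.sum_mul, Finset.mul_sum]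
    rw [Finset.sum_comm]
    refine Finset.sum_congr rfl fun i _ => ?_
    rw [Finset.sum_range]
    refine Finset.sum_congr rfl fun a _ => ?_
    simp only [map_mul, map_pow, map_neg, map_one, mul_pow]
    ring
  · rw [map_sum]
    refine Finset.sum_congr rfl fun a _ => ?_
    have h2 : specSeries k p (g a) = PowerSeries.mk fun e => PowerSeries.coeff (p * e + a) ψ := by
      ext e
      rw [coeff_specSeries a.2 (hg a), PowerSeries.coeff_mk]
    have h3 := map_deltaConstEval p (specSeries k p : MvPowerSeries (Fin p) k →+* k⟦X⟧)
      MvPowerSeries.X a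
    have h4 : (fun j : Fin p => (specSeries k p : MvPowerSeries (Fin p) k →+* k⟦X⟧)
        (MvPowerSeries.X j)) = specVal k p := funext fun j => specSeries_X j
    rw [h4, RingHom.coe_coe] at h3
    rw [map_mul, map_sub, specialize_C, specialize_C, specialize_X, h3, map_pow, map_mul, h2]
    simp

theorem coeff_divQPow_vOp_iterate (s : ℕ) (φ : k⟦X⟧) (m : ℕ) :
    PowerSeries.coeff m (divQPow (p ^ s) ((vOp p)^[s] φ)) =
      if p ^ s ∣ m then PowerSeries.coeff (m / p ^ s + 1) φ else 0 := by
  rw [divQPow, PowerSeries.coeff_mk, coeff_vOp_iterate, Nat.add_div_right _ (pow_pos hp.out.pos s)]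
  simp only [Nat.dvd_add_self_right]

/-- The series with coefficients the `p`-th roots of those of `φ`. -/
def frobRoot (p : ℕ) [Fact p.Prime] [CharP k p] [PerfectRing k p] (φ : k⟦X⟧) : k⟦X⟧ :=
  PowerSeries.map (frobeniusEquiv k p).symm.toRingHom φ

theorem coeff_frobRoot_pow [CharP k p] [PerfectRing k p] (φ : k⟦X⟧) (m : ℕ) :
    PowerSeries.coeff m (frobRoot p φ) ^ p = PowerSeries.coeff m φ := by
  rw [frobRoot, PowerSeries.coeff_map]
  exact frobenius_apply_frobeniusEquiv_symm k p _

/-- Over a perfect field `V(φ)/q^p` is a `p`-th power, so `isPU_C_pow_mul_X` applies. The index `a =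
p - 1` yields the `q'` term and `U φ`; the constants of the other indices assemble `φ^(-1)`, one
residue class modulo `p` each. -/
theorem isPU_sharpTerm_zero [CharP k p] [PerfectRing k p] (φ : k⟦X⟧) :
    IsPU p (sharpTerm p 0 φ) (sharpTerm p 0 (uOp p φ) - C (antiTheta p φ)) := by
  let ψ : k⟦X⟧ := PowerSeries.mk fun m => PowerSeries.coeff (m + 1) (frobRoot p φ)
  have hψ : ∀ m, PowerSeries.coeff m ψ ^ p = PowerSeries.coeff (m + 1) φ := fun m => by
    rw [PowerSeries.coeff_mk, coeff_frobRoot_pow]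
  have h1 : sharpTerm p 0 φ = C (ψ ^ p) * X () := by
    rw [sharpTerm_zero]
    congr 2
    ext m
    rw [coeff_divQPow_vOp_iterate, coeff_pow_char]
    simp only [pow_one, hψ]
  rw [h1]
  convert isPU_C_pow_mul_X ψ using 1
  choose! η hη hη1 hη2 using fun a (ha : a < p) => exists_deltaConstEval_specVal (k := k) ha
  let W : ℕ → k⟦X⟧ := fun a =>
    ((-1) ^ a * PowerSeries.mk fun e => PowerSeries.coeff (p * e + a) ψ) ^ p
  have hW : ∀ a m, PowerSeries.coeff m (W a) =
      if p ∣ m then (-1) ^ a * PowerSeries.coeff (m + a + 1) φ else 0 := by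
    intro a m
    have h : ((-1 : k⟦X⟧) ^ a * PowerSeries.mk fun e => PowerSeries.coeff (p * e + a) ψ) =
        PowerSeries.C ((-1) ^ a) * PowerSeries.mk fun e => PowerSeries.coeff (p * e + a) ψ := by
      simp
    simp only [W, h]
    rw [coeff_pow_char]
    refine if_ctx_congr Iff.rfl (fun hm => ?_) fun _ => rfl
    rw [PowerSeries.coeff_C_mul, mul_pow, PowerSeries.coeff_mk, hψ, ← pow_mul, mul_comm a p,
      pow_mul, neg_one_pow_char, Nat.mul_div_cancel' hm]
  have hsum : ∑ a : Fin p, C (W a) * ((if a.1 + 1 = p then X () else 0) -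
      C (deltaConstEval p (specVal k p) a)) =
      C (W (p - 1)) * X () - C (∑ a ∈ Finset.range p,
        W a * (PowerSeries.C (η a) * PowerSeries.X ^ (a + 1))) := by
    rw [map_sum, Finset.sum_range]
    simp only [mul_sub]
    rw [Finset.sum_sub_distrib]
    congr 1
    · rw [Finset.sum_eq_single (⟨p - 1, by have := hp.out.pos; omega⟩ : Fin p)]
      · simp [Nat.sub_add_cancel hp.out.one_le]
      · intro b _ hb
        rw [if_neg, mul_zero]
        intro h
        apply hb
        ext
        simp only
        omega
      · simp
    · refine Finset.sum_congr rfl fun a _ => ?_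
      rw [hη a a.2, ← map_mul]
  refine Eq.trans ?_ hsum.symm
  congr 1
  · rw [sharpTerm_zero]
    congr 2
    ext m
    rw [coeff_divQPow_vOp_iterate, hW, pow_one]
    refine if_ctx_congr Iff.rfl (fun hm => ?_) fun _ => rfl
    have hs : ((-1 : k) ^ (p - 1)) = 1 := by
      rw [← cast_choose_pred (p := p) (by have := hp.out.pos; omega)]
      simp
    rw [hs, one_mul, uOp, PowerSeries.coeff_mk, add_assoc, Nat.sub_add_cancel hp.out.one_le,
      add_mul, one_mul, Nat.div_mul_cancel hm]
  · congr 1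
    ext m
    rw [antiTheta, PowerSeries.coeff_mk, map_sum]
    -- Here `η a = (-1)^a / (a + 1)` for `a + 1 < p`: the sign cancels that of `W a`, and `a + 1 =
    -- m` in `k`. For `a = p - 1` the constant `η a` is zero.
    have hterm : ∀ a ∈ Finset.range p, PowerSeries.coeff m
        (W a * (PowerSeries.C (η a) * PowerSeries.X ^ (a + 1))) =
        if a + 1 = m % p then PowerSeries.coeff m φ / (m : k) else 0 := by
      intro a ha
      have ha' := Finset.mem_range.mp ha
      rw [← mul_assoc, PowerSeries.coeff_mul_X_pow', PowerSeries.coeff_mul_C, hW]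
      by_cases hm : a + 1 = m % p
      · have h2 : a + 1 < p := hm ▸ Nat.mod_lt m hp.out.pos
        have h3 : m - (a + 1) = p * (m / p) := by
          have := Nat.div_add_mod m p
          omega
        have h4 : a + 1 ≤ m := hm ▸ Nat.mod_le m p
        have h5 : ((a + 1 : ℕ) : k) = m := by
          rw [hm]
          exact CharP.cast_eq_mod k p m |>.symm
        have h6 : ((a + 1 : ℕ) : k) ≠ 0 := by
          rw [Ne, CharP.cast_eq_zero_iff k p]
          exact fun h => absurd (Nat.le_of_dvd (Nat.succ_pos a) h) (by omega)
        rw [if_pos h4, if_pos (h3 ▸ dvd_mul_right _ _), if_pos hm, add_assoc,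
          Nat.sub_add_cancel h4, ← h5, eq_div_iff h6, ← hη1 a ha' h2]
        have h7 : ((-1 : k) ^ a) * (-1) ^ a = 1 := by
          rw [← mul_pow]
          simp
        rw [← hη1 a ha' h2] at h7
        linear_combination PowerSeries.coeff m φ * h7
      · rw [if_neg hm]
        split_ifs with h2 h3
        · by_cases h4 : a + 1 = p
          · rw [hη2 a ha' h4, mul_zero]
          · exfalso
            apply hm
            have h5 : a + 1 ≡ m [MOD p] := (Nat.modEq_iff_dvd' h2).2 h3
            rw [Nat.ModEq, Nat.mod_eq_of_lt (by omega : a + 1 < p)] at h5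
            exact h5
        · rw [zero_mul]
        · rfl
    rw [Finset.sum_congr rfl hterm]
    by_cases hm : m % p = 0
    · rw [if_neg, Finset.sum_eq_zero]
      · intro a _
        rw [if_neg (by omega)]
      · intro h
        exact (Nat.Prime.coprime_iff_not_dvd hp.out).1 h.symm (Nat.dvd_of_mod_eq_zero hm)
    · have hlt := Nat.mod_lt m hp.out.pos
      rw [if_pos, Finset.sum_eq_single_of_mem (m % p - 1) (Finset.mem_range.mpr (by omega)),
        if_pos (by omega)]
      · intro b _ hb
        rw [if_neg (by omega)]
      · exact ((Nat.Prime.coprime_iff_not_dvd hp.out).2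
          fun h => hm (Nat.mod_eq_zero_of_dvd h)).symm

theorem sharpTerm_frobRoot_pow [CharP k p] [PerfectRing k p] (s : ℕ) (φ : k⟦X⟧) :
    sharpTerm p s (frobRoot p φ) ^ p = sharpTerm p (s + 1) φ := by
  rw [sharpTerm, sharpTerm, mul_pow, ← map_pow, ← pow_mul, ← pow_succ]
  congr 2
  ext m
  rw [coeff_pow_char, coeff_divQPow_vOp_iterate, coeff_divQPow_vOp_iterate]
  by_cases h : p ∣ m
  · obtain ⟨m, rfl⟩ := h
    rw [if_pos (dvd_mul_right p m), Nat.mul_div_cancel_left _ hp.out.pos, pow_succ' p (s + 1),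
      Nat.mul_div_mul_left _ _ hp.out.pos]
    simp only [Nat.mul_dvd_mul_iff_left hp.out.pos]
    split_ifs
    · rw [coeff_frobRoot_pow]
    · exact zero_pow hp.out.ne_zero
  · rw [if_neg h, if_neg fun h' => h ((dvd_pow_self p (Nat.succ_ne_zero _)).trans h')]

theorem vOp_iterate_antiTheta_frobRoot_pow [CharP k p] [PerfectRing k p] (s : ℕ) (φ : k⟦X⟧) :
    ((vOp p)^[s] (antiTheta p (frobRoot p φ))) ^ p = (vOp p)^[s + 1] (antiTheta p φ) := by
  ext m
  rw [coeff_pow_char, Function.iterate_succ_apply', coeff_vOp]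
  split_ifs with h
  · rw [coeff_vOp_iterate_antiTheta, coeff_vOp_iterate_antiTheta]
    split_ifs
    · rw [div_pow, coeff_frobRoot_pow]
      congr 1
      exact map_natCast (frobenius k p) _
    · exact zero_pow hp.out.ne_zero
  · rfl

theorem uOp_frobRoot [CharP k p] [PerfectRing k p] (φ : k⟦X⟧) :
    uOp p (frobRoot p φ) = frobRoot p (uOp p φ) := by
  ext m
  simp [uOp, frobRoot]

/-- The case `s + 1` is the `p`-th power of the case `s` for the series of `p`-th roots of
coefficients. -/
theorem isPU_sharpTerm [CharP k p] [PerfectRing k p] (s : ℕ) (φ : k⟦X⟧) :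
    IsPU p (sharpTerm p s φ)
      (sharpTerm p s (uOp p φ) - C ((vOp p)^[s] (antiTheta p φ))) := by
  induction s generalizing φ with
  | zero => exact isPU_sharpTerm_zero φ
  | succ s ih =>
    have h := (ih (frobRoot p φ)).pow_char
    rwa [sharpTerm_frobRoot_pow, sub_pow_char, uOp_frobRoot, sharpTerm_frobRoot_pow,
      ← map_pow, vOp_iterate_antiTheta_frobRoot_pow] at h

end PUSharp

/-! ## The shape of Taylor `δ`-`p`-symmetric series -/

section Shape

variable {k : Type*} [Field k]

theorem coeff_subst_C_mul_X_pow {S : Type*} [CommRing S] [Algebra k S] (c : S) {a : ℕ} (ha : a ≠ 0)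
    (φ : k⟦X⟧) (e : ℕ) :
    PowerSeries.coeff e (PowerSeries.subst (PowerSeries.C c * PowerSeries.X ^ a : S⟦X⟧) φ) =
      if a ∣ e then algebraMap k S (PowerSeries.coeff (e / a) φ) * c ^ (e / a) else 0 := by
  have hs : PowerSeries.HasSubst (PowerSeries.C c * PowerSeries.X ^ a : S⟦X⟧) :=
    PowerSeries.HasSubst.of_constantCoeff_zero' (by simp [ha])
  rw [PowerSeries.coeff_subst' hs]
  have hterm : ∀ d : ℕ, PowerSeries.coeff e ((PowerSeries.C c * PowerSeries.X ^ a : S⟦X⟧) ^ d) =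
      if e = a * d then c ^ d else 0 := by
    intro d
    rw [mul_pow, ← pow_mul, ← map_pow, PowerSeries.coeff_C_mul, PowerSeries.coeff_X_pow]
    simp
  simp only [hterm]
  split_ifs with h
  · obtain ⟨d, rfl⟩ := h
    rw [Nat.mul_div_cancel_left _ (Nat.pos_of_ne_zero ha), finsum_eq_single _ d]
    · simp [Algebra.smul_def]
    · intro d' hd'
      rw [if_neg, smul_zero]
      intro h
      exact hd' (Nat.eq_of_mul_eq_mul_left (Nat.pos_of_ne_zero ha) h).symm
  · refine finsum_eq_zero_of_forall_eq_zero fun d => ?_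
    rw [if_neg, smul_zero]
    rintro rfl
    exact h (dvd_mul_right _ _)

open MvPolynomial

theorem esymmErase_comp_equiv {σ B : Type*} [Fintype σ] [DecidableEq σ] [CommRing B] (x : σ → B)
    (e : Equiv.Perm σ) (i : σ) (a : ℕ) :
    esymmErase (fun l => x (e l)) i a = esymmErase x (e i) a := by
  rw [esymmErase, esymmErase]
  refine Finset.sum_bij' (fun T _ => T.map e.toEmbedding) (fun T _ => T.map e.symm.toEmbedding)
    ?_ ?_ ?_ ?_ ?_
  · intro T hT
    simpa [Finset.mem_powersetCard, Finset.subset_erase] using hT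
  · intro T hT
    simpa [Finset.mem_powersetCard, Finset.subset_erase, Equiv.symm_apply_eq] using hT
  · intro T _
    simp [Finset.map_map]
  · intro T _
    simp [Finset.map_map]
  · intro T _
    simp

/-- Modulo `x i - x j` the transposition of `i` and `j` does not change the family `x`, but it
exchanges the omitted indices. -/
theorem sub_dvd_esymmErase_sub {σ B : Type*} [Fintype σ] [DecidableEq σ] [CommRing B] (x : σ → B)
    (i j : σ) (a : ℕ) : x i - x j ∣ esymmErase x i a - esymmErase x j a := by
  let I : Ideal B := Ideal.span {x i - x j}
  have hx : Ideal.Quotient.mk I (x i) = Ideal.Quotient.mk I (x j) :=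
    Ideal.Quotient.eq.mpr (Ideal.mem_span_singleton_self _)
  rw [← Ideal.mem_span_singleton]
  apply Ideal.Quotient.eq.mp
  rw [map_esymmErase, map_esymmErase]
  have h1 : (fun l => Ideal.Quotient.mk I (x l)) =
      fun l => Ideal.Quotient.mk I (x (Equiv.swap i j l)) := by
    ext1 l
    rcases eq_or_ne l i with rfl | hi
    · rw [Equiv.swap_apply_left, hx]
    · rcases eq_or_ne l j with rfl | hj
      · rw [Equiv.swap_apply_right, hx]
      · rw [Equiv.swap_apply_of_ne_of_ne hi hj]
  conv_lhs => rw [h1]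
  rw [esymmErase_comp_equiv (fun l => Ideal.Quotient.mk I (x l)) (Equiv.swap i j),
    Equiv.swap_apply_left]

/-- The polynomials in `T` whose coefficient of `T ^ n` is divisible by `u ^ n`. -/
def dvdCoeffs {A : Type*} [CommRing A] (u : A) : Subalgebra A (Polynomial A) where
  carrier := {Q | ∀ n, u ^ n ∣ Q.coeff n}
  mul_mem' {P Q} hP hQ n := by
    rw [Polynomial.coeff_mul]
    refine Finset.dvd_sum fun x hx => ?_
    rw [← Finset.HasAntidiagonal.mem_antidiagonal.mp hx, pow_add]
    exact mul_dvd_mul (hP _) (hQ _)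
  add_mem' {P Q} hP hQ n := by
    rw [Polynomial.coeff_add]
    exact dvd_add (hP n) (hQ n)
  algebraMap_mem' r n := by
    rcases n with _ | n
    · simp
    · simp [Polynomial.algebraMap_eq]

theorem C_mul_X_mem_dvdCoeffs {A : Type*} [CommRing A] {u c : A} (h : u ∣ c) :
    Polynomial.C c * Polynomial.X ∈ dvdCoeffs u := by
  intro n
  rw [Polynomial.coeff_C_mul, Polynomial.coeff_X]
  split_ifs with hn
  · subst hn
    simpa using h
  · simp

variable {S : Type*} [CommRing S] [Algebra k S] {σ : Type*}

/-- The homomorphism `k[[x_i]][x_i'] → S[[w]][T]` with `x_i ↦ x i`, `x_i' ↦ b i * T`. -/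
def evalLine (x : σ → S⟦X⟧) (hx : MvPowerSeries.HasSubst x) (b : σ → S⟦X⟧) :
    DSer σ k →ₐ[k] Polynomial S⟦X⟧ :=
  MvPolynomial.aevalTower
    ((IsScalarTower.toAlgHom k S⟦X⟧ (Polynomial S⟦X⟧)).comp
      (MvPowerSeries.substAlgHom (R := k) hx))
    fun i => Polynomial.C (b i) * Polynomial.X

theorem evalLine_C (x : σ → S⟦X⟧) (hx : MvPowerSeries.HasSubst x) (b : σ → S⟦X⟧)
    (φ : MvPowerSeries σ k) : evalLine x hx b (C φ) =
      Polynomial.C (MvPowerSeries.substAlgHom (R := k) hx φ) := by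
  rw [evalLine, aevalTower_C]
  rfl

theorem evalLine_X (x : σ → S⟦X⟧) (hx : MvPowerSeries.HasSubst x) (b : σ → S⟦X⟧) (i : σ) :
    evalLine (k := k) x hx b (X i) = Polynomial.C (b i) * Polynomial.X := by
  rw [evalLine, aevalTower_X]

variable {p : ℕ}

theorem coeff_evalLine_subst (x : Fin p → S⟦X⟧) (hx : MvPowerSeries.HasSubst x) (b : Fin p → S⟦X⟧)
    (f : DSer Unit k) (j : Fin p) (n : ℕ) :
    (evalLine (k := k) x hx b (DSer.subst
      (fun _ : Unit => (MvPowerSeries.X j : MvPowerSeries (Fin p) k))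
      (MvPowerSeries.hasSubst_of_constantCoeff_zero fun _ => MvPowerSeries.constantCoeff_X j)
      (fun _ => DSer.var' j) f)).coeff n =
      PowerSeries.subst (x j) (coeff (Finsupp.single () n) f) * b j ^ n := by
  have hxj : PowerSeries.HasSubst (x j) := hx.const_coeff j
  induction f using MvPolynomial.induction_on' with
  | monomial m φ =>
    obtain ⟨d, rfl⟩ : ∃ d, m = Finsupp.single () d := ⟨m (), by ext; simp⟩
    have h1 : (monomial (Finsupp.single () d) φ : DSer Unit k) = C φ * X () ^ d := by
      rw [C_mul_X_pow_eq_monomial]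
    have h2 : MvPowerSeries.substAlgHom (R := k) hx (MvPowerSeries.subst
        (fun _ : Unit => (MvPowerSeries.X j : MvPowerSeries (Fin p) k)) φ) =
        PowerSeries.subst (x j) φ := by
      rw [MvPowerSeries.substAlgHom_apply, MvPowerSeries.subst_comp_subst_apply
        (MvPowerSeries.hasSubst_of_constantCoeff_zero fun _ => MvPowerSeries.constantCoeff_X j) hx]
      simp only [MvPowerSeries.subst_X hx]
      rfl
    rw [coeff_monomial, h1, map_mul, map_mul, map_pow, map_pow, DSer.subst_C, DSer.subst_X,
      DSer.var', evalLine_C, evalLine_X, h2, mul_pow, ← map_pow, ← mul_assoc, ← map_mul,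
      Polynomial.coeff_C_mul, Polynomial.coeff_X_pow]
    by_cases hn : n = d
    · subst hn
      simp
    · rw [if_neg hn, if_neg fun h => hn (Finsupp.single_injective _ h).symm, mul_zero,
        ← PowerSeries.coe_substAlgHom hxj, map_zero, zero_mul]
  | add f g hf hg =>
    rw [map_add, map_add, Polynomial.coeff_add, hf, hg, coeff_add,
      ← PowerSeries.coe_substAlgHom hxj, map_add, add_mul]

variable [hp : Fact p.Prime]

/-- Along the line `q_i' = b_i T` each `s_a'` becomes a constant plus a multiple of `u T`. Such
elements lie in the subalgebra `dvdCoeffs u`. -/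
theorem evalLine_symmHom_mem [CharP k p] (x : Fin p → S⟦X⟧) (hx : MvPowerSeries.HasSubst x)
    (b : Fin p → S⟦X⟧) {u : S⟦X⟧} (hu : ∀ a, u ∣ ∑ i, esymmErase x i a ^ p * b i)
    (G : DSer (Fin p) k) : evalLine x hx b (symmHom k p G) ∈ dvdCoeffs u := by
  induction G using MvPolynomial.induction_on with
  | C φ =>
    rw [symmHom_C, evalLine_C]
    exact (dvdCoeffs u).algebraMap_mem _
  | add P Q hP hQ =>
    rw [map_add, map_add]
    exact add_mem hP hQ
  | mul_X P a hP =>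
    rw [map_mul, map_mul]
    refine mul_mem hP ?_
    have h : ∀ i : Fin p, MvPowerSeries.substAlgHom (R := k) hx (esymmErase MvPowerSeries.X i a) =
        esymmErase x i a := fun i => by
      have := map_esymmErase (MvPowerSeries.substAlgHom (R := k) hx :
        MvPowerSeries (Fin p) k →+* MvPowerSeries Unit S) MvPowerSeries.X i a
      simpa only [RingHom.coe_coe, MvPowerSeries.substAlgHom_X] using this
    rw [symmHom_X, map_add, evalLine_C, map_sum]
    refine add_mem ((dvdCoeffs u).algebraMap_mem _) ?_
    have h2 : ∑ i, evalLine (k := k) x hx b (C (esymmErase MvPowerSeries.X i a ^ p) * X i) =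
        Polynomial.C (∑ i, esymmErase x i a ^ p * b i) * Polynomial.X := by
      rw [map_sum, Finset.sum_mul]
      refine Finset.sum_congr rfl fun i _ => ?_
      rw [map_mul, evalLine_C, evalLine_X, map_pow, h, map_mul, mul_assoc]
    rw [h2]
    exact C_mul_X_mem_dvdCoeffs (hu a)

/-- For `M = p^v M0` with `p ∤ M0`, `X^M - 1 = (X - 1)^(p^v) g^(p^v)` with `g(1) = M0 ≠ 0`. So the
order of vanishing at `1` is exactly `p^v`. -/
theorem le_of_X_sub_one_pow_dvd [CharP k p] {c : k} (hc : c ≠ 0) {r M : ℕ} (hM : M ≠ 0)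
    (h : (Polynomial.X - 1 : Polynomial k) ^ r ∣ Polynomial.C c * (Polynomial.X ^ M - 1)) :
    r ≤ p ^ padicValNat p M := by
  obtain ⟨v, M0, hM0, rfl⟩ := Nat.exists_eq_pow_mul_and_not_dvd hM p hp.out.ne_one
  have hM00 : M0 ≠ 0 := by
    rintro rfl
    simp at hM
  have hv : padicValNat p (p ^ v * M0) = v := by
    rw [padicValNat.mul (pow_ne_zero v hp.out.ne_zero) hM00, padicValNat.prime_pow,
      padicValNat.eq_zero_of_not_dvd hM0, add_zero]
  rw [hv]
  let g : Polynomial k := ∑ i ∈ Finset.range M0, Polynomial.X ^ i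
  have hfac : (Polynomial.X ^ (p ^ v * M0) - 1 : Polynomial k) =
      (Polynomial.X - 1) ^ p ^ v * g ^ p ^ v := by
    rw [← mul_pow, mul_geom_sum, sub_pow_char_pow, one_pow, ← pow_mul, mul_comm M0]
  have hg : g.eval 1 ≠ 0 := by
    simp only [g, Polynomial.eval_finsetSum, Polynomial.eval_pow, Polynomial.eval_X, one_pow,
      Finset.sum_const, Finset.card_range, nsmul_eq_mul, mul_one]
    rwa [Ne, CharP.cast_eq_zero_iff k p]
  have hX : (Polynomial.X - 1 : Polynomial k) = Polynomial.X - Polynomial.C 1 := by simp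
  have hcop : IsCoprime ((Polynomial.X - 1 : Polynomial k) ^ r) (Polynomial.C c * g ^ p ^ v) := by
    refine IsCoprime.pow_left (IsCoprime.mul_right ?_ (IsCoprime.pow_right ?_))
    · exact isCoprime_one_right.of_isCoprime_of_dvd_right
        (isUnit_iff_dvd_one.mp (Polynomial.isUnit_C.mpr hc.isUnit))
    · rw [hX, (Polynomial.irreducible_X_sub_C (1 : k)).coprime_iff_not_dvd,
        Polynomial.dvd_iff_isRoot]
      exact hg
  rw [hfac, mul_left_comm] at h
  have h2 := hcop.dvd_of_dvd_mul_right h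
  have hX1 : (Polynomial.X - 1 : Polynomial k).natDegree = 1 := by
    rw [hX, Polynomial.natDegree_X_sub_C]
  have hX0 : (Polynomial.X - 1 : Polynomial k) ≠ 0 := by
    rw [hX]
    exact Polynomial.X_sub_C_ne_zero 1
  have h3 := Polynomial.natDegree_le_of_dvd h2 (pow_ne_zero _ hX0)
  simpa [Polynomial.natDegree_pow, hX1] using h3

/-- With `r` the smaller valuation (the one of `p n` if `m = 0`), `p^r` divides `m` and `m + p n`,
hence `p n`. As `p n ≤ p^r`, equality holds. -/
theorem exists_eq_pow_of_le_pow_padicValNat {m n : ℕ} (hn : n ≠ 0)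
    (h1 : m ≠ 0 → p * n ≤ p ^ padicValNat p m)
    (h2 : p * n ≤ p ^ padicValNat p (m + p * n)) : ∃ s, n = p ^ s ∧ p ^ (s + 1) ∣ m := by
  obtain ⟨r, hr, hrm, hrn⟩ : ∃ r, p * n ≤ p ^ r ∧ p ^ r ∣ m ∧ p ^ r ∣ p * n := by
    by_cases hm : m = 0
    · subst hm
      rw [zero_add] at h2
      exact ⟨_, h2, dvd_zero _, pow_padicValNat_dvd⟩
    · rcases le_total (padicValNat p m) (padicValNat p (m + p * n)) with h | h
      · have hd := (pow_dvd_pow p h).trans (pow_padicValNat_dvd (n := m + p * n))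
        exact ⟨_, h1 hm, pow_padicValNat_dvd, (Nat.dvd_add_right pow_padicValNat_dvd).1 hd⟩
      · have hd := (pow_dvd_pow p h).trans (pow_padicValNat_dvd (n := m))
        exact ⟨_, h2, hd, (Nat.dvd_add_right hd).1 pow_padicValNat_dvd⟩
  have hpn : 0 < p * n := Nat.mul_pos hp.out.pos (Nat.pos_of_ne_zero hn)
  have heq : p * n = p ^ r := le_antisymm hr (Nat.le_of_dvd hpn hrn)
  rcases r with _ | s
  · exfalso
    have h3 := Nat.eq_one_of_mul_eq_one_right (heq.trans (pow_zero p))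
    exact hp.out.ne_one h3
  · refine ⟨s, ?_, hrm⟩
    rw [pow_succ'] at heq
    exact Nat.eq_of_mul_eq_mul_left hp.out.pos heq

theorem dvd_of_isTaylorSymmetric [CharP k p] {f : DSer Unit k} (hf : IsTaylorSymmetric p f)
    (x : Fin p → S⟦X⟧) (hx : MvPowerSeries.HasSubst x) (b : Fin p → S⟦X⟧) {i j : Fin p}
    (hij : i ≠ j) (hb : ∀ l, l ≠ i → l ≠ j → b l = 0)
    (hu : ∀ a, (x i - x j) ^ p ∣ esymmErase x i a ^ p * b i + esymmErase x j a ^ p * b j)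
    {n : ℕ} (hn : n ≠ 0) : ((x i - x j) ^ p) ^ n ∣
      PowerSeries.subst (x i) (coeff (Finsupp.single () n) f) * b i ^ n +
        PowerSeries.subst (x j) (coeff (Finsupp.single () n) f) * b j ^ n := by
  obtain ⟨G, hG⟩ := hf
  have hsum : ∀ F : Fin p → S⟦X⟧, (∀ l, b l = 0 → F l = 0) → ∑ l, F l = F i + F j := by
    intro F hF
    rw [← Finset.sum_pair hij]
    refine (Finset.sum_subset (Finset.subset_univ _) fun l _ hl => ?_).symm
    simp only [Finset.mem_insert, Finset.mem_singleton, not_or] at hl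
    exact hF l (hb l hl.1 hl.2)
  have h1 := evalLine_symmHom_mem x hx b (u := (x i - x j) ^ p) (fun a => by
    rw [hsum _ fun l hl => by rw [hl, mul_zero]]
    exact hu a) G n
  rw [hG, sigmaP, map_sum, Polynomial.finsetSum_coeff] at h1
  simp only [coeff_evalLine_subst] at h1
  rwa [hsum _ fun l hl => by rw [hl, zero_pow hn, mul_zero]] at h1

/-- Put `q_1 = t w`, `q_2 = w` and all other variables zero. Two tangent directions give the two
valuation bounds required by `exists_eq_pow_of_le_pow_padicValNat`. -/
theorem dcoeff_ne_zero_of_isTaylorSymmetric [CharP k p] (hp2 : p ≠ 2) {f : DSer Unit k}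
    (hf : IsTaylorSymmetric p f) {m n : ℕ} (hn : n ≠ 0) (hmn : dcoeff m n f ≠ 0) :
    ∃ s, n = p ^ s ∧ p ^ (s + 1) ∣ m := by
  have : CharP (Polynomial k)⟦X⟧ p :=
    charP_of_injective_algebraMap (algebraMap k (Polynomial k)⟦X⟧).injective p
  let i : Fin p := ⟨0, hp.out.pos⟩
  let j : Fin p := ⟨1, hp.out.one_lt⟩
  have hij : i ≠ j := by simp [i, j]
  let t : Polynomial k := Polynomial.X
  let x : Fin p → (Polynomial k)⟦X⟧ := fun l =>
    if l = i then PowerSeries.C t * PowerSeries.X ^ 1 else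
      if l = j then PowerSeries.C 1 * PowerSeries.X ^ 1 else 0
  have hxi : x i = PowerSeries.C t * PowerSeries.X ^ 1 := if_pos rfl
  have hxj : x j = PowerSeries.C 1 * PowerSeries.X ^ 1 := by simp only [x, if_neg hij.symm, if_true]
  have hx : MvPowerSeries.HasSubst x := by
    refine MvPowerSeries.hasSubst_of_constantCoeff_zero fun l => ?_
    change PowerSeries.constantCoeff (x l) = 0
    simp only [x]
    split_ifs <;> simp
  have hxij : ((x i - x j) ^ p) ^ n =
      PowerSeries.C ((t - 1) ^ (p * n)) * PowerSeries.X ^ (p * n) := by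
    rw [hxi, hxj, ← sub_mul, ← map_sub, ← pow_mul, mul_pow, ← map_pow, pow_one]
  have hC : ∀ (c : Polynomial k) (H : (Polynomial k)⟦X⟧) (e : ℕ),
      PowerSeries.C c * PowerSeries.X ^ (p * n) ∣ H → c ∣ PowerSeries.coeff e H := by
    rintro c _ e ⟨H, rfl⟩
    rw [mul_assoc, PowerSeries.coeff_C_mul]
    exact dvd_mul_right _ _
  set φ := coeff (Finsupp.single () n) f with hφ
  have hc : PowerSeries.coeff m φ ≠ 0 := hmn
  have hsub : ∀ (c : Polynomial k) (e : ℕ), PowerSeries.coeff e (PowerSeries.subst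
      (PowerSeries.C c * PowerSeries.X ^ 1 : (Polynomial k)⟦X⟧) φ) =
      Polynomial.C (PowerSeries.coeff e φ) * c ^ e := by
    intro c e
    rw [coeff_subst_C_mul_X_pow c one_ne_zero, if_pos (one_dvd e), Nat.div_one]
    rfl
  -- Tangent direction `(1, -1)`.
  have h1 : (t - 1) ^ (p * n) ∣ Polynomial.C (PowerSeries.coeff m φ) * (t ^ m + (-1) ^ n) := by
    have h := dvd_of_isTaylorSymmetric hf x hx
      (fun l => if l = i then 1 else if l = j then -1 else 0)
      hij (fun l hi hj => by simp [hi, hj]) (fun a => by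
        simp only [if_true, if_neg hij.symm, mul_one, mul_neg]
        rw [← sub_eq_add_neg, ← sub_pow_char]
        exact pow_dvd_pow_of_dvd (sub_dvd_esymmErase_sub x i j a) p) hn
    simp only [if_true, if_neg hij.symm, one_pow, mul_one] at h
    rw [hxij, hxi, hxj] at h
    have h' := hC _ _ m h
    have hneg : ((-1) ^ n : (Polynomial k)⟦X⟧) = PowerSeries.C ((-1) ^ n) := by simp
    rw [map_add, hneg, PowerSeries.coeff_mul_C, hsub, hsub, one_pow] at h'
    convert h' using 1
    ring
  -- Tangent direction `(q_1^p, -q_2^p)`, which shifts the exponent `m` to `m + p n`.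
  have h2 : (t - 1) ^ (p * n) ∣
      Polynomial.C (PowerSeries.coeff m φ) * (t ^ (m + p * n) + (-1) ^ n) := by
    have h := dvd_of_isTaylorSymmetric hf x hx
      (fun l => if l = i then x i ^ p else if l = j then - x j ^ p else 0)
      hij (fun l hi hj => by simp [hi, hj]) (fun a => by
        simp only [if_true, if_neg hij.symm, mul_neg]
        rw [← sub_eq_add_neg, ← mul_pow, ← mul_pow, ← sub_pow_char]
        refine pow_dvd_pow_of_dvd ?_ p
        have e1 : esymmErase x i a * x i - esymmErase x j a * x j =
          (esymmErase x i a - esymmErase x j a) * x i + esymmErase x j a * (x i - x j) := by ring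
        rw [e1]
        exact dvd_add ((sub_dvd_esymmErase_sub x i j a).mul_right _) (dvd_mul_left _ _)) hn
    simp only [if_true, if_neg hij.symm] at h
    rw [hxij, hxi, hxj] at h
    have h' := hC _ _ (m + p * n) h
    have e1 : ((PowerSeries.C t * PowerSeries.X ^ 1 : (Polynomial k)⟦X⟧) ^ p) ^ n =
        PowerSeries.C (t ^ (p * n)) * PowerSeries.X ^ (p * n) := by
      rw [← pow_mul, mul_pow, ← map_pow, pow_one]
    have e2 : (-(PowerSeries.C 1 * PowerSeries.X ^ 1 : (Polynomial k)⟦X⟧) ^ p) ^ n =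
        PowerSeries.C ((-1) ^ n) * PowerSeries.X ^ (p * n) := by
      rw [neg_pow, ← pow_mul, mul_pow, map_one, one_pow, pow_one, one_mul, map_pow, map_neg, map_one]
    rw [map_add, e1, e2, ← mul_assoc, ← mul_assoc, PowerSeries.coeff_mul_X_pow,
      PowerSeries.coeff_mul_X_pow, PowerSeries.coeff_mul_C, PowerSeries.coeff_mul_C, hsub, hsub,
      one_pow] at h'
    convert h' using 1
    ring
  -- For even `n`, setting `t = 1` would make twice a nonzero coefficient vanish, impossible for odd
  -- `p`.
  have hodd : ((-1) ^ n : Polynomial k) = -1 := by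
    rcases Nat.even_or_odd n with he | ho
    · exfalso
      have h3 : (t - 1) ∣ Polynomial.C (PowerSeries.coeff m φ) * (t ^ m + (-1) ^ n) :=
        (dvd_pow_self _ (Nat.mul_ne_zero hp.out.ne_zero hn)).trans h1
      have h4 := Polynomial.eval_dvd (x := 1) h3
      simp only [t, he.neg_one_pow, Polynomial.eval_sub, Polynomial.eval_X, Polynomial.eval_one,
        sub_self, Polynomial.eval_mul, Polynomial.eval_C, Polynomial.eval_add, Polynomial.eval_pow,
        one_pow, zero_dvd_iff, mul_eq_zero, hc, false_or, one_add_one_eq_two] at h4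
      have h5 : ((2 : ℕ) : k) = 0 := by exact_mod_cast h4
      rw [CharP.cast_eq_zero_iff k p, Nat.dvd_prime Nat.prime_two] at h5
      exact h5.elim hp.out.ne_one hp2
    · exact ho.neg_one_pow
  rw [hodd, ← sub_eq_add_neg] at h1 h2
  refine exists_eq_pow_of_le_pow_padicValNat hn (fun hm => le_of_X_sub_one_pow_dvd hc hm h1)
    (le_of_X_sub_one_pow_dvd hc ?_ h2)
  exact (Nat.add_pos_right _ (Nat.mul_pos hp.out.pos (Nat.pos_of_ne_zero hn))).ne'

end Shape

/-! ## The Hecke operators away from `p` on coefficients -/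

section Away

open MvPolynomial

variable {k : Type*} [Field k]

theorem dcoeff_ext {f g : DSer Unit k} (h : ∀ m n, dcoeff m n f = dcoeff m n g) : f = g := by
  ext n : 1
  obtain ⟨d, rfl⟩ : ∃ d, n = Finsupp.single () d := ⟨n (), by ext; simp⟩
  exact PowerSeries.ext fun m => h m d

theorem dcoeff_add (m n : ℕ) (f g : DSer Unit k) :
    dcoeff m n (f + g) = dcoeff m n f + dcoeff m n g := by
  simp [dcoeff]

theorem dcoeff_smul (m n : ℕ) (c : k) (f : DSer Unit k) :
    dcoeff m n (c • f) = c * dcoeff m n f := by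
  rw [dcoeff, coeff_smul, PowerSeries.coeff_smul, smul_eq_mul]
  rfl

theorem dcoeff_sum {ι : Type*} (s : Finset ι) (m n : ℕ) (f : ι → DSer Unit k) :
    dcoeff m n (∑ i ∈ s, f i) = ∑ i ∈ s, dcoeff m n (f i) := by
  simp [dcoeff, coeff_sum]

theorem dcoeff_C_mul_X_pow (m n d : ℕ) (φ : k⟦X⟧) :
    dcoeff m n (C φ * X () ^ d : DSer Unit k) = if n = d then PowerSeries.coeff m φ else 0 := by
  rw [dcoeff, C_mul_X_pow_eq_monomial, coeff_monomial]
  by_cases h : n = d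
  · rw [if_pos h, if_pos (by rw [h])]
  · rw [if_neg h, if_neg fun h' => h (Finsupp.single_injective _ h').symm]
    rfl

theorem dcoeff_C (m n : ℕ) (φ : k⟦X⟧) :
    dcoeff m n (C φ : DSer Unit k) = if n = 0 then PowerSeries.coeff m φ else 0 := by
  simpa using dcoeff_C_mul_X_pow m n 0 φ

@[elab_as_elim]
theorem DSer.induction {P : DSer Unit k → Prop} (f : DSer Unit k)
    (hmon : ∀ (φ : k⟦X⟧) (d : ℕ), P (C φ * X () ^ d)) (hadd : ∀ f g, P f → P g → P (f + g)) :
    P f := by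
  induction f using MvPolynomial.induction_on' with
  | monomial m φ =>
    obtain ⟨d, rfl⟩ : ∃ d, m = Finsupp.single () d := ⟨m (), by ext; simp⟩
    rw [← C_mul_X_pow_eq_monomial]
    exact hmon φ d
  | add f g hf hg => exact hadd f g hf hg

variable (p : ℕ)

/-- The coefficient of `q ^ M * (q' / q ^ p) ^ n` in `f`. -/
def tcoeff (n M : ℕ) (f : DSer Unit k) : k := if p * n ≤ M then dcoeff (M - p * n) n f else 0

theorem tcoeff_add (n M : ℕ) (f g : DSer Unit k) :
    tcoeff p n M (f + g) = tcoeff p n M f + tcoeff p n M g := by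
  simp only [tcoeff, dcoeff_add]
  split_ifs <;> simp

theorem tcoeff_smul (n M : ℕ) (c : k) (f : DSer Unit k) :
    tcoeff p n M (c • f) = c * tcoeff p n M f := by
  simp only [tcoeff, dcoeff_smul]
  split_ifs <;> simp

theorem tcoeff_zero (n M : ℕ) : tcoeff p n M (0 : DSer Unit k) = 0 := by
  simpa using tcoeff_smul p n M (0 : k) 0

theorem tcoeff_sum {ι : Type*} (s : Finset ι) (n M : ℕ) (f : ι → DSer Unit k) :
    tcoeff p n M (∑ i ∈ s, f i) = ∑ i ∈ s, tcoeff p n M (f i) := by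
  simp only [tcoeff, dcoeff_sum]
  split_ifs <;> simp

theorem dcoeff_eq_tcoeff (m n : ℕ) (f : DSer Unit k) : dcoeff m n f = tcoeff p n (m + p * n) f := by
  rw [tcoeff, if_pos (Nat.le_add_left _ _), Nat.add_sub_cancel]

theorem tcoeff_zero_left (M : ℕ) (f : DSer Unit k) : tcoeff p 0 M f = dcoeff M 0 f := by
  simp [tcoeff]

variable {p}

theorem tcoeff_ext {f g : DSer Unit k} (h : ∀ n M, tcoeff p n M f = tcoeff p n M g) : f = g :=
  dcoeff_ext fun m n => by rw [dcoeff_eq_tcoeff p, h, ← dcoeff_eq_tcoeff]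

theorem tcoeff_C_mul_X_pow (n M d : ℕ) (φ : k⟦X⟧) :
    tcoeff p n M (C φ * X () ^ d : DSer Unit k) =
      if n = d then (if p * n ≤ M then PowerSeries.coeff (M - p * n) φ else 0) else 0 := by
  rw [tcoeff, dcoeff_C_mul_X_pow]
  split_ifs <;> rfl

variable [hp : Fact p.Prime]

theorem scale_C_mul_X_pow [CharP k p] (c : k) {a : ℕ} (ha : a ≠ 0) (φ : k⟦X⟧) (d : ℕ) :
    scale p c a ha (C φ * X () ^ d) =
      C (PowerSeries.subst (PowerSeries.C c * PowerSeries.X ^ a : k⟦X⟧) φ *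
        PowerSeries.C ((c ^ p * a) ^ d) * PowerSeries.X ^ (p * (a - 1) * d)) * X () ^ d := by
  rw [scale, map_mul, map_pow, DSer.subst_C, DSer.subst_X, deltaEval_scale]
  have h1 : (DSer.var () : DSer Unit k) = C (PowerSeries.X : k⟦X⟧) := rfl
  have h2 : ((a : ℕ) : DSer Unit k) = C (PowerSeries.C (a : k)) := by simp
  have h3 : DSer.var' () = (X () : DSer Unit k) := rfl
  rw [h1, h2, h3, DSer.ofSeries]
  have h4 : C (PowerSeries.C c) ^ p * C (PowerSeries.C (a : k)) *
      C (PowerSeries.X : k⟦X⟧) ^ (p * (a - 1)) * (X () : DSer Unit k) =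
      C (PowerSeries.C (c ^ p * a) * PowerSeries.X ^ (p * (a - 1))) * X () := by
    simp only [map_mul, map_pow]
  refine (congrArg (fun z => C (PowerSeries.subst (PowerSeries.C c * PowerSeries.X ^ a : k⟦X⟧) φ) *
    z ^ d) h4).trans ?_
  rw [mul_pow, ← mul_assoc, ← map_pow, ← map_mul, mul_pow, ← map_pow, ← pow_mul, ← mul_assoc]

/-- `δ(c q^a) / (c q^a)^p = a q'/q^p`: the substitution does not mix powers of `q'/q^p`, which is
the reason for using these coordinates. -/
theorem tcoeff_scale [CharP k p] (c : k) {a : ℕ} (ha : a ≠ 0) (f : DSer Unit k) (n M : ℕ) :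
    tcoeff p n M (scale p c a ha f) =
      if a ∣ M then c ^ (M / a) * (a : k) ^ n * tcoeff p n (M / a) f else 0 := by
  induction f using DSer.induction with
  | hmon φ d =>
    rw [scale_C_mul_X_pow, tcoeff_C_mul_X_pow, tcoeff_C_mul_X_pow]
    by_cases hn : n = d
    swap
    · simp [hn]
    subst hn
    rw [if_pos rfl, if_pos rfl, PowerSeries.coeff_mul_X_pow', PowerSeries.coeff_mul_C,
      coeff_subst_C_mul_X_pow c ha]
    have hapos := Nat.pos_of_ne_zero ha
    have h1 : p * n ≤ M / a ↔ a * (p * n) ≤ M := by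
      rw [Nat.le_div_iff_mul_le hapos, mul_comm]
    have h2 : p * (a - 1) * n + p * n = a * (p * n) := by
      obtain ⟨b, rfl⟩ := Nat.exists_eq_succ_of_ne_zero ha
      simp only [Nat.succ_eq_add_one, Nat.add_sub_cancel]
      ring
    by_cases h3 : a * (p * n) ≤ M
    · have h4 : p * n ≤ M := le_trans (Nat.le_mul_of_pos_left _ hapos) h3
      have h5 : M - p * n - p * (a - 1) * n = M - a * (p * n) := by omega
      rw [if_pos h4, if_pos (by omega), h5, if_pos (h1.2 h3)]
      by_cases h6 : a ∣ M
      · obtain ⟨M, rfl⟩ := h6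
        rw [← Nat.mul_sub, if_pos (dvd_mul_right _ _), if_pos (dvd_mul_right _ _),
          Nat.mul_div_cancel_left _ hapos, Nat.mul_div_cancel_left _ hapos]
        have h7 : p * n ≤ M := Nat.le_of_mul_le_mul_left h3 hapos
        have h8 : c ^ M = c ^ (M - p * n) * c ^ (p * n) := by
          rw [← pow_add, Nat.sub_add_cancel h7]
        rw [h8, mul_pow, ← pow_mul, Algebra.algebraMap_self_apply]
        ring
      · rw [if_neg h6, if_neg, zero_mul]
        rwa [Nat.dvd_sub_iff_left h3 (dvd_mul_right _ _)]
    · rw [if_neg fun h => h3 (h1.1 h), mul_zero, ite_self]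
      split_ifs
      · omega
      all_goals simp
  | hadd f g hf hg =>
    rw [map_add, tcoeff_add, hf, hg, tcoeff_add]
    split_ifs
    · ring
    · ring

theorem dcoeff_relFrob (f : DSer Unit k) (m n : ℕ) : dcoeff m n (relFrob k p f) =
    if p ∣ m ∧ p ∣ n then dcoeff (m / p) (n / p) f else 0 := by
  induction f using DSer.induction with
  | hmon φ d =>
    have h1 : relFrob k p (C φ * X () ^ d) = C (PowerSeries.subst
        (PowerSeries.C 1 * PowerSeries.X ^ p : k⟦X⟧) φ) * X () ^ (p * d) := by
      rw [relFrob, map_mul, map_pow, DSer.subst_C, DSer.subst_X, pow_mul, map_one, one_mul]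
      rfl
    rw [h1, dcoeff_C_mul_X_pow, dcoeff_C_mul_X_pow, coeff_subst_C_mul_X_pow _ hp.out.ne_zero]
    by_cases hn : p ∣ n
    · obtain ⟨n, rfl⟩ := hn
      rw [Nat.mul_div_cancel_left _ hp.out.pos]
      by_cases hd : n = d
      · subst hd
        simp
      · rw [if_neg fun h => hd (Nat.eq_of_mul_eq_mul_left hp.out.pos h), if_neg hd, ite_self]
    · rw [if_neg, if_neg fun h => hn h.2]
      rintro rfl
      exact hn (dvd_mul_right _ _)
  | hadd f g hf hg =>
    rw [map_add, dcoeff_add, hf, hg, dcoeff_add]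
    split_ifs
    · rfl
    · simp

theorem tcoeff_relFrob (f : DSer Unit k) (n M : ℕ) : tcoeff p n M (relFrob k p f) =
    if p ∣ M ∧ p ∣ n then tcoeff p (n / p) (M / p) f else 0 := by
  rw [tcoeff, dcoeff_relFrob, tcoeff]
  by_cases hn : p ∣ n
  · obtain ⟨n, rfl⟩ := hn
    rw [Nat.mul_div_cancel_left _ hp.out.pos]
    by_cases hM : p ∣ M
    · obtain ⟨M, rfl⟩ := hM
      rw [Nat.mul_div_cancel_left _ hp.out.pos, ← Nat.mul_sub, Nat.mul_div_cancel_left _ hp.out.pos]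
      simp [Nat.mul_le_mul_left_iff hp.out.pos]
    · rw [if_neg (fun h => hM h.1 : ¬ (p ∣ M ∧ p ∣ p * n))]
      split_ifs with h1 h2
      · exact absurd ((Nat.dvd_sub_iff_left h1 (dvd_mul_right _ _)).1 h2.1) hM
      · rfl
      · rfl
  · simp [hn]

theorem sum_primitiveRoot_pow {η : k} {D : ℕ} (hη : IsPrimitiveRoot η D) (j : ℕ) :
    ∑ B ∈ Finset.range D, (η ^ B) ^ j = if D ∣ j then (D : k) else 0 := by
  have h : ∀ B, (η ^ B) ^ j = (η ^ j) ^ B := fun B => by rw [← pow_mul, mul_comm, pow_mul]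
  simp only [h]
  split_ifs with hD
  · rw [(hη.pow_eq_one_iff_dvd j).2 hD]
    simp
  · have h1 : η ^ j - 1 ≠ 0 := fun h => hD ((hη.pow_eq_one_iff_dvd j).1 (sub_eq_zero.mp h))
    apply mul_left_cancel₀ h1
    rw [mul_geom_sum, mul_zero, ← pow_mul, mul_comm, pow_mul, hη.pow_eq_one, one_pow, sub_self]

/-- The sum over `B` selects the exponents divisible by `D = n / A` and contributes a factor `D`;
the scalars collapse to `n * n^(κ-1) * D^(-κ) * D = A^κ D`. -/
theorem tcoeff_smul_deltaHecke [CharP k p] (N κ : ℕ) {n : ℕ} (hn : n ≠ 0) (hnp : n.Coprime p)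
    {ζ : k} (hζ : IsPrimitiveRoot ζ n) (f : DSer Unit k) (m M : ℕ) :
    tcoeff p m M ((n : k) • deltaHecke p N κ n ζ f) = ∑ A ∈ n.divisors with A.Coprime N,
      if A * n ∣ M then (A : k) ^ κ * (A : k) ^ (2 * m) * ((n / A : ℕ) : k) *
        tcoeff p m (M / A ^ 2) f else 0 := by
  have hn0 : (n : k) ≠ 0 := by
    rw [Ne, CharP.cast_eq_zero_iff k p]
    exact (Nat.Prime.coprime_iff_not_dvd hp.out).1 hnp.symm
  rw [tcoeff_smul, deltaHecke, tcoeff_smul, tcoeff_sum]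
  simp only [tcoeff_sum, tcoeff_smul, tcoeff_scale]
  rw [Finset.sum_filter, Finset.sum_filter, ← Finset.sum_attach n.divisors, Finset.mul_sum,
    Finset.mul_sum]
  refine Finset.sum_congr rfl fun ⟨A, hA⟩ _ => ?_
  obtain ⟨D, rfl⟩ := Nat.dvd_of_mem_divisors hA
  have hA0 : A ≠ 0 := fun h => hn (by rw [h, zero_mul])
  have hD0 : D ≠ 0 := fun h => hn (by rw [h, mul_zero])
  simp only [Nat.mul_div_cancel_left _ (Nat.pos_of_ne_zero hA0)]
  by_cases hAN : A.Coprime N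
  swap
  · simp [hAN]
  rw [if_pos hAN, if_pos hAN]
  rw [Nat.cast_mul] at hn0
  have hAk : (A : k) ≠ 0 := left_ne_zero_of_mul hn0
  have hDk : (D : k) ≠ 0 := right_ne_zero_of_mul hn0
  by_cases hAM : A ^ 2 ∣ M
  · obtain ⟨j, rfl⟩ := hAM
    have hj : A ^ 2 * j / A ^ 2 = j :=
      Nat.mul_div_cancel_left _ (pow_pos (Nat.pos_of_ne_zero hA0) 2)
    have hdvd : A * (A * D) ∣ A ^ 2 * j ↔ D ∣ j := by
      rw [← mul_assoc, ← sq, Nat.mul_dvd_mul_iff_left (pow_pos (Nat.pos_of_ne_zero hA0) 2)]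
    -- Since `n = A D`, `ζ^A` is a primitive `D`-th root of unity.
    have hsum := sum_primitiveRoot_pow (hζ.pow (Nat.pos_of_ne_zero hn) rfl) j
    simp only [← pow_mul] at hsum
    simp only [dvd_mul_right, if_true, hj, hdvd, ← pow_mul]
    have h1 : ∀ B, (D : k) ^ (-(κ : ℤ)) * (ζ ^ (A * B * j) * ((A ^ 2 : ℕ) : k) ^ m *
        tcoeff p m j f) = ((D : k) ^ (-(κ : ℤ)) * ((A ^ 2 : ℕ) : k) ^ m * tcoeff p m j f) *
        ζ ^ (A * B * j) := fun B => by ring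
    simp only [h1, ← Finset.mul_sum, hsum]
    split_ifs with h
    · rw [Nat.cast_mul, mul_zpow, zpow_sub_one₀ hAk, zpow_sub_one₀ hDk, zpow_neg, zpow_natCast,
        zpow_natCast]
      push_cast
      field_simp
      rw [pow_mul]
      ring
    · simp
  · have h1 : ¬ A * (A * D) ∣ M := fun h => hAM ((dvd_mul_right _ D).trans (by
      rwa [← mul_assoc, ← sq] at h))
    simp [hAM, h1]

theorem tcoeff_smul_toRoot [CharP k p] {n : ℕ} (hn : n ≠ 0) (c : k) (f : DSer Unit k) (m M : ℕ) :
    tcoeff p m M (c • toRoot p n hn f) =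
      if n ∣ M then c * (n : k) ^ m * tcoeff p m (M / n) f else 0 := by
  rw [tcoeff_smul, toRoot, tcoeff_scale]
  split_ifs
  · rw [one_pow]
    ring
  · rw [mul_zero]

/-- In the variable `q_n` both sides are supported on exponents divisible by `n`, so it suffices to
compare them at `M * n`. -/
theorem deltaHecke_eq_iff [CharP k p] (N κ : ℕ) {n : ℕ} (hn : n ≠ 0) (hnp : n.Coprime p)
    {ζ : k} (hζ : IsPrimitiveRoot ζ n) (f : DSer Unit k) (c : k) :
    (n : k) • deltaHecke p N κ n ζ f = c • toRoot p n hn f ↔ ∀ m M,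
      ∑ A ∈ (Nat.gcd n M).divisors with A.Coprime N, (A : k) ^ κ * (A : k) ^ (2 * m) *
        ((n / A : ℕ) : k) * tcoeff p m (M * n / A ^ 2) f = c * (n : k) ^ m * tcoeff p m M f := by
  have key : ∀ m M, tcoeff p m (M * n) ((n : k) • deltaHecke p N κ n ζ f) =
      ∑ A ∈ (Nat.gcd n M).divisors with A.Coprime N, (A : k) ^ κ * (A : k) ^ (2 * m) *
        ((n / A : ℕ) : k) * tcoeff p m (M * n / A ^ 2) f := by
    intro m M
    rw [tcoeff_smul_deltaHecke N κ hn hnp hζ, ← Finset.sum_filter, Finset.filter_filter]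
    refine Finset.sum_congr ?_ fun A _ => rfl
    ext A
    simp only [Finset.mem_filter, Nat.mem_divisors, Nat.dvd_gcd_iff,
      Nat.mul_dvd_mul_iff_right (Nat.pos_of_ne_zero hn)]
    have : n.gcd M ≠ 0 := Nat.gcd_ne_zero_left hn
    tauto
  constructor
  · intro h m M
    rw [← key, h, tcoeff_smul_toRoot, if_pos (dvd_mul_left _ _),
      Nat.mul_div_cancel _ (Nat.pos_of_ne_zero hn)]
  · intro h
    refine tcoeff_ext (p := p) fun m M => ?_
    by_cases hM : n ∣ M
    · obtain ⟨M, rfl⟩ := hM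
      rw [mul_comm n M, key, h, tcoeff_smul_toRoot, if_pos (dvd_mul_left _ _),
        Nat.mul_div_cancel _ (Nat.pos_of_ne_zero hn)]
    · rw [tcoeff_smul_deltaHecke N κ hn hnp hζ, tcoeff_smul_toRoot, if_neg hM]
      refine Finset.sum_eq_zero fun A _ => if_neg fun h => hM ((dvd_mul_left _ _).trans h)

end Away

/-! ## Classical eigenforms mod `p` -/

section Classical

variable {k : Type*} [Field k]

/-- The Hecke relations for the eigenvalues `lam n` of the operators `T_{κ+2}(n)`, `(n, p) = 1`,
together with `U ψ = lamp ψ`, for `ψ ∈ q k[[q]]`. -/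
structure IsHeckeSystem (p N κ : ℕ) (lam : ℕ → k) (lamp : k) (ψ : k⟦X⟧) : Prop where
  coeff_zero : PowerSeries.coeff 0 ψ = 0
  away : ∀ n M : ℕ, n ≠ 0 → n.Coprime p → ∑ A ∈ (Nat.gcd n M).divisors with A.Coprime N,
    (A : k) ^ (κ + 1) * PowerSeries.coeff (M * n / A ^ 2) ψ = lam n * PowerSeries.coeff M ψ
  uOp_eq : uOp p ψ = lamp • ψ

variable {p N κ : ℕ} {lam : ℕ → k} {lamp : k}

theorem exists_eq_mul_of_mem_divisors_gcd {n M A : ℕ} (hn : n ≠ 0) (hA : A ∈ (n.gcd M).divisors) :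
    ∃ B D, 0 < A ∧ n = A * B ∧ M = A * D ∧ ∀ c, c * M * n / A ^ 2 = c * (D * B) := by
  obtain ⟨h1, h2⟩ := Nat.dvd_gcd_iff.1 (Nat.dvd_of_mem_divisors hA)
  obtain ⟨B, rfl⟩ := h1
  obtain ⟨D, rfl⟩ := h2
  have hA0 : 0 < A := Nat.pos_of_ne_zero (left_ne_zero_of_mul hn)
  refine ⟨B, D, hA0, rfl, rfl, fun c => ?_⟩
  rw [show c * (A * D) * (A * B) = A ^ 2 * (c * (D * B)) by ring,
    Nat.mul_div_cancel_left _ (pow_pos hA0 2)]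

/-- In the relation at `M = 1` only `A = 1` contributes. -/
theorem IsHeckeSystem.coeff_coprime {ψ : k⟦X⟧} (h : IsHeckeSystem p N κ lam lamp ψ) {n : ℕ}
    (hn : n ≠ 0) (hnp : n.Coprime p) :
    PowerSeries.coeff n ψ = lam n * PowerSeries.coeff 1 ψ := by
  rw [← h.away n 1 hn hnp, Nat.gcd_one_right, Nat.divisors_one, Finset.filter_true_of_mem]
  · simp
  · simp

theorem IsHeckeSystem.coeff_pow_mul {ψ : k⟦X⟧} (h : IsHeckeSystem p N κ lam lamp ψ) (i n : ℕ) :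
    PowerSeries.coeff (p ^ i * n) ψ = lamp ^ i * PowerSeries.coeff n ψ := by
  induction i with
  | zero => simp
  | succ i ih =>
    have h1 := congrArg (PowerSeries.coeff (p ^ i * n)) h.uOp_eq
    rw [uOp, PowerSeries.coeff_mk, PowerSeries.coeff_smul, smul_eq_mul, ih] at h1
    rw [show p ^ (i + 1) * n = p ^ i * n * p by ring, h1]
    ring

theorem gcd_pow_mul {n : ℕ} (hnp : n.Coprime p) (i M : ℕ) : n.gcd (p ^ i * M) = n.gcd M :=
  Nat.Coprime.gcd_mul_left_cancel_right M (hnp.symm.pow_left i)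

/-- The Hecke relation for the coefficients of `q ^ M` in `f(q, 0)`, in terms of the multiples by
`m` of its coefficients of `q ^ (p ^ i * m)`. -/
theorem sum_hecke_zero {n : ℕ} (hn : n ≠ 0) (hnp : n.Coprime p) (t : ℕ → k) (i m : ℕ) :
    (∑ A ∈ (Nat.gcd n (p ^ i * m)).divisors with A.Coprime N, (A : k) ^ κ * (A : k) ^ (2 * 0) *
      ((n / A : ℕ) : k) * t (p ^ i * m * n / A ^ 2)) * m =
    ∑ A ∈ (Nat.gcd n m).divisors with A.Coprime N,
      (A : k) ^ (κ + 1) * (((m * n / A ^ 2 : ℕ) : k) * t (p ^ i * (m * n / A ^ 2))) := by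
  rw [gcd_pow_mul hnp, Finset.sum_mul]
  refine Finset.sum_congr rfl fun A hA => ?_
  obtain ⟨B, D, hA0, rfl, rfl, h⟩ :=
    exists_eq_mul_of_mem_divisors_gcd hn (Finset.mem_filter.1 hA).1
  have h1 := h 1
  rw [one_mul, one_mul] at h1
  -- With `n = A B` and `m = A D`, `A^κ B m = A^(κ+1) (B D)` and `B D = m n / A^2`: the factor `m`
  -- raises the weight by two.
  rw [h, h1, Nat.mul_div_cancel_left _ hA0]
  push_cast
  ring

variable [hp : Fact p.Prime]

theorem exists_eq_pow_mul_coprime {M : ℕ} (hM : M ≠ 0) : ∃ i m, M = p ^ i * m ∧ m.Coprime p := by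
  obtain ⟨i, m, h1, h2⟩ := Nat.exists_eq_pow_mul_and_not_dvd hM p hp.out.ne_one
  exact ⟨i, m, h2, ((Nat.Prime.coprime_iff_not_dvd hp.out).2 h1).symm⟩

theorem ne_zero_of_coprime {m : ℕ} (hm : m.Coprime p) : m ≠ 0 := by
  rintro rfl
  exact hp.out.ne_one (by simpa using hm)

theorem cast_ne_zero_of_coprime [CharP k p] {m : ℕ} (hm : m.Coprime p) : (m : k) ≠ 0 := by
  rw [Ne, CharP.cast_eq_zero_iff k p]
  exact (Nat.Prime.coprime_iff_not_dvd hp.out).1 hm.symm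

theorem cast_pow_pow_char [CharP k p] (m s : ℕ) : (m : k) ^ p ^ s = m := by
  induction s with
  | zero => simp
  | succ s ih =>
    rw [pow_succ, pow_mul, ih, ← frobenius_def, map_natCast]

/-- Two series in `q k[[q]]` with the same eigenvalues are proportional. -/
theorem IsHeckeSystem.coeff_one_mul {φ ψ : k⟦X⟧} (hφ : IsHeckeSystem p N κ lam lamp φ)
    (hψ : IsHeckeSystem p N κ lam lamp ψ) (M : ℕ) :
    PowerSeries.coeff 1 φ * PowerSeries.coeff M ψ =
      PowerSeries.coeff 1 ψ * PowerSeries.coeff M φ := by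
  by_cases hM : M = 0
  · rw [hM, hφ.coeff_zero, hψ.coeff_zero, mul_zero, mul_zero]
  · obtain ⟨i, m, rfl, hm⟩ := exists_eq_pow_mul_coprime (p := p) hM
    rw [hφ.coeff_pow_mul, hψ.coeff_pow_mul, hφ.coeff_coprime (ne_zero_of_coprime hm) hm,
      hψ.coeff_coprime (ne_zero_of_coprime hm) hm]
    ring

theorem IsHeckeSystem.coeff_one_ne_zero {φ : k⟦X⟧} (hφ : IsHeckeSystem p N κ lam lamp φ)
    (h0 : φ ≠ 0) : PowerSeries.coeff 1 φ ≠ 0 := by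
  intro h1
  refine h0 (PowerSeries.ext fun M => ?_)
  by_cases hM : M = 0
  · rw [hM, hφ.coeff_zero, map_zero]
  · obtain ⟨i, m, rfl, hm⟩ := exists_eq_pow_mul_coprime (p := p) hM
    rw [hφ.coeff_pow_mul, hφ.coeff_coprime (ne_zero_of_coprime hm) hm, h1, mul_zero, mul_zero,
      map_zero]

/-- The term `A = p` carries `p^(κ+1) = 0`. -/
theorem classicalHecke_prime [CharP k p] (N κ : ℕ) (φ : k⟦X⟧) :
    classicalHecke N (κ + 2) p φ = uOp p φ := by
  ext m
  rw [classicalHecke, uOp, PowerSeries.coeff_mk, PowerSeries.coeff_mk, Finset.sum_eq_single 1]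
  · simp
  · intro A hA hA1
    have h1 : A ∣ p := (Nat.dvd_of_mem_divisors (Finset.mem_filter.1 hA).1).trans
      (Nat.gcd_dvd_left p m)
    rw [((Nat.dvd_prime hp.out).1 h1).resolve_left hA1, CharP.cast_eq_zero, zero_pow (by omega),
      zero_mul]
  · intro h
    exact absurd (by simp [hp.out.ne_zero]) h

theorem isClassicalEigen_iff [CharP k p] {φ : k⟦X⟧} :
    IsClassicalEigen p N κ lam lamp φ ↔ φ ≠ 0 ∧ IsHeckeSystem p N κ lam lamp φ := by
  have key : ∀ n M, PowerSeries.coeff M (classicalHecke N (κ + 2) n φ) =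
      ∑ A ∈ (Nat.gcd n M).divisors with A.Coprime N,
        (A : k) ^ (κ + 1) * PowerSeries.coeff (M * n / A ^ 2) φ := fun n M => by
    rw [classicalHecke, PowerSeries.coeff_mk]
    rfl
  constructor
  · intro h
    refine ⟨h.ne_zero, ?_, fun n M hn hnp => ?_, ?_⟩
    · rw [PowerSeries.coeff_zero_eq_constantCoeff_apply, h.constantCoeff_eq]
    · rw [← key, h.away n (Nat.pos_of_ne_zero hn) hnp, PowerSeries.coeff_smul, smul_eq_mul]
    · rw [← classicalHecke_prime N κ, h.at_p]
  · rintro ⟨h0, h⟩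
    refine ⟨?_, h0, fun n hn hnp => PowerSeries.ext fun M => ?_, ?_⟩
    · rw [← PowerSeries.coeff_zero_eq_constantCoeff_apply, h.coeff_zero]
    · rw [key, h.away n M (by omega) hnp, PowerSeries.coeff_smul, smul_eq_mul]
    · rw [classicalHecke_prime, h.uOp_eq]

/-- The Hecke relation for the coefficients of `q ^ M * (q' / q ^ p) ^ (p ^ s)`. -/
theorem sum_hecke_pow [CharP k p] {n : ℕ} (hn : n ≠ 0) (hnp : n.Coprime p) (t : ℕ → k)
    (s i m : ℕ) :
    ∑ A ∈ (Nat.gcd n (p ^ i * m)).divisors with A.Coprime N, (A : k) ^ κ *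
      (A : k) ^ (2 * p ^ s) * ((n / A : ℕ) : k) * t (p ^ i * m * n / A ^ 2) =
    n * ∑ A ∈ (Nat.gcd n m).divisors with A.Coprime N,
      (A : k) ^ (κ + 1) * t (p ^ i * (m * n / A ^ 2)) := by
  rw [gcd_pow_mul hnp, Finset.mul_sum]
  refine Finset.sum_congr rfl fun A hA => ?_
  obtain ⟨B, D, hA0, rfl, rfl, h⟩ :=
    exists_eq_mul_of_mem_divisors_gcd hn (Finset.mem_filter.1 hA).1
  have h1 := h 1
  rw [one_mul, one_mul] at h1
  -- By Fermat `A^(2 p^s) = A^2`, and `A^κ A^2 (n / A) = n A^(κ+1)`.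
  rw [h, h1, Nat.mul_div_cancel_left _ hA0, mul_comm 2, pow_mul, cast_pow_pow_char]
  push_cast
  ring

end Classical

/-! ## The `δ`-series attached to a classical eigenform -/

section EigenForm

open MvPolynomial

variable {k : Type*} [Field k] {p : ℕ}

/-- The `δ`-series `ψ + ∑ V ^ (s + 1) (φ_s) (q' / q ^ p) ^ (p ^ s)`. -/
def sharpForm (p : ℕ) (T : Finset ℕ) (ψ : k⟦X⟧) (φ : ℕ → k⟦X⟧) : DSer Unit k :=
  C ψ + ∑ s ∈ T, sharpTerm p s (φ s)

/-- The `δ`-series `(∑ d_i F ^ i) φ^{(-1)} + ∑ P_s V ^ (s + 1) (φ) (q' / q ^ p) ^ (p ^ s)`. -/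
def eigenForm (p : ℕ) (φ d : k⟦X⟧) (P : Polynomial k) : DSer Unit k :=
  sharpForm p P.support (frobSum p d (antiTheta p φ)) fun s => P.coeff s • φ

theorem coeff_zero_antiTheta {φ : k⟦X⟧} : PowerSeries.coeff 0 (antiTheta p φ) = 0 := by
  simp [antiTheta]

theorem coeff_zero_uOp {φ : k⟦X⟧} (h0 : PowerSeries.coeff 0 φ = 0) :
    PowerSeries.coeff 0 (uOp p φ) = 0 := by
  rw [uOp, PowerSeries.coeff_mk, zero_mul, h0]

theorem coeff_zero_smul (c : k) {φ : k⟦X⟧} (h0 : PowerSeries.coeff 0 φ = 0) :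
    PowerSeries.coeff 0 (c • φ) = 0 := by
  rw [PowerSeries.coeff_smul, h0, smul_zero]

theorem tcoeff_C (n M : ℕ) (φ : k⟦X⟧) :
    tcoeff p n M (C φ : DSer Unit k) = if n = 0 then PowerSeries.coeff M φ else 0 := by
  have h := tcoeff_C_mul_X_pow (p := p) n M 0 φ
  rw [pow_zero, mul_one] at h
  rw [h]
  refine if_ctx_congr Iff.rfl ?_ fun _ => rfl
  rintro rfl
  simp

variable [hp : Fact p.Prime]

theorem tcoeff_sharpTerm {φ : k⟦X⟧} (h0 : PowerSeries.coeff 0 φ = 0) (s n M : ℕ) :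
    tcoeff p n M (sharpTerm p s φ) = if n = p ^ s then
      (if p ^ (s + 1) ∣ M then PowerSeries.coeff (M / p ^ (s + 1)) φ else 0) else 0 := by
  rw [sharpTerm, tcoeff_C_mul_X_pow, coeff_divQPow_vOp_iterate]
  refine if_ctx_congr Iff.rfl ?_ fun _ => rfl
  rintro rfl
  rw [← pow_succ']
  by_cases h : p ^ (s + 1) ≤ M
  · rw [if_pos h]
    obtain ⟨M, rfl⟩ := Nat.exists_eq_add_of_le' h
    rw [Nat.add_sub_cancel, Nat.add_div_right _ (pow_pos hp.out.pos _)]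
    simp only [Nat.dvd_add_self_right]
  -- Below `p^(s+1)` the right side can only involve the constant coefficient of `φ`, which is zero.
  · rw [if_neg h, Nat.div_eq_of_lt (by omega), h0, ite_self]

theorem pow_dvd_and_coprime_iff {m : ℕ} (hm : m.Coprime p) (i j : ℕ) :
    p ^ j ∣ p ^ i * m ∧ (p ^ i * m / p ^ j).Coprime p ↔ j = i := by
  constructor
  · rintro ⟨h1, h2⟩
    have hji : j ≤ i :=
      (Nat.pow_dvd_pow_iff_le_right hp.out.one_lt).1 ((hm.symm.pow_left j).dvd_of_dvd_mul_right h1)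
    obtain ⟨l, rfl⟩ := Nat.exists_eq_add_of_le hji
    rw [pow_add, mul_assoc, Nat.mul_div_cancel_left _ (pow_pos hp.out.pos _)] at h2
    by_contra hl
    have : p ∣ p ^ l * m := (dvd_pow_self p (by omega)).mul_right m
    exact (Nat.Prime.coprime_iff_not_dvd hp.out).1 h2.symm this
  · rintro rfl
    rw [Nat.mul_div_cancel_left _ (pow_pos hp.out.pos _)]
    exact ⟨dvd_mul_right _ _, hm⟩

theorem coeff_vOp_iterate_antiTheta_pow_mul (φ : k⟦X⟧) {m : ℕ} (hm : m.Coprime p) (i j : ℕ) :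
    PowerSeries.coeff (p ^ i * m) ((vOp p)^[j] (antiTheta p φ)) =
      if j = i then PowerSeries.coeff m φ / (m : k) else 0 := by
  rw [coeff_vOp_iterate_antiTheta]
  refine if_ctx_congr (pow_dvd_and_coprime_iff hm i j) ?_ fun _ => rfl
  rintro rfl
  rw [Nat.mul_div_cancel_left _ (pow_pos hp.out.pos _)]

/-- `φ^(-1)` lives on exponents prime to `p`, so the `V^j φ^(-1)` have disjoint supports and only `j
= i` reaches `p^i m`. -/
theorem coeff_frobSum_antiTheta (φ d : k⟦X⟧) {m : ℕ} (hm : m.Coprime p) (i : ℕ) :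
    PowerSeries.coeff (p ^ i * m) (frobSum p d (antiTheta p φ)) =
      PowerSeries.coeff i d * (PowerSeries.coeff m φ / (m : k)) := by
  have hi : i < p ^ i * m + 1 :=
    (Nat.lt_pow_self hp.out.one_lt).trans_le (Nat.le_mul_of_pos_right _
      (Nat.pos_of_ne_zero (ne_zero_of_coprime hm))) |>.trans (Nat.lt_succ_self _)
  rw [frobSum, PowerSeries.coeff_mk, Finset.sum_eq_single i]
  · rw [coeff_vOp_iterate_antiTheta_pow_mul φ hm, if_pos rfl]
  · intro j _ hj
    rw [coeff_vOp_iterate_antiTheta_pow_mul φ hm, if_neg hj, mul_zero]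
  · intro h
    exact absurd (Finset.mem_range.2 hi) h

theorem tcoeff_sharpForm_zero {T : Finset ℕ} {ψ : k⟦X⟧} {φ : ℕ → k⟦X⟧}
    (h0 : ∀ s, PowerSeries.coeff 0 (φ s) = 0) (M : ℕ) :
    tcoeff p 0 M (sharpForm p T ψ φ) = PowerSeries.coeff M ψ := by
  rw [sharpForm, tcoeff_add, tcoeff_C, if_pos rfl, tcoeff_sum, Finset.sum_eq_zero, add_zero]
  intro s _
  rw [tcoeff_sharpTerm (h0 s), if_neg (pow_ne_zero s hp.out.ne_zero).symm]

theorem tcoeff_sharpForm_pow {T : Finset ℕ} {ψ : k⟦X⟧} {φ : ℕ → k⟦X⟧}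
    (h0 : ∀ s, PowerSeries.coeff 0 (φ s) = 0) (s M : ℕ) :
    tcoeff p (p ^ s) M (sharpForm p T ψ φ) = if s ∈ T then
      (if p ^ (s + 1) ∣ M then PowerSeries.coeff (M / p ^ (s + 1)) (φ s) else 0) else 0 := by
  have h1 : ∀ j, tcoeff p (p ^ s) M (sharpTerm p j (φ j)) = if s = j then
      (if p ^ (s + 1) ∣ M then PowerSeries.coeff (M / p ^ (s + 1)) (φ s) else 0) else 0 := by
    intro j
    rw [tcoeff_sharpTerm (h0 j)]
    refine if_ctx_congr (Nat.pow_right_injective hp.out.two_le).eq_iff ?_ fun _ => rfl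
    rintro rfl
    rfl
  rw [sharpForm, tcoeff_add, tcoeff_C, if_neg (pow_ne_zero s hp.out.ne_zero), zero_add, tcoeff_sum]
  simp only [h1, Finset.sum_ite_eq]

theorem tcoeff_sharpForm_of_ne {T : Finset ℕ} {ψ : k⟦X⟧} {φ : ℕ → k⟦X⟧}
    (h0 : ∀ s, PowerSeries.coeff 0 (φ s) = 0) {n : ℕ} (hn : n ≠ 0) (hn' : ∀ s, n ≠ p ^ s) (M : ℕ) :
    tcoeff p n M (sharpForm p T ψ φ) = 0 := by
  rw [sharpForm, tcoeff_add, tcoeff_C, if_neg hn, zero_add, tcoeff_sum]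
  refine Finset.sum_eq_zero fun s _ => ?_
  rw [tcoeff_sharpTerm (h0 s), if_neg (hn' s)]

/-- A `δ`-series is `sharpForm p T ψ φ` if it has the right coefficients. -/
theorem eq_sharpForm {T : Finset ℕ} {ψ : k⟦X⟧} {φ : ℕ → k⟦X⟧}
    (h0 : ∀ s, PowerSeries.coeff 0 (φ s) = 0) {f : DSer Unit k}
    (hf1 : ∀ M, tcoeff p 0 M f = PowerSeries.coeff M ψ)
    (hf2 : ∀ s M, tcoeff p (p ^ s) M f = if s ∈ T then
      (if p ^ (s + 1) ∣ M then PowerSeries.coeff (M / p ^ (s + 1)) (φ s) else 0) else 0)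
    (hf3 : ∀ n M, n ≠ 0 → (∀ s, n ≠ p ^ s) → tcoeff p n M f = 0) : f = sharpForm p T ψ φ := by
  refine tcoeff_ext (p := p) fun n M => ?_
  by_cases hn : n = 0
  · rw [hn, hf1, tcoeff_sharpForm_zero h0]
  · by_cases hn' : ∃ s, n = p ^ s
    · obtain ⟨s, rfl⟩ := hn'
      rw [hf2, tcoeff_sharpForm_pow h0]
    · rw [not_exists] at hn'
      rw [hf3 n M hn hn', tcoeff_sharpForm_of_ne h0 hn hn']

theorem sharpForm_inj {T : Finset ℕ} {ψ ψ' : k⟦X⟧} {φ φ' : ℕ → k⟦X⟧}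
    (h0 : ∀ s, PowerSeries.coeff 0 (φ s) = 0) (h0' : ∀ s, PowerSeries.coeff 0 (φ' s) = 0) :
    sharpForm p T ψ φ = sharpForm p T ψ' φ' ↔ ψ = ψ' ∧ ∀ s ∈ T, φ s = φ' s := by
  constructor
  · intro h
    refine ⟨PowerSeries.ext fun M => ?_, fun s hs => PowerSeries.ext fun M => ?_⟩
    · rw [← tcoeff_sharpForm_zero (p := p) (T := T) h0, h, tcoeff_sharpForm_zero h0']
    · have h1 := congrArg (tcoeff p (p ^ s) (p ^ (s + 1) * M)) h
      rwa [tcoeff_sharpForm_pow h0, tcoeff_sharpForm_pow h0', if_pos hs, if_pos hs,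
        if_pos (dvd_mul_right _ _), if_pos (dvd_mul_right _ _),
        Nat.mul_div_cancel_left _ (pow_pos hp.out.pos _)] at h1
  · rintro ⟨rfl, h⟩
    rw [sharpForm, sharpForm, Finset.sum_congr rfl fun s hs => by rw [h s hs]]

theorem tcoeff_eigenForm_zero {φ : k⟦X⟧} (h0 : PowerSeries.coeff 0 φ = 0) (d : k⟦X⟧)
    (P : Polynomial k) (M : ℕ) :
    tcoeff p 0 M (eigenForm p φ d P) = PowerSeries.coeff M (frobSum p d (antiTheta p φ)) :=
  tcoeff_sharpForm_zero (fun _ => coeff_zero_smul _ h0) M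

theorem tcoeff_eigenForm_pow {φ : k⟦X⟧} (h0 : PowerSeries.coeff 0 φ = 0) (d : k⟦X⟧)
    (P : Polynomial k) (s M : ℕ) :
    tcoeff p (p ^ s) M (eigenForm p φ d P) =
      P.coeff s * if p ^ (s + 1) ∣ M then PowerSeries.coeff (M / p ^ (s + 1)) φ else 0 := by
  rw [eigenForm, tcoeff_sharpForm_pow fun _ => coeff_zero_smul _ h0]
  simp only [PowerSeries.coeff_smul, smul_eq_mul]
  split_ifs with h1 h2 h2
  · rfl
  · rw [mul_zero]
  · rw [Polynomial.notMem_support_iff.1 h1, zero_mul]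
  · rw [mul_zero]

theorem tcoeff_eigenForm_of_ne {φ : k⟦X⟧} (h0 : PowerSeries.coeff 0 φ = 0) (d : k⟦X⟧)
    (P : Polynomial k) {n : ℕ} (hn : n ≠ 0) (hn' : ∀ s, n ≠ p ^ s) (M : ℕ) :
    tcoeff p n M (eigenForm p φ d P) = 0 :=
  tcoeff_sharpForm_of_ne (fun _ => coeff_zero_smul _ h0) hn hn' M

/-- A `δ`-series is `eigenForm p φ d P` if it has the right coefficients. -/
theorem eq_eigenForm {φ : k⟦X⟧} (h0 : PowerSeries.coeff 0 φ = 0) {d : k⟦X⟧} {P : Polynomial k}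
    {f : DSer Unit k} (hf0 : tcoeff p 0 0 f = 0)
    (hf1 : ∀ i m : ℕ, m.Coprime p →
      tcoeff p 0 (p ^ i * m) f = PowerSeries.coeff i d * (PowerSeries.coeff m φ / (m : k)))
    (hf2 : ∀ s M, tcoeff p (p ^ s) M f =
      P.coeff s * if p ^ (s + 1) ∣ M then PowerSeries.coeff (M / p ^ (s + 1)) φ else 0)
    (hf3 : ∀ n M, n ≠ 0 → (∀ s, n ≠ p ^ s) → tcoeff p n M f = 0) : f = eigenForm p φ d P := by
  refine tcoeff_ext (p := p) fun n M => ?_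
  by_cases hn : n = 0
  · subst hn
    rw [tcoeff_eigenForm_zero h0]
    by_cases hM : M = 0
    · subst hM
      rw [hf0, coeff_zero_frobSum p d coeff_zero_antiTheta]
    · obtain ⟨i, m, rfl, hm⟩ := exists_eq_pow_mul_coprime (p := p) hM
      rw [hf1 i m hm, coeff_frobSum_antiTheta φ d hm]
  · by_cases hn' : ∃ s, n = p ^ s
    · obtain ⟨s, rfl⟩ := hn'
      rw [hf2, tcoeff_eigenForm_pow h0]
    · rw [not_exists] at hn'
      rw [hf3 n M hn hn', tcoeff_eigenForm_of_ne h0 d P hn hn']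

end EigenForm

/-! ## The Hecke operator at `p` on sums of `sharpTerm`s -/

section AtPrime

open MvPolynomial

variable {k : Type*} [Field k] {p N κ : ℕ} {lam : ℕ → k} {lamp : k}

theorem coeff_atZero (M : ℕ) (f : DSer Unit k) :
    PowerSeries.coeff M (atZero f) = tcoeff p 0 M f := by
  rw [tcoeff_zero_left, dcoeff, Finsupp.single_zero]
  rfl

theorem constTerm_eq (f : DSer Unit k) : constTerm f = PowerSeries.coeff 0 (atZero f) := by
  rw [PowerSeries.coeff_zero_eq_constantCoeff_apply]
  rfl

theorem smul_ofSeries (c : k) (ψ : k⟦X⟧) : c • (C ψ : DSer Unit k) = C (c • ψ) := by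
  refine dcoeff_ext fun m n => ?_
  rw [dcoeff_smul, dcoeff_C, dcoeff_C, PowerSeries.coeff_smul, smul_eq_mul, mul_ite, mul_zero]

variable [hp : Fact p.Prime]

/-- `V` multiplies `q'/q^p` by `p = 0`. -/
theorem tcoeff_deltaV [CharP k p] (n M : ℕ) (f : DSer Unit k) :
    tcoeff p n M (deltaV p f) = if p ∣ M ∧ n = 0 then tcoeff p 0 (M / p) f else 0 := by
  rw [deltaV, tcoeff_scale]
  by_cases hM : p ∣ M
  · rw [if_pos hM, one_pow, one_mul, CharP.cast_eq_zero]
    by_cases hn : n = 0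
    · rw [hn, pow_zero, one_mul, if_pos ⟨hM, rfl⟩]
    · rw [zero_pow hn, zero_mul, if_neg fun h => hn h.2]
  · rw [if_neg hM, if_neg fun h => hM h.1]

theorem deltaV_sharpForm [CharP k p] {T : Finset ℕ} {ψ : k⟦X⟧} {φ : ℕ → k⟦X⟧}
    (h0 : ∀ s, PowerSeries.coeff 0 (φ s) = 0) :
    deltaV p (sharpForm p T ψ φ) = C (vOp p ψ) := by
  refine tcoeff_ext (p := p) fun n M => ?_
  rw [tcoeff_deltaV, tcoeff_C, tcoeff_sharpForm_zero h0, coeff_vOp]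
  by_cases hM : p ∣ M <;> by_cases hn : n = 0 <;> simp [hM, hn]

theorem sharpTerm_smul {φ : k⟦X⟧} (h0 : PowerSeries.coeff 0 φ = 0) (s : ℕ) (c : k) :
    sharpTerm p s (c • φ) = c • sharpTerm p s φ := by
  refine tcoeff_ext (p := p) fun n M => ?_
  rw [tcoeff_smul, tcoeff_sharpTerm h0, tcoeff_sharpTerm (coeff_zero_smul c h0)]
  split_ifs
  · rfl
  · rw [mul_zero]
  · rw [mul_zero]

/-- "`pU`" and `V` preserve the shape `sharpForm`, so the equation at `p` is compared component by
component, using uniqueness of "`pU`". -/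
theorem isHeckeAtP_sharpForm_iff [CharP k p] [PerfectRing k p] {T : Finset ℕ} {ψ : k⟦X⟧}
    {φ : ℕ → k⟦X⟧} (h0 : ∀ s, PowerSeries.coeff 0 (φ s) = 0) :
    IsHeckeAtP p κ (sharpForm p T ψ φ) (lamp • sharpForm p T ψ φ) ↔
      (p : k) ^ κ • vOp p ψ - ∑ s ∈ T, (vOp p)^[s] (antiTheta p (φ s)) = lamp • ψ ∧
      ∀ s ∈ T, uOp p (φ s) = lamp • φ s := by
  have hPU : IsPU p (sharpForm p T ψ φ)
      (0 + ∑ s ∈ T, (sharpTerm p s (uOp p (φ s)) - C ((vOp p)^[s] (antiTheta p (φ s))))) :=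
    (isPU_C ψ).add (IsPU.sum T fun s _ => isPU_sharpTerm s (φ s))
  have h1 : IsHeckeAtP p κ (sharpForm p T ψ φ) (lamp • sharpForm p T ψ φ) ↔
      (0 + ∑ s ∈ T, (sharpTerm p s (uOp p (φ s)) - C ((vOp p)^[s] (antiTheta p (φ s))))) +
        (p : k) ^ κ • deltaV p (sharpForm p T ψ φ) = lamp • sharpForm p T ψ φ := by
    constructor
    · rintro ⟨G, hG, h⟩
      rw [hPU.unique ⟨G, hG, rfl⟩, h]
    · intro h
      obtain ⟨G, hG, hG'⟩ := hPU
      exact ⟨G, hG, by rw [hG', h]⟩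
  have h2 : (0 + ∑ s ∈ T, (sharpTerm p s (uOp p (φ s)) - C ((vOp p)^[s] (antiTheta p (φ s))))) +
        (p : k) ^ κ • deltaV p (sharpForm p T ψ φ) = sharpForm p T
        ((p : k) ^ κ • vOp p ψ - ∑ s ∈ T, (vOp p)^[s] (antiTheta p (φ s)))
        fun s => uOp p (φ s) := by
    rw [deltaV_sharpForm h0, sharpForm, Finset.sum_sub_distrib, C_sub, map_sum, smul_ofSeries]
    ring
  have h3 : lamp • sharpForm p T ψ φ = sharpForm p T (lamp • ψ) fun s => lamp • φ s := by
    rw [sharpForm, sharpForm, smul_add, Finset.smul_sum, smul_ofSeries]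
    congr 1
    exact Finset.sum_congr rfl fun s _ => (sharpTerm_smul (h0 s) s lamp).symm
  rw [h1, h2, h3, sharpForm_inj (fun s => coeff_zero_uOp (h0 s))
    fun s => coeff_zero_smul lamp (h0 s)]

/-- The coefficients of `f` at the powers of `q' / q ^ p` of exponent `p ^ s`. -/
def partSeries (p s : ℕ) (f : DSer Unit k) : k⟦X⟧ :=
  PowerSeries.mk fun m => tcoeff p (p ^ s) (p ^ (s + 1) * m) f

theorem coeff_zero_partSeries (s : ℕ) (f : DSer Unit k) :
    PowerSeries.coeff 0 (partSeries p s f) = 0 := by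
  rw [partSeries, PowerSeries.coeff_mk, tcoeff, if_neg]
  rw [mul_zero, ← pow_succ']
  exact not_le.2 (pow_pos hp.out.pos _)

/-- The range of indices of the nonzero `partSeries`. -/
def partRange (f : DSer Unit k) : Finset ℕ := Finset.range (f.totalDegree + 1)

theorem tcoeff_eq_zero_of_notMem {f : DSer Unit k} {s : ℕ} (hs : s ∉ partRange f) (M : ℕ) :
    tcoeff p (p ^ s) M f = 0 := by
  rw [tcoeff, dcoeff, coeff_eq_zero_of_totalDegree_lt, map_zero, ite_self]
  have h1 : s < p ^ s := Nat.lt_pow_self hp.out.one_lt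
  have h2 : f.totalDegree < s := by simpa [partRange] using hs
  have h3 : (Finsupp.single () (p ^ s)).support = {()} :=
    Finsupp.support_single _ (pow_ne_zero s hp.out.ne_zero)
  rw [h3, Finset.sum_singleton, Finsupp.single_eq_same]
  omega

theorem partSeries_eq_zero {f : DSer Unit k} {s : ℕ} (hs : s ∉ partRange f) :
    partSeries p s f = 0 := by
  ext M
  rw [partSeries, PowerSeries.coeff_mk, tcoeff_eq_zero_of_notMem hs, map_zero]

theorem IsTaylorSymmetric.eq_sharpForm [CharP k p] (hp2 : p ≠ 2) {f : DSer Unit k}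
    (hf : IsTaylorSymmetric p f) :
    f = sharpForm p (partRange f) (atZero f) fun s => partSeries p s f := by
  have key : ∀ n M, n ≠ 0 → tcoeff p n M f ≠ 0 → ∃ s, n = p ^ s ∧ p ^ (s + 1) ∣ M := by
    intro n M hn h
    rw [tcoeff] at h
    have h1 : p * n ≤ M := by
      by_contra h1
      exact h (if_neg h1)
    rw [if_pos h1] at h
    obtain ⟨s, rfl, h2⟩ := dcoeff_ne_zero_of_isTaylorSymmetric hp2 hf hn h
    refine ⟨s, rfl, ?_⟩
    rw [← pow_succ'] at h1 h2
    rwa [Nat.dvd_sub_iff_left h1 dvd_rfl] at h2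
  refine DeltaHecke.eq_sharpForm (fun s => coeff_zero_partSeries s f)
    (fun M => (coeff_atZero M f).symm) ?_ ?_
  · intro s M
    split_ifs with h1 h2
    · obtain ⟨M, rfl⟩ := h2
      rw [Nat.mul_div_cancel_left _ (pow_pos hp.out.pos _), partSeries, PowerSeries.coeff_mk]
    · by_contra h3
      obtain ⟨s', h4, h5⟩ := key _ M (pow_ne_zero s hp.out.ne_zero) h3
      rw [Nat.pow_right_injective hp.out.two_le h4] at h2
      exact h2 h5
    · exact tcoeff_eq_zero_of_notMem h1 M
  · intro n M hn hn'
    by_contra h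
    obtain ⟨s, hs, _⟩ := key n M hn h
    exact hn' s hs

/-- The series `∑ m a_{p ^ i m} q ^ m`, `(m, p) = 1`, attached to `∑ a_m q ^ m`. -/
def thetaPart (p i : ℕ) (ψ : k⟦X⟧) : k⟦X⟧ :=
  PowerSeries.mk fun m => if m.Coprime p then (m : k) * PowerSeries.coeff (p ^ i * m) ψ else 0

/-- The factor `m` turns the relations for `f(q, 0)` into those of weight `κ + 2`, and `U` kills
series supported on exponents prime to `p`. This supplies the classical eigenvector when `lamp = 0`
and `f` does not involve `q'`. -/
theorem isHeckeSystem_thetaPart {ψ : k⟦X⟧} (h : ∀ n M : ℕ, n ≠ 0 → n.Coprime p →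
      ∑ A ∈ (Nat.gcd n M).divisors with A.Coprime N, (A : k) ^ κ * (A : k) ^ (2 * 0) *
        ((n / A : ℕ) : k) * PowerSeries.coeff (M * n / A ^ 2) ψ =
      lam n * PowerSeries.coeff M ψ) (i : ℕ) :
    IsHeckeSystem p N κ lam 0 (thetaPart p i ψ) where
  coeff_zero := by simp [thetaPart]
  uOp_eq := by
    ext m
    have : ¬ (m * p).Coprime p := fun h =>
      (Nat.Prime.coprime_iff_not_dvd hp.out).1 h.symm (dvd_mul_left p m)
    simp [uOp, thetaPart, this]
  away n M hn hnp := by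
    simp only [thetaPart, PowerSeries.coeff_mk]
    have h1 : ∀ A ∈ (n.gcd M).divisors, ((M * n / A ^ 2).Coprime p ↔ M.Coprime p) := by
      intro A hA
      obtain ⟨B, D, hA0, rfl, rfl, h⟩ := exists_eq_mul_of_mem_divisors_gcd hn hA
      have h1 := h 1
      rw [one_mul, one_mul] at h1
      rw [h1, Nat.coprime_mul_iff_left, Nat.coprime_mul_iff_left]
      rw [Nat.coprime_mul_iff_left] at hnp
      tauto
    by_cases hM : M.Coprime p
    · rw [if_pos hM, mul_left_comm, ← h n (p ^ i * M) hn hnp, mul_comm (M : k),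
        sum_hecke_zero hn hnp fun m => PowerSeries.coeff m ψ]
      refine Finset.sum_congr rfl fun A hA => ?_
      rw [if_pos ((h1 A (Finset.mem_filter.1 hA).1).2 hM)]
    · rw [if_neg hM, mul_zero]
      refine Finset.sum_eq_zero fun A hA => ?_
      rw [if_neg fun h => hM ((h1 A (Finset.mem_filter.1 hA).1).1 h), mul_zero]

end AtPrime

/-! ## The space of eigenvectors -/

section EigenSpace

open MvPolynomial

variable {k : Type*} [Field k] {p N κ : ℕ} {lam ζ : ℕ → k} {lamp : k}

/-- The relation between the two parameters of the `eigenForm`s in the `eigenSpace`. -/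
def IsEigenPair (p κ : ℕ) (lamp : k) (d : k⟦X⟧) (P : Polynomial k) : Prop :=
  (P : k⟦X⟧) = (PowerSeries.C ((p : k) ^ κ) * PowerSeries.X - PowerSeries.C lamp) * d

theorem isEigenPair_iff {d : k⟦X⟧} {P : Polynomial k} : IsEigenPair p κ lamp d P ↔
    P.coeff 0 = -(lamp * PowerSeries.coeff 0 d) ∧ ∀ i, P.coeff (i + 1) =
      (p : k) ^ κ * PowerSeries.coeff i d - lamp * PowerSeries.coeff (i + 1) d := by
  have h0 : PowerSeries.coeff 0 ((PowerSeries.C ((p : k) ^ κ) * PowerSeries.X -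
      PowerSeries.C lamp) * d) = -(lamp * PowerSeries.coeff 0 d) := by
    rw [sub_mul, mul_assoc, map_sub, PowerSeries.coeff_C_mul, PowerSeries.coeff_C_mul,
      PowerSeries.coeff_zero_X_mul, mul_zero, zero_sub]
  have h1 : ∀ i, PowerSeries.coeff (i + 1) ((PowerSeries.C ((p : k) ^ κ) * PowerSeries.X -
      PowerSeries.C lamp) * d) =
      (p : k) ^ κ * PowerSeries.coeff i d - lamp * PowerSeries.coeff (i + 1) d := fun i => by
    rw [sub_mul, mul_assoc, map_sub, PowerSeries.coeff_C_mul, PowerSeries.coeff_C_mul,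
      PowerSeries.coeff_succ_X_mul]
  constructor
  · intro h
    refine ⟨?_, fun i => ?_⟩
    · rw [← h0, ← h, Polynomial.coeff_coe]
    · rw [← h1, ← h, Polynomial.coeff_coe]
  · rintro ⟨h2, h3⟩
    refine PowerSeries.ext fun i => ?_
    rw [Polynomial.coeff_coe]
    cases i with
    | zero => rw [h2, h0]
    | succ i => rw [h3, h1]

variable [hp : Fact p.Prime]

theorem IsDeltaEigen.sum_tcoeff [CharP k p]
    (hζ : ∀ n : ℕ, 1 ≤ n → n.Coprime p → IsPrimitiveRoot (ζ n) n) {f : DSer Unit k}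
    (hf : IsDeltaEigen p N κ ζ lam lamp f) {n : ℕ} (hn : n ≠ 0) (hnp : n.Coprime p) (m M : ℕ) :
    ∑ A ∈ (Nat.gcd n M).divisors with A.Coprime N, (A : k) ^ κ * (A : k) ^ (2 * m) *
      ((n / A : ℕ) : k) * tcoeff p m (M * n / A ^ 2) f = lam n * (n : k) ^ m * tcoeff p m M f :=
  (deltaHecke_eq_iff N κ hn hnp (hζ n (Nat.pos_of_ne_zero hn) hnp) f (lam n)).1
    (hf.away n hn hnp) m M

theorem IsDeltaEigen.isHeckeSystem_partSeries [CharP k p] [PerfectRing k p] (hp2 : p ≠ 2)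
    (hζ : ∀ n : ℕ, 1 ≤ n → n.Coprime p → IsPrimitiveRoot (ζ n) n) {f : DSer Unit k}
    (hf : IsDeltaEigen p N κ ζ lam lamp f) (s : ℕ) :
    IsHeckeSystem p N κ lam lamp (partSeries p s f) where
  coeff_zero := coeff_zero_partSeries s f
  uOp_eq := by
    by_cases hs : s ∈ partRange f
    · have h := hf.at_p
      rw [hf.symmetric.eq_sharpForm hp2,
        isHeckeAtP_sharpForm_iff fun s => coeff_zero_partSeries s f] at h
      exact h.2 s hs
    · rw [partSeries_eq_zero hs, smul_zero]
      ext
      simp [uOp]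
  away n M hn hnp := by
    have h := hf.sum_tcoeff hζ hn hnp (p ^ s) (p ^ (s + 1) * M)
    rw [sum_hecke_pow hn hnp fun m => tcoeff p (p ^ s) m f, cast_pow_pow_char, mul_comm (lam n),
      mul_assoc] at h
    simp only [partSeries, PowerSeries.coeff_mk]
    exact mul_left_cancel₀ (cast_ne_zero_of_coprime hnp) h

theorem IsDeltaEigen.at_p_atZero [CharP k p] [PerfectRing k p] (hp2 : p ≠ 2) {f : DSer Unit k}
    (hf : IsDeltaEigen p N κ ζ lam lamp f) :
    (p : k) ^ κ • vOp p (atZero f) -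
      ∑ s ∈ partRange f, (vOp p)^[s] (antiTheta p (partSeries p s f)) = lamp • atZero f := by
  have h := hf.at_p
  rw [hf.symmetric.eq_sharpForm hp2,
    isHeckeAtP_sharpForm_iff fun s => coeff_zero_partSeries s f] at h
  exact h.1

/-- A nonzero `δ`-eigenvector gives rise to a classical one. -/
theorem IsDeltaEigen.exists_isHeckeSystem [CharP k p] [PerfectRing k p] (hp2 : p ≠ 2)
    (hζ : ∀ n : ℕ, 1 ≤ n → n.Coprime p → IsPrimitiveRoot (ζ n) n) {f : DSer Unit k}
    (hf : IsDeltaEigen p N κ ζ lam lamp f) (hf0 : constTerm f = 0) (hne : f ≠ 0) :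
    ∃ φ : k⟦X⟧, φ ≠ 0 ∧ IsHeckeSystem p N κ lam lamp φ := by
  by_contra hcon
  push Not at hcon
  have h1 : ∀ s, partSeries p s f = 0 := fun s => by
    by_contra h
    exact hcon _ h (hf.isHeckeSystem_partSeries hp2 hζ s)
  have h2 : (p : k) ^ κ • vOp p (atZero f) = lamp • atZero f := by
    have h := hf.at_p_atZero hp2
    rw [Finset.sum_eq_zero, sub_zero] at h
    · exact h
    · intro s _
      rw [h1]
      ext m
      simp [coeff_vOp_iterate_antiTheta]
  have h3 : ∀ i m, m.Coprime p → PowerSeries.coeff (p ^ i * m) (atZero f) = 0 := by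
    intro i m hm
    -- If `lamp = 0`, a nonzero `thetaPart` would be a classical eigenvector. Otherwise `p^κ V ψ =
    -- lamp ψ` determines the coefficient at `p^(i+1) m` from the one at `p^i m`, starting from
    -- zero.
    by_cases hl : lamp = 0
    · subst hl
      have h4 : thetaPart p i (atZero f) = 0 := by
        by_contra h
        refine hcon _ h (isHeckeSystem_thetaPart (fun n M hn hnp => ?_) i)
        have h5 := hf.sum_tcoeff hζ hn hnp 0 M
        simp only [← coeff_atZero, pow_zero, mul_one] at h5
        simpa using h5
      have h5 := congrArg (PowerSeries.coeff m) h4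
      rw [thetaPart, PowerSeries.coeff_mk, if_pos hm, map_zero] at h5
      exact (mul_eq_zero.1 h5).resolve_left (cast_ne_zero_of_coprime hm)
    · have h4 : ∀ M, (p : k) ^ κ * (if p ∣ M then PowerSeries.coeff (M / p) (atZero f) else 0) =
          lamp * PowerSeries.coeff M (atZero f) := fun M => by
        have h := congrArg (PowerSeries.coeff M) h2
        rwa [PowerSeries.coeff_smul, PowerSeries.coeff_smul, coeff_vOp] at h
      induction i with
      | zero =>
        have h := h4 (p ^ 0 * m)
        rw [if_neg, mul_zero] at h
        · exact (mul_eq_zero.1 h.symm).resolve_left hl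
        · rw [pow_zero, one_mul]
          exact (Nat.Prime.coprime_iff_not_dvd hp.out).1 hm.symm
      | succ i ih =>
        have h := h4 (p ^ (i + 1) * m)
        rw [pow_succ', mul_assoc, if_pos (dvd_mul_right _ _), Nat.mul_div_cancel_left _ hp.out.pos,
          ih, mul_zero, ← mul_assoc, ← pow_succ'] at h
        exact (mul_eq_zero.1 h.symm).resolve_left hl
  refine hne ?_
  rw [hf.symmetric.eq_sharpForm hp2]
  have h4 : atZero f = 0 := by
    ext M
    by_cases hM : M = 0
    · rw [hM, ← constTerm_eq, hf0, map_zero]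
    · obtain ⟨i, m, rfl, hm⟩ := exists_eq_pow_mul_coprime (p := p) hM
      rw [h3 i m hm, map_zero]
  rw [sharpForm, h4, map_zero, zero_add]
  refine Finset.sum_eq_zero fun s _ => ?_
  rw [h1]
  simpa using sharpTerm_smul (p := p) (map_zero (PowerSeries.coeff (R := k) 0)) s (0 : k)

/-- By multiplicity one every component of `f` is determined by its coefficients at `p`-powers. The
coefficient at `q^(p^i)` of the equation at `p` gives the relation between `d` and `P`. -/
theorem exists_eq_eigenForm [CharP k p] [PerfectRing k p] (hp2 : p ≠ 2)
    (hζ : ∀ n : ℕ, 1 ≤ n → n.Coprime p → IsPrimitiveRoot (ζ n) n) {φ : k⟦X⟧} (hφ0 : φ ≠ 0)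
    (hφ : IsHeckeSystem p N κ lam lamp φ) {f : DSer Unit k}
    (hf : f ∈ eigenSpace p N κ ζ lam lamp) :
    ∃ d P, IsEigenPair p κ lamp d P ∧ f = eigenForm p φ d P := by
  obtain ⟨hf0, rfl | hf⟩ := hf
  · refine ⟨0, 0, by simp [IsEigenPair], ?_⟩
    have h : frobSum p 0 (antiTheta p φ) = 0 := by
      ext
      simp [frobSum]
    simp [eigenForm, sharpForm, h]
  have h1 := hφ.coeff_one_ne_zero hφ0
  -- Forced: by `coeff_frobSum_antiTheta` the coefficient at `q^(p^i)` of the candidate is `d_i`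
  -- times the first coefficient of `φ`.
  let d : k⟦X⟧ := PowerSeries.mk fun i =>
    PowerSeries.coeff (p ^ i) (atZero f) * (PowerSeries.coeff 1 φ)⁻¹
  let c : ℕ → k := fun s => PowerSeries.coeff 1 (partSeries p s f)
  let P : Polynomial k := ∑ s ∈ partRange f, Polynomial.monomial s
    (c s * (PowerSeries.coeff 1 φ)⁻¹)
  have hc : ∀ s, s ∉ partRange f → c s = 0 := fun s hs => by
    simp only [c]
    rw [partSeries_eq_zero hs, map_zero]
  have hd : ∀ i, PowerSeries.coeff i d =
    PowerSeries.coeff (p ^ i) (atZero f) * (PowerSeries.coeff 1 φ)⁻¹ := fun i =>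
      PowerSeries.coeff_mk _ _
  have hP : ∀ s, P.coeff s = c s * (PowerSeries.coeff 1 φ)⁻¹ := fun s => by
    simp only [P, Polynomial.finsetSum_coeff, Polynomial.coeff_monomial, Finset.sum_ite_eq']
    split_ifs with hs
    · rfl
    · rw [hc s hs, zero_mul]
  refine ⟨d, P, ?_, eq_eigenForm hφ.coeff_zero ?_ ?_ ?_ ?_⟩
  · have h2 : ∀ i, c i = (p : k) ^ κ * PowerSeries.coeff (p ^ i) (vOp p (atZero f)) -
        lamp * PowerSeries.coeff (p ^ i) (atZero f) := by
      intro i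
      have h3 := congrArg (PowerSeries.coeff (p ^ i)) (hf.at_p_atZero hp2)
      have h4 : ∀ s, PowerSeries.coeff (p ^ i) ((vOp p)^[s] (antiTheta p (partSeries p s f))) =
          if s = i then c i else 0 := by
        intro s
        have h5 := coeff_vOp_iterate_antiTheta_pow_mul (partSeries p s f) (Nat.coprime_one_left p)
          i s
        rw [mul_one, Nat.cast_one, div_one] at h5
        rw [h5]
        refine if_ctx_congr Iff.rfl ?_ fun _ => rfl
        rintro rfl
        rfl
      rw [map_sub, map_sum, PowerSeries.coeff_smul, PowerSeries.coeff_smul, smul_eq_mul,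
        smul_eq_mul, Finset.sum_congr rfl fun s _ => h4 s, Finset.sum_ite_eq'] at h3
      rw [← h3]
      split_ifs with hi
      · ring
      · rw [hc i hi]
        ring
    rw [isEigenPair_iff]
    refine ⟨?_, fun i => ?_⟩
    · rw [hP, h2, hd, coeff_vOp, if_neg]
      · ring
      · rw [pow_zero, Nat.dvd_one]
        exact hp.out.ne_one
    · rw [hP, h2, hd, hd, coeff_vOp, if_pos (dvd_pow_self p (Nat.succ_ne_zero i)), pow_succ,
        Nat.mul_div_cancel _ hp.out.pos]
      ring
  · rw [← coeff_atZero, ← constTerm_eq, hf0]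
  · intro i m hm
    have hm0 := ne_zero_of_coprime hm
    -- The relation for `T(m)` at the exponent `p^i` has only the term `A = 1`, so it expresses the
    -- coefficient at `p^i m` through the one at `p^i`.
    have h2 := hf.sum_tcoeff hζ hm0 hm 0 (p ^ i * 1)
    have h3 := sum_hecke_zero (N := N) (κ := κ) hm0 hm (fun m => tcoeff p 0 m f) i 1
    rw [h2, Nat.gcd_one_right, Nat.divisors_one, Finset.filter_true_of_mem (by simp)] at h3
    simp only [Finset.sum_singleton, one_mul, one_pow, Nat.cast_one, mul_one, Nat.div_one,
      pow_zero] at h3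
    rw [hd, hφ.coeff_coprime hm0 hm, coeff_atZero (p := p)]
    have := cast_ne_zero_of_coprime (k := k) hm
    field_simp
    linear_combination -h3
  · intro s M
    rw [hf.symmetric.eq_sharpForm hp2, tcoeff_sharpForm_pow fun s => coeff_zero_partSeries s f, hP]
    split_ifs with h2 h3 h3
    · have h4 := hφ.coeff_one_mul (hf.isHeckeSystem_partSeries hp2 hζ s) (M / p ^ (s + 1))
      simp only [c]
      field_simp
      linear_combination h4
    · rw [mul_zero]
    · rw [hc s h2, zero_mul, zero_mul]
    · rw [mul_zero]
  · intro n M hn hn'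
    rw [hf.symmetric.eq_sharpForm hp2,
      tcoeff_sharpForm_of_ne (fun s => coeff_zero_partSeries s f) hn hn']

/-- At the exponent `p^i m`, the series part of the equation at `p` is the `i`-th coefficient of the
eigenpair relation times `a_m / m`. The relations away from `p` reduce to those of `φ`. -/
theorem eigenForm_mem_eigenSpace [CharP k p] [PerfectRing k p]
    (hζ : ∀ n : ℕ, 1 ≤ n → n.Coprime p → IsPrimitiveRoot (ζ n) n) {φ : k⟦X⟧}
    (hφ : IsHeckeSystem p N κ lam lamp φ) {d : k⟦X⟧} {P : Polynomial k}
    (h : IsEigenPair p κ lamp d P) : eigenForm p φ d P ∈ eigenSpace p N κ ζ lam lamp := by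
  have h0 := hφ.coeff_zero
  have hz : tcoeff p 0 0 (eigenForm p φ d P) = 0 := by
    rw [tcoeff_eigenForm_zero h0, coeff_zero_frobSum p d coeff_zero_antiTheta]
  have hat : IsHeckeAtP p κ (eigenForm p φ d P) (lamp • eigenForm p φ d P) := by
    rw [eigenForm, isHeckeAtP_sharpForm_iff fun s => coeff_zero_smul _ h0]
    refine ⟨?_, fun s _ => ?_⟩
    · rw [isEigenPair_iff] at h
      ext M
      rw [map_sub, map_sum, PowerSeries.coeff_smul, PowerSeries.coeff_smul, smul_eq_mul,
        smul_eq_mul]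
      by_cases hM : M = 0
      · rw [hM, coeff_vOp, if_pos (dvd_zero p), Nat.zero_div,
          coeff_zero_frobSum p d coeff_zero_antiTheta, Finset.sum_eq_zero]
        · ring
        · intro s _
          rw [coeff_vOp_iterate, Nat.zero_div, coeff_zero_antiTheta, ite_self]
      · obtain ⟨i, m, rfl, hm⟩ := exists_eq_pow_mul_coprime (p := p) hM
        have h2 : ∑ s ∈ P.support, PowerSeries.coeff (p ^ i * m)
            ((vOp p)^[s] (antiTheta p (P.coeff s • φ))) =
            P.coeff i * (PowerSeries.coeff m φ / (m : k)) := by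
          simp only [coeff_vOp_iterate_antiTheta_pow_mul _ hm, PowerSeries.coeff_smul,
            Finset.sum_ite_eq', smul_eq_mul, mul_div_assoc]
          split_ifs with h3
          · rfl
          · rw [Polynomial.notMem_support_iff.1 h3, zero_mul]
        rw [h2, coeff_vOp, coeff_frobSum_antiTheta φ d hm]
        cases i with
        | zero =>
          rw [pow_zero, one_mul, if_neg ((Nat.Prime.coprime_iff_not_dvd hp.out).1 hm.symm), h.1]
          ring
        | succ i =>
          rw [pow_succ', mul_assoc, if_pos (dvd_mul_right _ _),
            Nat.mul_div_cancel_left _ hp.out.pos, coeff_frobSum_antiTheta φ d hm, h.2]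
          ring
    · ext m
      have h2 := congrArg (PowerSeries.coeff m) hφ.uOp_eq
      rw [uOp, PowerSeries.coeff_mk, PowerSeries.coeff_smul, smul_eq_mul] at h2
      rw [uOp, PowerSeries.coeff_mk, PowerSeries.coeff_smul, PowerSeries.coeff_smul,
        PowerSeries.coeff_smul, h2]
      simp only [smul_eq_mul]
      ring
  refine ⟨?_, Or.inr ⟨?_, fun n hn hnp => ?_, hat⟩⟩
  · rw [constTerm_eq, coeff_atZero (p := p), hz]
  · obtain ⟨G, hG, _⟩ := hat
    exact ⟨G, hG⟩
  rw [deltaHecke_eq_iff N κ hn hnp (hζ n (Nat.pos_of_ne_zero hn) hnp)]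
  intro l M
  by_cases hl : l = 0
  · subst hl
    by_cases hM : M = 0
    · subst hM
      rw [hz, mul_zero (lam n * _)]
      refine Finset.sum_eq_zero fun A _ => ?_
      rw [zero_mul, Nat.zero_div, hz, mul_zero]
    · obtain ⟨i, m, rfl, hm⟩ := exists_eq_pow_mul_coprime (p := p) hM
      have ht : ∀ m : ℕ, m.Coprime p → (m : k) * tcoeff p 0 (p ^ i * m) (eigenForm p φ d P) =
          PowerSeries.coeff i d * PowerSeries.coeff m φ := fun m hm => by
        rw [tcoeff_eigenForm_zero h0, coeff_frobSum_antiTheta φ d hm, mul_left_comm,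
          mul_div_cancel₀ _ (cast_ne_zero_of_coprime hm)]
      apply mul_right_cancel₀ (cast_ne_zero_of_coprime (k := k) hm)
      rw [sum_hecke_zero hn hnp fun m => tcoeff p 0 m (eigenForm p φ d P), pow_zero, mul_one,
        mul_assoc, mul_comm _ (m : k), ht m hm, mul_left_comm, ← hφ.away n m hn hnp,
        Finset.mul_sum]
      refine Finset.sum_congr rfl fun A hA => ?_
      rw [ht, mul_left_comm]
      obtain ⟨B, D, hA0, rfl, rfl, h⟩ :=
        exists_eq_mul_of_mem_divisors_gcd hn (Finset.mem_filter.1 hA).1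
      have h1 := h 1
      rw [one_mul, one_mul] at h1
      rw [h1]
      exact (Nat.Coprime.coprime_mul_left hm).mul_left (Nat.Coprime.coprime_mul_left hnp)
  by_cases hl' : ∃ s, l = p ^ s
  · obtain ⟨s, rfl⟩ := hl'
    by_cases hM : p ^ (s + 1) ∣ M
    · obtain ⟨M, rfl⟩ := hM
      have ht : ∀ m, tcoeff p (p ^ s) (p ^ (s + 1) * m) (eigenForm p φ d P) =
          P.coeff s * PowerSeries.coeff m φ := fun m => by
        rw [tcoeff_eigenForm_pow h0, if_pos (dvd_mul_right _ _),
          Nat.mul_div_cancel_left _ (pow_pos hp.out.pos _)]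
      rw [sum_hecke_pow hn hnp fun m => tcoeff p (p ^ s) m (eigenForm p φ d P), ht,
        cast_pow_pow_char, mul_comm (lam n), mul_assoc, mul_left_comm (lam n),
        ← hφ.away n M hn hnp, Finset.mul_sum (a := P.coeff s)]
      congr 1
      refine Finset.sum_congr rfl fun A _ => ?_
      rw [ht, mul_left_comm]
    · rw [tcoeff_eigenForm_pow h0, if_neg hM, mul_zero, mul_zero]
      refine Finset.sum_eq_zero fun A hA => ?_
      rw [tcoeff_eigenForm_pow h0, if_neg, mul_zero, mul_zero]
      obtain ⟨B, D, hA0, rfl, rfl, h⟩ :=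
        exists_eq_mul_of_mem_divisors_gcd hn (Finset.mem_filter.1 hA).1
      have h1 := h 1
      rw [one_mul, one_mul] at h1
      rw [h1]
      intro h2
      have h3 : (p ^ (s + 1)).Coprime B :=
        (Nat.Coprime.coprime_mul_left hnp).symm.pow_left _
      exact hM ((h3.dvd_of_dvd_mul_right h2).mul_left A)
  · rw [not_exists] at hl'
    rw [tcoeff_eigenForm_of_ne h0 d P hl hl', mul_zero]
    refine Finset.sum_eq_zero fun A _ => ?_
    rw [tcoeff_eigenForm_of_ne h0 d P hl hl', mul_zero]

end EigenSpace

/-! ## The Frobenius module structure -/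

section Frobenius

open MvPolynomial

variable {k : Type*} [Field k]

theorem exists_basis_of_smul_eq_zero {R V : Type*} [Ring R] [AddCommGroup V] [Module R V] {v : V}
    (hv : ∀ r : R, r • v = 0 → r = 0) :
    ∃ M : Submodule R V, (∀ x, x ∈ M ↔ ∃ r : R, r • v = x) ∧
      ∃ b : Module.Basis Unit R M, (b ()).1 = v := by
  have hinj : Function.Injective (LinearMap.toSpanSingleton R V v) := by
    rw [injective_iff_map_eq_zero]
    exact fun r hr => hv r hr
  refine ⟨LinearMap.range (LinearMap.toSpanSingleton R V v), fun x => Iff.rfl,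
    (Module.Basis.singleton Unit R).map (LinearEquiv.ofInjective _ hinj), ?_⟩
  simp

variable {p N κ : ℕ} {lam ζ : ℕ → k} {lamp : k}

theorem isEigenPair_one : IsEigenPair p κ lamp 1
    (Polynomial.C ((p : k) ^ κ) * Polynomial.X - Polynomial.C lamp) := by
  rw [IsEigenPair, mul_one, Polynomial.coe_sub, Polynomial.coe_mul, Polynomial.coe_C,
    Polynomial.coe_C, Polynomial.coe_X]

theorem IsEigenPair.mul {d : k⟦X⟧} {P : Polynomial k} (h : IsEigenPair p κ lamp d P)
    (Q : Polynomial k) : IsEigenPair p κ lamp (Q * d) (Q * P) := by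
  rw [IsEigenPair] at h ⊢
  rw [Polynomial.coe_mul, h, mul_left_comm]

variable [hp : Fact p.Prime]

theorem eigenForm_add {φ : k⟦X⟧} (h0 : PowerSeries.coeff 0 φ = 0) (d d' : k⟦X⟧)
    (P P' : Polynomial k) :
    eigenForm p φ d P + eigenForm p φ d' P' = eigenForm p φ (d + d') (P + P') := by
  refine eq_eigenForm h0 ?_ (fun i m hm => ?_) (fun s M => ?_) fun n M hn hn' => ?_
  · simp only [tcoeff_add, tcoeff_eigenForm_zero h0, coeff_zero_frobSum p _ coeff_zero_antiTheta,
      add_zero]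
  · rw [tcoeff_add, tcoeff_eigenForm_zero h0, tcoeff_eigenForm_zero h0,
      coeff_frobSum_antiTheta φ _ hm, coeff_frobSum_antiTheta φ _ hm, map_add, add_mul]
  · rw [tcoeff_add, tcoeff_eigenForm_pow h0, tcoeff_eigenForm_pow h0, Polynomial.coeff_add,
      add_mul]
  · rw [tcoeff_add, tcoeff_eigenForm_of_ne h0 _ _ hn hn', tcoeff_eigenForm_of_ne h0 _ _ hn hn',
      add_zero]

theorem eigenForm_smul {φ : k⟦X⟧} (h0 : PowerSeries.coeff 0 φ = 0) (c : k) (d : k⟦X⟧)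
    (P : Polynomial k) : c • eigenForm p φ d P = eigenForm p φ (c • d) (c • P) := by
  refine eq_eigenForm h0 ?_ (fun i m hm => ?_) (fun s M => ?_) fun n M hn hn' => ?_
  · simp only [tcoeff_smul, tcoeff_eigenForm_zero h0, coeff_zero_frobSum p _ coeff_zero_antiTheta,
      mul_zero]
  · rw [tcoeff_smul, tcoeff_eigenForm_zero h0, coeff_frobSum_antiTheta φ _ hm,
      PowerSeries.coeff_smul, smul_eq_mul, mul_assoc]
  · rw [tcoeff_smul, tcoeff_eigenForm_pow h0, Polynomial.coeff_smul, smul_eq_mul, mul_assoc]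
  · rw [tcoeff_smul, tcoeff_eigenForm_of_ne h0 _ _ hn hn', mul_zero]

/-- `F_{/k}` acts as `V` on series and sends `V^(s+1)(φ) (q'/q^p)^(p^s)` to the term of index `s +
1`, so it shifts both parameters by `X`. -/
theorem relFrob_eigenForm {φ : k⟦X⟧} (h0 : PowerSeries.coeff 0 φ = 0) (d : k⟦X⟧)
    (P : Polynomial k) : relFrob k p (eigenForm p φ d P) =
      eigenForm p φ (PowerSeries.X * d) (Polynomial.X * P) := by
  refine eq_eigenForm h0 ?_ (fun i m hm => ?_) (fun s M => ?_) fun n M hn hn' => ?_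
  · rw [tcoeff_relFrob, Nat.zero_div, tcoeff_eigenForm_zero h0,
      coeff_zero_frobSum p _ coeff_zero_antiTheta, ite_self]
  · rw [tcoeff_relFrob, Nat.zero_div]
    cases i with
    | zero =>
      rw [PowerSeries.coeff_zero_X_mul, zero_mul, if_neg]
      rintro ⟨h, _⟩
      rw [pow_zero, one_mul] at h
      exact (Nat.Prime.coprime_iff_not_dvd hp.out).1 hm.symm h
    | succ i =>
      rw [PowerSeries.coeff_succ_X_mul, pow_succ', mul_assoc,
        if_pos ⟨dvd_mul_right _ _, dvd_zero p⟩, Nat.mul_div_cancel_left _ hp.out.pos,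
        tcoeff_eigenForm_zero h0, coeff_frobSum_antiTheta φ _ hm]
  · rw [tcoeff_relFrob]
    cases s with
    | zero =>
      rw [Polynomial.coeff_X_mul_zero, zero_mul, if_neg]
      rintro ⟨_, h⟩
      rw [pow_zero, Nat.dvd_one] at h
      exact hp.out.ne_one h
    | succ s =>
      rw [Polynomial.coeff_X_mul, pow_succ p s, Nat.mul_div_cancel _ hp.out.pos]
      by_cases hM : p ∣ M
      · obtain ⟨M, rfl⟩ := hM
        rw [if_pos ⟨dvd_mul_right _ _, dvd_mul_left _ _⟩, Nat.mul_div_cancel_left _ hp.out.pos,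
          tcoeff_eigenForm_pow h0, pow_succ' p (s + 1)]
        simp only [Nat.mul_dvd_mul_iff_left hp.out.pos, Nat.mul_div_mul_left _ _ hp.out.pos]
      · rw [if_neg fun h => hM h.1,
          if_neg fun h => hM ((dvd_pow_self p (Nat.succ_ne_zero _)).trans h), mul_zero]
  · rw [tcoeff_relFrob]
    split_ifs with h
    · obtain ⟨n, rfl⟩ := h.2
      rw [Nat.mul_div_cancel_left _ hp.out.pos]
      refine tcoeff_eigenForm_of_ne h0 _ _ (right_ne_zero_of_mul hn) (fun s hs => ?_) _
      exact hn' (s + 1) (by rw [hs, pow_succ'])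
    · rfl

theorem aeval_relFrob_eigenForm {φ : k⟦X⟧} (h0 : PowerSeries.coeff 0 φ = 0) (d : k⟦X⟧)
    (P Q : Polynomial k) :
    Polynomial.aeval (relFrob k p).toLinearMap Q (eigenForm p φ d P) =
      eigenForm p φ (Q * d) (Q * P) := by
  induction Q using Polynomial.induction_on with
  | C a =>
    rw [Polynomial.aeval_C, Module.algebraMap_end_apply, eigenForm_smul h0, Polynomial.coe_C,
      ← PowerSeries.smul_eq_C_mul, Polynomial.smul_eq_C_mul]
  | add Q Q' hQ hQ' =>
    rw [map_add, LinearMap.add_apply, hQ, hQ', eigenForm_add h0, Polynomial.coe_add, add_mul,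
      add_mul]
  | monomial n a h =>
    rw [pow_succ', mul_left_comm, map_mul, Module.End.mul_apply, h, Polynomial.aeval_X,
      AlgHom.toLinearMap_apply, relFrob_eigenForm h0, Polynomial.coe_mul Polynomial.X,
      Polynomial.coe_X, mul_assoc PowerSeries.X, mul_assoc Polynomial.X]

theorem frobSum_antiTheta_eq_zero {φ d : k⟦X⟧} (h1 : PowerSeries.coeff 1 φ ≠ 0)
    (h : frobSum p d (antiTheta p φ) = 0) : d = 0 := by
  ext i
  have h2 := congrArg (PowerSeries.coeff (p ^ i * 1)) h
  rw [coeff_frobSum_antiTheta φ d (Nat.coprime_one_left p), map_zero, Nat.cast_one, div_one] at h2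
  rw [map_zero]
  exact (mul_eq_zero.1 h2).resolve_right h1

theorem eigenForm_eq_zero {φ d : k⟦X⟧} {P : Polynomial k} (h0 : PowerSeries.coeff 0 φ = 0)
    (h1 : PowerSeries.coeff 1 φ ≠ 0) (h : eigenForm p φ d P = 0) : d = 0 := by
  refine frobSum_antiTheta_eq_zero (p := p) h1 (PowerSeries.ext fun M => ?_)
  rw [← tcoeff_eigenForm_zero h0 d P, h, tcoeff_zero, map_zero]

theorem sharpTwo_eq_eigenForm {φ : k⟦X⟧} (h0 : PowerSeries.coeff 0 φ = 0) :
    sharpTwo p κ lamp φ = eigenForm p φ 1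
      (Polynomial.C ((p : k) ^ κ) * Polynomial.X - Polynomial.C lamp) := by
  have h : sharpTwo p κ lamp φ = C (antiTheta p φ) + (-lamp) • sharpTerm p 0 φ +
      (p : k) ^ κ • sharpTerm p 1 φ := by
    rw [sharpTwo, neg_smul, ← sub_eq_add_neg, sharpTerm_zero, sharpTerm, pow_one]
    rfl
  have ht : ∀ n M, tcoeff p n M (sharpTwo p κ lamp φ) =
      (if n = 0 then PowerSeries.coeff M (antiTheta p φ) else 0) +
      -lamp * (if n = p ^ 0 then
        (if p ^ (0 + 1) ∣ M then PowerSeries.coeff (M / p ^ (0 + 1)) φ else 0) else 0) +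
      (p : k) ^ κ * (if n = p ^ 1 then
        (if p ^ (1 + 1) ∣ M then PowerSeries.coeff (M / p ^ (1 + 1)) φ else 0) else 0) :=
    fun n M => by
      rw [h, tcoeff_add, tcoeff_add, tcoeff_smul, tcoeff_smul, tcoeff_C, tcoeff_sharpTerm h0,
        tcoeff_sharpTerm h0]
  have hpow : ∀ s : ℕ, p ^ s ≠ 0 := fun s => pow_ne_zero s hp.out.ne_zero
  have hinj : ∀ s t : ℕ, p ^ s = p ^ t ↔ s = t := fun s t =>
    (Nat.pow_right_injective hp.out.two_le).eq_iff
  refine eq_eigenForm h0 ?_ (fun i m hm => ?_) (fun s M => ?_) fun n M hn hn' => ?_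
  · rw [ht, if_neg (hpow 0).symm, if_neg (hpow 1).symm, if_pos rfl, coeff_zero_antiTheta]
    ring
  · have h2 := coeff_vOp_iterate_antiTheta_pow_mul φ hm i 0
    rw [Function.iterate_zero_apply] at h2
    rw [ht, if_neg (hpow 0).symm, if_neg (hpow 1).symm, if_pos rfl, h2, PowerSeries.coeff_one]
    by_cases hi : i = 0
    · subst hi
      rw [if_pos rfl, if_pos rfl]
      ring
    · rw [if_neg hi, if_neg (Ne.symm hi)]
      ring
  · rw [ht, if_neg (hpow s)]
    simp only [hinj]
    generalize (p : k) ^ κ = c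
    match s with
    | 0 => simp
    | 1 => simp [Polynomial.coeff_C_succ]
    | s + 2 => simp [Polynomial.coeff_C_succ]
  · rw [ht, if_neg hn, if_neg (hn' 0), if_neg (hn' 1)]
    ring

/-- `U` discards the exponents prime to `p`, that is the contribution of `d_0`; the remaining ones
detect every `d_(i+1)`. -/
theorem isPrimitiveSeries_eigenForm_iff {φ : k⟦X⟧} (h0 : PowerSeries.coeff 0 φ = 0)
    (h1 : PowerSeries.coeff 1 φ ≠ 0) (d : k⟦X⟧) (P : Polynomial k) :
    IsPrimitiveSeries p (eigenForm p φ d P) ↔ ∀ i, PowerSeries.coeff (i + 1) d = 0 := by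
  have h2 : ∀ m, PowerSeries.coeff m (uOp p (atZero (eigenForm p φ d P))) =
      PowerSeries.coeff (m * p) (frobSum p d (antiTheta p φ)) := fun m => by
    rw [uOp, PowerSeries.coeff_mk, coeff_atZero (p := p), tcoeff_eigenForm_zero h0]
  constructor
  · intro h i
    have h3 := h2 (p ^ i)
    rw [h, map_zero, ← pow_succ, ← mul_one (p ^ (i + 1)),
      coeff_frobSum_antiTheta φ d (Nat.coprime_one_left p), Nat.cast_one, div_one] at h3
    exact (mul_eq_zero.1 h3.symm).resolve_right h1
  · intro h
    refine PowerSeries.ext fun m => ?_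
    rw [h2, map_zero]
    by_cases hm0 : m = 0
    · rw [hm0, zero_mul, coeff_zero_frobSum p _ coeff_zero_antiTheta]
    · obtain ⟨i, m, rfl, hm⟩ := exists_eq_pow_mul_coprime (p := p) hm0
      rw [mul_right_comm, ← pow_succ, coeff_frobSum_antiTheta φ d hm, h, zero_mul]

/-- If the polynomials `P` of all eigenpairs are divisible by one of them, the `eigenSpace` is a
free module of rank one over `k[F_{/k}]`. -/
theorem exists_basis_eigenSpace [CharP k p] [PerfectRing k p] (hp2 : p ≠ 2)
    (hζ : ∀ n : ℕ, 1 ≤ n → n.Coprime p → IsPrimitiveRoot (ζ n) n) {φ : k⟦X⟧} (hφ0 : φ ≠ 0)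
    (hφ : IsHeckeSystem p N κ lam lamp φ)
    (hne : Polynomial.C ((p : k) ^ κ) * Polynomial.X - Polynomial.C lamp ≠ 0)
    {e : k⟦X⟧} {R : Polynomial k} (he0 : e ≠ 0) (he : IsEigenPair p κ lamp e R)
    (hdvd : ∀ d P, IsEigenPair p κ lamp d P → R ∣ P) :
    ∃ M : Submodule (Polynomial k) (Module.AEval' (relFrob k p).toLinearMap),
      (∀ f : DSer Unit k, f ∈ eigenSpace p N κ ζ lam lamp ↔
        Module.AEval'.of (relFrob k p).toLinearMap f ∈ M) ∧
      ∃ b : Module.Basis Unit (Polynomial k) M,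
        (b ()).1 = Module.AEval'.of (relFrob k p).toLinearMap (eigenForm p φ e R) := by
  have h0 := hφ.coeff_zero
  have h1 := hφ.coeff_one_ne_zero hφ0
  have hsmul : ∀ Q : Polynomial k, Q • Module.AEval'.of (relFrob k p).toLinearMap
      (eigenForm p φ e R) = Module.AEval'.of (relFrob k p).toLinearMap
        (eigenForm p φ (Q * e) (Q * R)) := fun Q => by
    rw [← aeval_relFrob_eigenForm h0]
    rfl
  obtain ⟨M, hM, hb⟩ := exists_basis_of_smul_eq_zero (R := Polynomial k)
    (v := Module.AEval'.of (relFrob k p).toLinearMap (eigenForm p φ e R)) (by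
      intro Q hQ
      rw [hsmul, LinearEquiv.map_eq_zero_iff] at hQ
      have h2 := (mul_eq_zero.1 (eigenForm_eq_zero h0 h1 hQ)).resolve_right he0
      exact Polynomial.coe_injective k (h2.trans Polynomial.coe_zero.symm))
  refine ⟨M, fun f => ?_, hb⟩
  rw [hM]
  constructor
  · intro hf
    obtain ⟨d, P, hdP, rfl⟩ := exists_eq_eigenForm hp2 hζ hφ0 hφ hf
    obtain ⟨Q, rfl⟩ := hdvd d P hdP
    refine ⟨Q, ?_⟩
    rw [hsmul, mul_comm R Q]
    have h2 : (PowerSeries.C ((p : k) ^ κ) * PowerSeries.X - PowerSeries.C lamp : k⟦X⟧) ≠ 0 := by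
      intro h
      refine hne (Polynomial.coe_injective k ?_)
      rw [Polynomial.coe_sub, Polynomial.coe_mul, Polynomial.coe_C, Polynomial.coe_C,
        Polynomial.coe_X, h, Polynomial.coe_zero]
    -- As `p^κ X - lamp` is nonzero in the domain `k[[X]]`, the polynomial of an eigenpair
    -- determines its series.
    have h3 : d = Q * e := by
      apply mul_left_cancel₀ h2
      have h4 := he.mul Q
      rw [IsEigenPair] at h4 hdP
      rw [← h4, ← hdP, mul_comm]
    rw [h3]
  · rintro ⟨Q, hQ⟩
    rw [hsmul] at hQ
    rw [← (Module.AEval'.of (relFrob k p).toLinearMap).injective hQ]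
    exact eigenForm_mem_eigenSpace hζ hφ (he.mul Q)

theorem tcoeff_eigenForm_congr {φ d d' : k⟦X⟧} {P P' : Polynomial k}
    (h0 : PowerSeries.coeff 0 φ = 0) {n M : ℕ}
    (hd : ∀ i ≤ M, PowerSeries.coeff i d = PowerSeries.coeff i d')
    (hP : ∀ s ≤ n, P.coeff s = P'.coeff s) :
    tcoeff p n M (eigenForm p φ d P) = tcoeff p n M (eigenForm p φ d' P') := by
  by_cases hn : n = 0
  · rw [hn, tcoeff_eigenForm_zero h0, tcoeff_eigenForm_zero h0, frobSum, frobSum,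
      PowerSeries.coeff_mk, PowerSeries.coeff_mk]
    exact Finset.sum_congr rfl fun i hi => by
      rw [hd i (Nat.lt_succ_iff.1 (Finset.mem_range.1 hi))]
  · by_cases hn' : ∃ s, n = p ^ s
    · obtain ⟨s, rfl⟩ := hn'
      rw [tcoeff_eigenForm_pow h0, tcoeff_eigenForm_pow h0,
        hP s (Nat.lt_pow_self hp.out.one_lt).le]
    · rw [not_exists] at hn'
      rw [tcoeff_eigenForm_of_ne h0 _ _ hn hn', tcoeff_eigenForm_of_ne h0 _ _ hn hn']

/-- The sum `∑ c_i F_{/k} ^ i` of an `eigenForm` is an `eigenForm`. -/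
theorem hasFrobSum_eigenForm {φ : k⟦X⟧} (h0 : PowerSeries.coeff 0 φ = 0) {P R : Polynomial k}
    (c : ℕ → k) (hP : IsEigenPair p κ lamp 1 P) (hR : IsEigenPair p κ lamp (PowerSeries.mk c) R) :
    HasFrobSum p c (eigenForm p φ 1 P) (eigenForm p φ (PowerSeries.mk c) R) := by
  intro m m'
  -- The coefficient involves only `d_i` for `i ≤ m + p m'` and `P_s` for `s ≤ m'`; beyond this
  -- bound the partial sums have the right parameters.
  filter_upwards [Filter.eventually_gt_atTop (m + p * m' + m')] with n hn
  let E : Polynomial k := ∑ i ∈ Finset.range n, Polynomial.monomial i (c i)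
  have hE : ∀ i < n, PowerSeries.coeff i (E : k⟦X⟧) = PowerSeries.coeff i (PowerSeries.mk c) := by
    intro i hi
    rw [Polynomial.coeff_coe, PowerSeries.coeff_mk]
    simp only [E, Polynomial.finsetSum_coeff, Polynomial.coeff_monomial]
    rw [Finset.sum_ite_eq', if_pos (Finset.mem_range.2 hi)]
  have hsum : ∑ i ∈ Finset.range n, c i • (relFrob k p)^[i] (eigenForm p φ 1 P) =
      eigenForm p φ (E * 1) (E * P) := by
    rw [← aeval_relFrob_eigenForm h0, map_sum, LinearMap.sum_apply]
    refine Finset.sum_congr rfl fun i _ => ?_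
    rw [Polynomial.aeval_monomial, Module.End.mul_apply, Module.algebraMap_end_apply,
      Module.End.pow_apply]
    rfl
  have hEP := isEigenPair_iff.1 (hP.mul E)
  rw [mul_one] at hEP hsum
  rw [hsum, dcoeff_eq_tcoeff p, dcoeff_eq_tcoeff p]
  refine tcoeff_eigenForm_congr h0 (fun i hi => hE i (by omega)) fun s hs => ?_
  rw [isEigenPair_iff] at hR
  cases s with
  | zero => rw [hEP.1, hR.1, hE 0 (by omega)]
  | succ s => rw [hEP.2, hR.2, hE s (by omega), hE (s + 1) (by omega)]

end Frobenius

end DeltaHecke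

end

/-! ### The corollary: case distinction on `p^κ X - lamp`. -/

theorem mainTheorem8 (p : ℕ) [Fact p.Prime] (hp : 5 ≤ p)
    (k : Type*) [Field k] [Algebra (ZMod p) k] [IsAlgClosure (ZMod p) k]
    (N : ℕ) (hN : 4 ≤ N) (hNp : N.Coprime p)
    (ζ : ℕ → k) (hζ : ∀ n : ℕ, 1 ≤ n → n.Coprime p → IsPrimitiveRoot (ζ n) n)
    (κ : ℕ) (lam : ℕ → k) (lamp : k) :
    (eigenSpace p N κ ζ lam lamp ≠ ⊥ ↔
      ∃ φ : k⟦X⟧, IsClassicalEigen p N κ lam lamp φ) ∧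
    ∀ φ : k⟦X⟧, IsClassicalEigen p N κ lam lamp φ →
      (sharpTwo p κ lamp φ ∈ eigenSpace p N κ ζ lam lamp ∧
        IsPrimitiveSeries p (sharpTwo p κ lamp φ) ∧
        ∀ f ∈ eigenSpace p N κ ζ lam lamp, IsPrimitiveSeries p f →
          ∃ c : k, f = c • sharpTwo p κ lamp φ) ∧
      (0 < κ → lamp = 0 →
        sharpTwo p κ lamp φ = DSer.ofSeries (antiTheta p φ) ∧
        ∃ M : Submodule k⟦X⟧ (QSeries p k),
          (∀ f : DSer Unit k, f ∈ eigenSpace p N κ ζ lam lamp ↔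
            ∃ g ∈ M, f = DSer.ofSeries g.toSeries) ∧
          ∃ b : Module.Basis Unit k⟦X⟧ M,
            DSer.ofSeries (b ()).1.toSeries = sharpTwo p κ lamp φ) ∧
      ((0 < κ ∧ lamp ≠ 0) ∨ (κ = 0 ∧ lamp = 0) →
        ∃ M : Submodule (Polynomial k)
            (Module.AEval' (relFrob k p).toLinearMap),
          (∀ f : DSer Unit k, f ∈ eigenSpace p N κ ζ lam lamp ↔
            Module.AEval'.of (relFrob k p).toLinearMap f ∈ M) ∧
          ∃ b : Module.Basis Unit (Polynomial k) M,
            (b ()).1 = Module.AEval'.of (relFrob k p).toLinearMap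
              (sharpTwo p κ lamp φ)) ∧
      (κ = 0 → lamp ≠ 0 →
        ∃ sharpOne : DSer Unit k,
          HasFrobSum p (fun i => lamp⁻¹ ^ i) (sharpTwo p κ lamp φ)
            sharpOne ∧
          ∃ M : Submodule (Polynomial k)
              (Module.AEval' (relFrob k p).toLinearMap),
            (∀ f : DSer Unit k, f ∈ eigenSpace p N κ ζ lam lamp ↔
              Module.AEval'.of (relFrob k p).toLinearMap f ∈ M) ∧
            ∃ b : Module.Basis Unit (Polynomial k) M,
              (b ()).1 = Module.AEval'.of (relFrob k p).toLinearMap sharpOne) := by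

  have : CharP k p := charP_of_injective_algebraMap (algebraMap (ZMod p) k).injective p
  have : IsAlgClosed k := IsAlgClosure.isAlgClosed (ZMod p)
  have : PerfectRing k p := inferInstance
  have hp2 : p ≠ 2 := by omega
  refine ⟨⟨fun h => ?_, fun ⟨φ, hφ⟩ => ?_⟩, fun φ hφ => ?_⟩
  · obtain ⟨f, hf, hne⟩ := (Submodule.ne_bot_iff _).1 h
    obtain ⟨φ, hφ0, hφ⟩ := (hf.2.resolve_left hne).exists_isHeckeSystem hp2 hζ hf.1 hne
    exact ⟨φ, isClassicalEigen_iff.2 ⟨hφ0, hφ⟩⟩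
  · obtain ⟨hφ0, hφ⟩ := isClassicalEigen_iff.1 hφ
    refine (Submodule.ne_bot_iff _).2
      ⟨_, eigenForm_mem_eigenSpace hζ hφ isEigenPair_one, fun h => ?_⟩
    exact one_ne_zero (eigenForm_eq_zero hφ.coeff_zero (hφ.coeff_one_ne_zero hφ0) h)
  obtain ⟨hφ0, hφ⟩ := isClassicalEigen_iff.1 hφ
  have h0 := hφ.coeff_zero
  have h1 := hφ.coeff_one_ne_zero hφ0
  rw [sharpTwo_eq_eigenForm h0]
  refine ⟨⟨eigenForm_mem_eigenSpace hζ hφ isEigenPair_one, ?_, fun f hf hprim => ?_⟩, ?_, ?_, ?_⟩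
  · rw [isPrimitiveSeries_eigenForm_iff h0 h1]
    intro i
    rw [PowerSeries.coeff_one, if_neg (Nat.succ_ne_zero i)]
  · obtain ⟨d, P, hdP, rfl⟩ := exists_eq_eigenForm hp2 hζ hφ0 hφ hf
    rw [isPrimitiveSeries_eigenForm_iff h0 h1] at hprim
    refine ⟨PowerSeries.coeff 0 d, ?_⟩
    have hd : d = PowerSeries.C (PowerSeries.coeff 0 d) := by
      ext i
      cases i with
      | zero => simp
      | succ i => rw [hprim, PowerSeries.coeff_C, if_neg (Nat.succ_ne_zero i)]
    have hd' : d = PowerSeries.coeff 0 d • (1 : k⟦X⟧) := by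
      rw [PowerSeries.smul_eq_C_mul, mul_one, ← hd]
    have hP : P = PowerSeries.coeff 0 d •
        (Polynomial.C ((p : k) ^ κ) * Polynomial.X - Polynomial.C lamp) := by
      apply Polynomial.coe_injective k
      have h2 := (isEigenPair_one (p := p) (κ := κ) (lamp := lamp)).mul
        (Polynomial.C (PowerSeries.coeff 0 d))
      rw [IsEigenPair, mul_one, Polynomial.coe_C, ← hd] at h2
      rw [Polynomial.smul_eq_C_mul, h2, hdP]
    rw [eigenForm_smul h0, ← hP, ← hd']
  · intro hκ hl
    subst hl
    have hR : Polynomial.C ((p : k) ^ κ) * Polynomial.X - Polynomial.C 0 = 0 := by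
      rw [CharP.cast_eq_zero, zero_pow hκ.ne', map_zero, zero_mul, sub_zero]
    -- The factor `p^κ X - lamp` is zero here, so `P = 0` and `d` is arbitrary.
    have hpair : ∀ (d : k⟦X⟧) (P : Polynomial k), IsEigenPair p κ 0 d P ↔ P = 0 := fun d P => by
      rw [IsEigenPair, CharP.cast_eq_zero, zero_pow hκ.ne', map_zero, zero_mul, sub_zero, zero_mul,
        ← Polynomial.coe_zero]
      exact (Polynomial.coe_injective k).eq_iff
    have hform : ∀ d : k⟦X⟧, eigenForm p φ d 0 = DSer.ofSeries (frobSum p d (antiTheta p φ)) :=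
      fun d => by
        rw [eigenForm, sharpForm, Polynomial.support_zero, Finset.sum_empty, add_zero]
    have hone : frobSum p 1 (antiTheta p φ) = antiTheta p φ := by
      ext m
      rw [frobSum, PowerSeries.coeff_mk, Finset.sum_range_succ']
      simp [PowerSeries.coeff_one]
    rw [hR, hform, hone]
    let v : QSeries p k := ⟨antiTheta p φ, coeff_zero_antiTheta⟩
    have hv : ∀ d : k⟦X⟧, (d • v).toSeries = frobSum p d (antiTheta p φ) := fun d => rfl
    obtain ⟨M, hM, b, hb⟩ := exists_basis_of_smul_eq_zero (R := k⟦X⟧) (v := v) fun d hd => by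
      refine frobSum_antiTheta_eq_zero (p := p) h1 ?_
      rw [← hv, hd]
      rfl
    refine ⟨rfl, M, fun f => ⟨fun hf => ?_, ?_⟩, b, by rw [hb]; rfl⟩
    · obtain ⟨d, P, hdP, rfl⟩ := exists_eq_eigenForm hp2 hζ hφ0 hφ hf
      rw [(hpair d P).1 hdP, hform]
      exact ⟨d • v, (hM _).2 ⟨d, rfl⟩, by rw [hv]⟩
    · rintro ⟨g, hg, rfl⟩
      obtain ⟨d, rfl⟩ := (hM g).1 hg
      rw [hv, ← hform]
      exact eigenForm_mem_eigenSpace hζ hφ ((hpair d 0).2 rfl)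
  · intro hcase
    have hR : Polynomial.C ((p : k) ^ κ) * Polynomial.X - Polynomial.C lamp ≠ 0 := by
      intro h
      rcases hcase with ⟨_, hl⟩ | ⟨rfl, _⟩
      · have h2 := congrArg (fun Q => Polynomial.coeff Q 0) h
        simp [hl] at h2
      · have h2 := congrArg (fun Q => Polynomial.coeff Q 1) h
        simp at h2
    refine exists_basis_eigenSpace hp2 hζ hφ0 hφ hR one_ne_zero isEigenPair_one fun d P hdP => ?_
    -- In the first case the factor is the unit `-lamp`; in the second it is `X`, and `P` has
    -- constant term `-lamp d_0 = 0`.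
    rcases hcase with ⟨hκ, hl⟩ | ⟨rfl, rfl⟩
    · rw [CharP.cast_eq_zero, zero_pow hκ.ne', map_zero, zero_mul, zero_sub, neg_dvd]
      exact ((Polynomial.isUnit_C.2 (isUnit_iff_ne_zero.2 hl))).dvd
    · rw [pow_zero, map_one, one_mul, map_zero, sub_zero, Polynomial.X_dvd_iff,
        (isEigenPair_iff.1 hdP).1, zero_mul, neg_zero]
  · intro hκ hl
    subst hκ
    -- Geometric series: `(X - lamp) ∑ lamp^(-i) X^i = -lamp`, a unit that divides every `P`.
    have hpair : IsEigenPair p 0 lamp (PowerSeries.mk fun i => lamp⁻¹ ^ i)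
        (Polynomial.C (-lamp)) := by
      rw [isEigenPair_iff]
      refine ⟨by simp, fun i => ?_⟩
      rw [Polynomial.coeff_C, if_neg (Nat.succ_ne_zero i), PowerSeries.coeff_mk,
        PowerSeries.coeff_mk, pow_zero, one_mul, pow_succ', mul_inv_cancel_left₀ hl, sub_self]
    refine ⟨_, hasFrobSum_eigenForm h0 (fun i => lamp⁻¹ ^ i) isEigenPair_one hpair,
      exists_basis_eigenSpace hp2 hζ hφ0 hφ ?_ ?_ hpair fun d P _ => ?_⟩
    · intro h
      have h2 := congrArg (fun Q => Polynomial.coeff Q 1) h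
      simp at h2
    · intro h
      have h2 := congrArg (PowerSeries.coeff 0) h
      simp at h2
    · exact (Polynomial.isUnit_C.2 (isUnit_iff_ne_zero.2 (neg_ne_zero.2 hl))).dvd
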